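/- **Setting.** Let $M$ be a compact Hausdorff smooth $n$-dimensional manifold with corners, with $\partial M\neq\emptyset$ and interior $M_0$. Let $F_1,\dots,F_N$ be its closed codimension one faces (the closures of the connected components of the set of boundary points of depth one), and suppose that each $F_i$ has a boundary defining function $\rho_i$: a smooth $\rho_i\ge 0$ with $F_i=\{\rho_i=0\}$ and $d\rho_i\ne0$ on $F_i$. Put $\rho=\rho_1\cdots\rho_N$. A *Lie structure* on $M$ is a finitely generated projective $C^\infty(M)$-module $\mathcal V$ of smooth vector fields on $M$ that is closed under the Lie bracket, consists of vector fields tangent to all boundary faces, and contains all smooth vector fields with support in $M_0$. Let $\mathcal A\to M$ be the vector bundle with $\Gamma(\mathcal A)=\mathcal V$ (so $\mathcal A|_{M_0}=TM_0$) and $\Omega^1(\mathcal A)$ its bundle of complex one-densities. For $f\in\Gamma^\infty(M,\Omega^1(\mathcal A))$ put $$G(f)(z)=\int_M\rho^z f\quad(z\in\mathbb C),\qquad G(f)(z_1,\dots,z_N)=\int_M\rho_1^{z_1}\cdots\rho_N^{z_N}f .$$ $\mathcal V$ is *renormalizable* if there is a minimal $\kappa\in\mathbb R$ such that, for all $f$,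 the integral $G(f)(z)$ converges absolutely and is holomorphic on $\operatorname{Re}z>\kappa-1$ and extends meromorphically to $\mathbb C$. $\mathcal V$ is *exact* if every $p\in\partial M$ has coordinates $x_1,\dots,x_n$ around it (given by a smooth corner chart) and exponents $a_{ij}\in\mathbb N_0$ such that near $p$ the module $\mathcal V$ is generated by $$\Big(\prod_{j\in J}x_j^{a_{ij}}\Big)\partial_{x_i},\qquad i=1,\dots,n,$$ where $J$ is the set of those $j$ for which $x_j$ is a boundary coordinate with $x_j(p)=0$. If $p$ lies on one face only, defined by $x_1$ say, this means: $\mathcal V$ is generated by $x_1^{k_1}\partial_{x_1},\dots,x_1^{k_n}\partial_{x_n}$. **Proposition 5.4.** Let $\mathcal V$ be an exact Lie structure on $M$. Then $\mathcal V$ is renormalizable. More precisely: 1. Each face $F$ has a well-defined degeneracy index $k_F\in\mathbb N_0$: for all coordinates as above around all points of $F$, the sum $\sum_i a_{ij}$ of the exponents of the coordinate $x_j$ that defines $F$ there equals $k_F$. The minimal $\kappa$ is $\max_F k_F$. 2. For every $f$, the function $z\mapsto G(f)(z)$ on $\operatorname{Re} z>\max_F k_F-1$ extends meromorphically to $\mathbb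 C$, with poles only at the points $k_F-1-j$ ($F$ a face, $j\in\mathbb N_0$), of order at most the maximal depth (codimension of a corner) of $M$. In particular the poles are at most simple if no two faces of $M$ meet. 3. For every $f$, the integral $G(f)(z_1,\dots,z_N)$ converges absolutely for $\operatorname{Re}z_i>k_{F_i}-1$ ($i=1,\dots,N$), and extends meromorphically to $\mathbb C^N$ with at most simple poles, along the hyperplanes $z_i=k_{F_i}-1-j$, $j\in\mathbb N_0$. -/

import Mathlib

open Set Filter Topology MeasureTheory
open scoped Manifold ContDiff

namespace LieMfd

noncomputable section

/-- The standard model `[0,∞)ⁿ ⊆ ℝⁿ` of `n`-dimensional manifolds with corners. -/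
abbrev cornerModel (n : ℕ) :
    ModelWithCorners ℝ (EuclideanSpace ℝ (Fin n)) (EuclideanQuadrant n) :=
  modelWithCornersEuclideanQuadrant n

section Defs

variable (n : ℕ) (M : Type*) [TopologicalSpace M] [ChartedSpace (EuclideanQuadrant n) M]

/-- Real-valued smooth functions on the manifold with corners `M` (smooth up to the boundary). -/
abbrev SmoothFun : Type _ := C^∞⟮cornerModel n, M; 𝓘(ℝ, ℝ), ℝ⟯

/-- The depth of `p`: the number of boundary coordinates vanishing at `p`
(so depth `0` means interior point). -/
def depth {M : Type*} [TopologicalSpace M] [ChartedSpace (EuclideanQuadrant n) M] (p : M) : ℕ :=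
  Set.ncard {i : Fin n | extChartAt (cornerModel n) p p i = 0}

/-- The closed codimension one faces of `M`: the closures of the connected components of the
set of points of depth one. -/
def hyperfaces : Set (Set M) :=
  {F | ∃ p : M, depth n p = 1 ∧ F = closure (connectedComponentIn {q : M | depth n q = 1} p)}

variable {M}

/-- `ρ` is a boundary defining function of the closed codimension one face `F`: it is smooth and
nonnegative, its zero set is `F`, and its differential does not vanish on `F`. -/
structure IsBoundaryDefining (F : Set M) (ρ : SmoothFun n M) : Prop where
  nonneg : ∀ x, 0 ≤ ρ x
  zero_iff : ∀ x, ρ x = 0 ↔ x ∈ F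
  deriv_ne : ∀ x ∈ F, mfderiv (cornerModel n) 𝓘(ℝ, ℝ) ρ x ≠ 0

/-- `F₁, …, F_N` enumerates (without repetition) the closed codimension one faces of `M`,
and `ρ₁, …, ρ_N` are boundary defining functions for them. -/
structure IsHyperfaceSystem {N : ℕ} (F : Fin N → Set M) (ρ : Fin N → SmoothFun n M) : Prop where
  injective : Function.Injective F
  range_eq : Set.range F = hyperfaces n M
  defining : ∀ i, IsBoundaryDefining n (F i) (ρ i)

variable {n} in
/-- The differential of a smooth map `φ` from (part of) `M` to `ℝⁿ` at `x`, applied to a tangent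
vector. -/
def coordDeriv (φ : M → EuclideanSpace ℝ (Fin n)) (x : M)
    (X : TangentSpace (cornerModel n) x) : EuclideanSpace ℝ (Fin n) :=
  mfderiv (cornerModel n) 𝓘(ℝ, EuclideanSpace ℝ (Fin n)) φ x X

variable (M) [IsManifold (cornerModel n) ∞ M]

/-- Smooth vector fields on `M` (smooth up to the boundary). -/
abbrev VField : Type _ :=
  Cₛ^∞⟮cornerModel n; EuclideanSpace ℝ (Fin n), (TangentSpace (cornerModel n) : M → Type _)⟯

variable {n M}

/-- Pointwise multiplication of vector fields by smooth functions. -/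
instance : SMul (SmoothFun n M) (VField n M) :=
  ⟨fun a X => ⟨fun x => a x • X x, ContMDiff.smul_section a.contMDiff X.contMDiff⟩⟩

theorem smul_apply (a : SmoothFun n M) (X : VField n M) (x : M) : (a • X) x = a x • X x := rfl

instance : Module (SmoothFun n M) (VField n M) where
  one_smul X := by ext1 x; exact one_smul ℝ (X x)
  mul_smul a b X := by ext1 x; exact mul_smul (a x) (b x) (X x)
  smul_zero a := by ext1 x; exact smul_zero (a x)
  smul_add a X Y := by ext1 x; exact smul_add (a x) (X x) (Y x)
  add_smul a b X := by ext1 x; exact add_smul (a x) (b x) (X x)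
  zero_smul X := by ext1 x; exact zero_smul ℝ (X x)

variable (n M)

/-- A Lie structure on the manifold with corners `M`: a `C^∞(M)`-submodule of the smooth vector
fields which is finitely generated projective, closed under the Lie bracket, consists of vector
fields tangent to all boundary faces, and is unrestricted over the interior of `M` (so that the
associated Lie algebroid restricts to the tangent bundle of the interior). -/
structure LieStructure where
  /-- The module of vector fields. -/
  fields : Submodule (SmoothFun n M) (VField n M)
  finite : Module.Finite (SmoothFun n M) fields
  projective : Module.Projective (SmoothFun n M) fields
  bracket_mem : ∀ X ∈ fields, ∀ Y ∈ fields, ∃ Z ∈ fields, ∀ x : M,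
    Z x = VectorField.mlieBracket (cornerModel n) (fun y => X y) (fun y => Y y) x
  tangent : ∀ X ∈ fields, ∀ (p : M) (i : Fin n), extChartAt (cornerModel n) p p i = 0 →
    coordDeriv (extChartAt (cornerModel n) p) p (X p) i = 0
  full : ∀ X : VField n M, closure {x : M | X x ≠ 0} ⊆ (cornerModel n).interior M → X ∈ fields

variable {n M}

namespace LieStructure

variable (V : LieStructure n M)

/-- `v₁, …, v_n` is a local basis of the Lie structure `V` over the open set `U`: the `v_i` belong
to `V`, and over `U` every element of `V` is a combination of the `v_i` with coefficients smooth on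
`U`. (As `V` contains all directions in the interior, `n` local generators are a local frame of the
rank `n` bundle `A` with `Γ(A) = V`.) -/
structure IsLocalFrame (U : Set M) (v : Fin n → VField n M) : Prop where
  isOpen : IsOpen U
  mem : ∀ i, v i ∈ V.fields
  span : ∀ X ∈ V.fields, ∃ a : Fin n → M → ℝ,
    (∀ i, ContMDiffOn (cornerModel n) 𝓘(ℝ, ℝ) ∞ (a i) U) ∧
      ∀ x ∈ U, X x = ∑ i, a i x • v i x

/-- In the coordinates `x₁, …, x_n` given by the smooth chart `e` around `p`, the Lie structure is
generated near `p` by the vector fields `(∏_j x_j ^ (a i j)) ∂_{x_i}`, `i = 1, …, n`, where `j` runs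
over the boundary coordinates vanishing at `p` (the local boundary defining functions of the
faces through `p`). If `p` lies on only one face, with boundary defining
coordinate `x_j`, these are the `x_j ^ (a i j) ∂_{x_i}`. -/
def IsExactChart (p : M) (e : OpenPartialHomeomorph M (EuclideanQuadrant n))
    (a : Fin n → Fin n → ℕ) : Prop :=
  e ∈ IsManifold.maximalAtlas (cornerModel n) ∞ M ∧ p ∈ e.source ∧
    ∃ U ⊆ e.source, p ∈ U ∧ ∃ v : Fin n → VField n M, V.IsLocalFrame U v ∧
      ∀ x ∈ U, ∀ i : Fin n,
        coordDeriv (e.extend (cornerModel n)) x (v i x) =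
          (∏ j with e.extend (cornerModel n) p j = 0,
            e.extend (cornerModel n) x j ^ a i j) • EuclideanSpace.single i (1 : ℝ)

/-- The Lie structure is exact: near each boundary point it is generated, in suitable
coordinates, by coordinate vector fields multiplied by monomials in the boundary defining
coordinates. -/
def IsExact : Prop :=
  ∀ p ∈ (cornerModel n).boundary M, ∃ e a, V.IsExactChart p e a

/-- `k` is the degeneracy index of the face `F`: in all exact coordinates around points of
`F` the exponents of the coordinate `x_j` that defines `F` there add up to `k`. -/
def IsDegeneracyIndex (F : Set M) (k : ℕ) : Prop :=
  ∀ p ∈ F, ∀ e a, V.IsExactChart p e a → ∀ j : Fin n, e.extend (cornerModel n) p j = 0 →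
    (∀ᶠ x in 𝓝 p, e.extend (cornerModel n) x j = 0 → x ∈ F) → ∑ i, a i j = k

/-- Smooth complex one-densities of the Lie algebroid `A` of `V`, i.e. smooth sections of
`Ω¹(A) ⊗ ℂ` over `M`. Over the (dense) interior `A` is the tangent bundle, so such a section is
given there by a function of `n` tangent vectors scaling with `|det|` (values at boundary points
play no role); smoothness up to the boundary as a section of `Ω¹(A)` means that the value on every
local frame of `A` extends smoothly to the boundary. -/
structure Density where
  /-- The value on `n` tangent vectors. -/
  val : ∀ x : M, (Fin n → TangentSpace (cornerModel n) x) → ℂ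
  scaling : ∀ x ∈ (cornerModel n).interior M,
    ∀ (T : TangentSpace (cornerModel n) x →ₗ[ℝ] TangentSpace (cornerModel n) x)
      (w : Fin n → TangentSpace (cornerModel n) x),
      val x (fun i => T (w i)) = (|LinearMap.det T| : ℝ) * val x w
  smooth : ∀ (U : Set M) (v : Fin n → VField n M), V.IsLocalFrame U v →
    ∃ g : M → ℂ, ContMDiffOn (cornerModel n) 𝓘(ℝ, ℂ) ∞ g U ∧
      ∀ x ∈ U ∩ (cornerModel n).interior M, val x (fun i => v i x) = g x

end LieStructure

end Defs

section Integral

variable (n : ℕ) (M : Type*) [TopologicalSpace M] [ChartedSpace (EuclideanQuadrant n) M]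
  [IsManifold (cornerModel n) ∞ M] [T2Space M] [CompactSpace M]

/-- A smooth partition of unity on `M` subordinate to the atlas. -/
def chartPartition : SmoothPartitionOfUnity M (cornerModel n) M univ :=
  (SmoothPartitionOfUnity.exists_isSubordinate_chartAt_source (cornerModel n) M).choose

theorem chartPartition_isSubordinate :
    (chartPartition n M).IsSubordinate fun x => (chartAt (EuclideanQuadrant n) x).source :=
  (SmoothPartitionOfUnity.exists_isSubordinate_chartAt_source (cornerModel n) M).choose_spec

variable {n M}

/-- The coordinate function `f(∂₁, …, ∂_n)` of a density `f`, in the chart at `p`. -/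
def densityInChart (f : ∀ x : M, (Fin n → TangentSpace (cornerModel n) x) → ℂ) (p : M)
    (y : EuclideanSpace ℝ (Fin n)) : ℂ :=
  f ((extChartAt (cornerModel n) p).symm y) fun i =>
    (mfderiv (cornerModel n) 𝓘(ℝ, EuclideanSpace ℝ (Fin n)) (extChartAt (cornerModel n) p)
      ((extChartAt (cornerModel n) p).symm y)).inverse (EuclideanSpace.single i (1 : ℝ))

/-- The density `χ_p f`, in the chart at `p`, where `(χ_p)` is the partition of unity. -/
def cutoffDensity (f : ∀ x : M, (Fin n → TangentSpace (cornerModel n) x) → ℂ) (p : M)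
    (y : EuclideanSpace ℝ (Fin n)) : ℂ :=
  (chartPartition n M p ((extChartAt (cornerModel n) p).symm y) : ℂ) * densityInChart f p y

/-- (Absolute) integrability over `M` of a density on the interior of `M`. -/
def DensityIntegrable (f : ∀ x : M, (Fin n → TangentSpace (cornerModel n) x) → ℂ) : Prop :=
  ∀ p : M, IntegrableOn (cutoffDensity f p) (extChartAt (cornerModel n) p).target

/-- The integral over `M` of a density on the interior of `M` (the boundary is a null set). -/
def densityIntegral (f : ∀ x : M, (Fin n → TangentSpace (cornerModel n) x) → ℂ) : ℂ :=
  ∑ᶠ p : M, ∫ y in (extChartAt (cornerModel n) p).target, cutoffDensity f p y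

namespace LieStructure

variable {V : LieStructure n M} {N : ℕ} (ρ : Fin N → SmoothFun n M)

/-- The density `ρ^z f`, with `ρ = ρ₁ ⋯ ρ_N`. -/
def powMul (f : V.Density) (z : ℂ) (x : M) (w : Fin n → TangentSpace (cornerModel n) x) : ℂ :=
  ((∏ i, ρ i x : ℝ) : ℂ) ^ z * f.val x w

/-- `G(f)(z) = ∫_M ρ^z f`, with `ρ = ρ₁ ⋯ ρ_N`. -/
def G (f : V.Density) (z : ℂ) : ℂ := densityIntegral (powMul ρ f z)

/-- The density `ρ₁^{z₁} ⋯ ρ_N^{z_N} f`. -/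
def multiPowMul (f : V.Density) (z : Fin N → ℂ) (x : M)
    (w : Fin n → TangentSpace (cornerModel n) x) : ℂ :=
  (∏ i, (ρ i x : ℂ) ^ z i) * f.val x w

/-- The several-variable version `G(f)(z₁, …, z_N) = ∫_M ρ₁^{z₁} ⋯ ρ_N^{z_N} f`. -/
def multiG (f : V.Density) (z : Fin N → ℂ) : ℂ := densityIntegral (multiPowMul ρ f z)

variable (V)

/-- The condition on `κ` in the definition of renormalizability: for all smooth densities `f` the
integral `G(f)(z)` converges absolutely for `Re z > κ - 1`, is holomorphic there, and extends
meromorphically to `ℂ`. -/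
def RegularizesAt (κ : ℝ) : Prop :=
  ∀ f : V.Density,
    (∀ z : ℂ, κ - 1 < z.re → DensityIntegrable (powMul ρ f z)) ∧
    DifferentiableOn ℂ (G ρ f) {z : ℂ | κ - 1 < z.re} ∧
    ∃ g : ℂ → ℂ, MeromorphicOn g univ ∧ EqOn g (G ρ f) {z : ℂ | κ - 1 < z.re}

/-- `κ` is the minimal real number as in the definition of renormalizability. -/
def IsMinimalIndex (κ : ℝ) : Prop := IsLeast {κ' : ℝ | RegularizesAt V ρ κ'} κ

/-- The Lie manifold is renormalizable (with respect to the given boundary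
defining functions): there is a minimal `κ` as above. -/
def Renormalizable : Prop := ∃ κ : ℝ, IsMinimalIndex V ρ κ

end LieStructure

end Integral

/-- The points `k - 1 - j`, `j = 0, 1, 2, …`. -/
def poleSet (k : ℕ) : Set ℂ := {s | ∃ j : ℕ, s = (k : ℂ) - 1 - (j : ℂ)}

open scoped Classical in
/-- `g` is meromorphic on `ℂ^N` with at most simple poles, along the hyperplanes `z_i = s` with
`s ∈ P i`: near each `w` the function `g`, multiplied by those of the `z_i - w_i` for which
`w_i ∈ P i`, agrees off these hyperplanes with a holomorphic function. -/
def HasSimplePolesAlong {N : ℕ} (P : Fin N → Set ℂ) (g : (Fin N → ℂ) → ℂ) : Prop :=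
  ∀ w : Fin N → ℂ, ∃ h : (Fin N → ℂ) → ℂ, AnalyticAt ℂ h w ∧
    ∀ᶠ z in 𝓝 w, (∀ i, z i ∉ P i) → (∏ i with w i ∈ P i, (z i - w i)) * g z = h z

end

end LieMfd

set_option linter.unusedSectionVars false

/-! In exact coordinates at a boundary point the generators of `V` have determinant ∏ x_j^(∑_i a_ij)
against the coordinate fields. A density is smooth on the generators, so in coordinates it is a
smooth function divided by that monomial. The functions ρ_i of the faces through the point are the
vanishing coordinates up to smooth positive factors (Hadamard's lemma,
`IsHyperfaceSystem.exists_cornerData`). Partitions of unity therefore turn `multiG` into a finite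
sum of integrals of ∏ ρ_i^(s_i) φ over the quadrant, with s_i = z_i - k_i and φ smooth with compact
support (`Density.exists_pieces`).

Such a corner integral converges and is analytic for Re s_i > -1 (`Test.analyticAt`). Integrating
the derivative of y_j ∏ ρ_l^(s_l) φ, where y_j is the coordinate of ρ_i, expresses (s_i + 1) times
the integral through integrals of the same kind with s_i raised by one (`Test.functional_equation`).
Iteration continues the integral meromorphically. At a given point at most one linear factor per
variable vanishes, which gives simple poles along hyperplanes; only variables of faces through the
corner occur. On the diagonal the linear factors coincide, and their number, hence the order of the
pole, is bounded by the depth (`PolesOn.diagonalPoles`).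

The degeneracy index is intrinsic because determinants of two local frames, taken in any two charts,
are locally comparable. The order of vanishing at a depth-one point is thus unique
(`HasOrder.unique`). It is locally constant, and the depth-one points of a face form one connected
component. Points of higher depth inherit the index from depth-one points in the same chart.

The index is sharp: for a bump density at a depth-one point of F_i, the integrand at z = k_i - 1 is
1/y_j times a positive continuous function there, hence not integrable
(`exists_not_densityIntegrable`). So the admissible κ are exactly the upper bounds of the k_i. -/

namespace LieMfd

/-! ### Analyticity of exponential integrals in a parameter -/

noncomputable section

/-- Exponential integrals `s ↦ ∫ c(y) exp(L(y)(s - s₀)) dμ(y)` are analytic at `s₀`, as soon as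
they are absolutely convergent with a small room around `s₀`. -/
theorem analyticAt_integral_exp {α H : Type*} [MeasurableSpace α] {μ : Measure α}
    [NormedAddCommGroup H] [NormedSpace ℂ H] {L : α → H →L[ℂ] ℂ} {c : α → ℂ}
    (hL : AEStronglyMeasurable L μ) (hc : AEStronglyMeasurable c μ) {r : ℝ} (hr : 0 < r)
    (hint : Integrable (fun y => ‖c y‖ * Real.exp (r * ‖L y‖)) μ) (s₀ : H) :
    AnalyticAt ℂ (fun s => ∫ y, c y * Complex.exp (L y (s - s₀)) ∂μ) s₀ := by
  have hfac : ∀ (x : ℝ), 0 ≤ x → ∀ k : ℕ, ((k.factorial : ℝ)⁻¹) * x ^ k ≤ Real.exp x := by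
    intro x hx k
    have := Real.pow_div_factorial_le_exp x hx k
    rwa [div_eq_inv_mul] at this
  -- The power series at s₀ is the exponential series integrated termwise, with degree-k term c (L
  -- v)^k / k!. The single bound ‖c‖ exp(r‖L‖) controls both the radius of convergence and the
  -- interchange of sum and integral.
  let q : ∀ k : ℕ, α → H [×k]→L[ℂ] ℂ := fun k y =>
    (c y * ((k.factorial : ℂ)⁻¹)) •
      (ContinuousMultilinearMap.mkPiAlgebraFin ℂ k ℂ).compContinuousLinearMap (fun _ => L y)
  have hqm : ∀ k, AEStronglyMeasurable (q k) μ := by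
    intro k
    refine (hc.mul_const _).smul ?_
    have h1 : Continuous fun l : H →L[ℂ] ℂ =>
        (ContinuousMultilinearMap.mkPiAlgebraFin ℂ k ℂ).compContinuousLinearMap
          (fun _ : Fin k => l) := by
      have h2 := (ContinuousMultilinearMap.compContinuousLinearMapContinuousMultilinear ℂ
        (fun _ : Fin k => H) (fun _ : Fin k => ℂ) ℂ).cont
      have h3 : Continuous fun l : H →L[ℂ] ℂ =>
          (ContinuousMultilinearMap.compContinuousLinearMapContinuousMultilinear ℂ
        (fun _ : Fin k => H) (fun _ : Fin k => ℂ) ℂ) (fun _ => l) :=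
        h2.comp (continuous_pi fun _ => continuous_id)
      exact h3.clm_apply continuous_const
    exact h1.comp_aestronglyMeasurable hL
  have hqn : ∀ k y, ‖q k y‖ ≤ ‖c y‖ * ((k.factorial : ℝ)⁻¹ * ‖L y‖ ^ k) := by
    intro k y
    rw [norm_smul, norm_mul, mul_assoc]
    refine mul_le_mul_of_nonneg_left ?_ (norm_nonneg _)
    have h1 : ‖((k.factorial : ℂ)⁻¹)‖ = (k.factorial : ℝ)⁻¹ := by simp
    rw [h1]
    refine mul_le_mul_of_nonneg_left ?_ (by positivity)
    refine (ContinuousMultilinearMap.norm_compContinuousLinearMap_le _ _).trans ?_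
    simp
  have hqr : ∀ k y, ‖q k y‖ * r ^ k ≤ ‖c y‖ * Real.exp (r * ‖L y‖) := by
    intro k y
    calc ‖q k y‖ * r ^ k ≤ ‖c y‖ * ((k.factorial : ℝ)⁻¹ * ‖L y‖ ^ k) * r ^ k :=
          mul_le_mul_of_nonneg_right (hqn k y) (by positivity)
      _ = ‖c y‖ * ((k.factorial : ℝ)⁻¹ * (r * ‖L y‖) ^ k) := by ring
      _ ≤ _ := mul_le_mul_of_nonneg_left (hfac _ (by positivity) k) (norm_nonneg _)
  have hqi : ∀ k, Integrable (q k) μ := by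
    intro k
    refine (hint.mul_const ((r ^ k)⁻¹)).mono' (hqm k) (Eventually.of_forall fun y => ?_)
    rw [← div_eq_mul_inv, le_div_iff₀ (by positivity)]
    exact hqr k y
  let p : FormalMultilinearSeries ℂ H ℂ := fun k => ∫ y, q k y ∂μ
  refine ⟨p, ENNReal.ofReal r, ?_, by simpa using hr, ?_⟩
  · have hb : ∀ k, ‖p k‖ * (r.toNNReal : ℝ) ^ k ≤ ∫ y, ‖c y‖ * Real.exp (r * ‖L y‖) ∂μ := by
      intro k
      rw [Real.coe_toNNReal _ hr.le]
      calc ‖p k‖ * r ^ k ≤ (∫ y, ‖q k y‖ ∂μ) * r ^ k :=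
            mul_le_mul_of_nonneg_right (norm_integral_le_integral_norm _) (by positivity)
        _ = ∫ y, ‖q k y‖ * r ^ k ∂μ := by rw [integral_mul_const]
        _ ≤ _ := integral_mono ((hqi k).norm.mul_const _) hint (hqr k)
    exact p.le_radius_of_bound _ hb
  · intro v hv
    have hv' : ‖v‖ < r := by
      simpa [Metric.mem_eball, edist_zero_right, ← ofReal_norm, hr,
        ENNReal.ofReal_lt_ofReal_iff] using hv
    have e1 : ∀ k, p k (fun _ => v) = ∫ y, c y * ((k.factorial : ℂ)⁻¹ * (L y v) ^ k) ∂μ := by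
      intro k
      rw [ContinuousMultilinearMap.integral_apply (hqi k)]
      congr 1
      ext y
      simp [q, mul_assoc]
    simp only [e1, add_sub_cancel_left]
    refine hasSum_integral_of_dominated_convergence
      (fun k y => ‖c y‖ * ((k.factorial : ℝ)⁻¹ * (r * ‖L y‖) ^ k)) ?_ ?_ ?_ ?_ ?_
    · intro k
      have hLv : AEStronglyMeasurable (fun y => L y v) μ :=
        (ContinuousLinearMap.apply ℂ ℂ v).continuous.comp_aestronglyMeasurable hL
      exact hc.mul ((hLv.pow k).const_mul _)
    · intro k
      refine Eventually.of_forall fun y => ?_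
      rw [norm_mul, norm_mul, norm_pow]
      refine mul_le_mul_of_nonneg_left ?_ (norm_nonneg _)
      have h1 : ‖((k.factorial : ℂ)⁻¹)‖ = (k.factorial : ℝ)⁻¹ := by simp
      rw [h1]
      refine mul_le_mul_of_nonneg_left ?_ (by positivity)
      refine pow_le_pow_left₀ (norm_nonneg _) ?_ k
      calc ‖L y v‖ ≤ ‖L y‖ * ‖v‖ := (L y).le_opNorm v
        _ ≤ ‖L y‖ * r := by gcongr
        _ = r * ‖L y‖ := mul_comm _ _
    · refine Eventually.of_forall fun y => ?_
      refine Summable.mul_left _ ?_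
      have := Real.summable_pow_div_factorial (r * ‖L y‖)
      simpa [div_eq_inv_mul] using this
    · refine hint.congr (Eventually.of_forall fun y => ?_)
      simp only
      rw [tsum_mul_left, Real.exp_eq_exp_ℝ, NormedSpace.exp_eq_tsum_div]
      simp [div_eq_inv_mul]
    · refine Eventually.of_forall fun y => ?_
      refine HasSum.mul_left _ ?_
      have := NormedSpace.expSeries_div_hasSum_exp (L y v)
      rw [← Complex.exp_eq_exp_ℂ] at this
      simpa [div_eq_inv_mul] using this

end

/-! ### Parameter integrals on convex sets and Hadamard's lemma -/

noncomputable section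

/-- By compactness of [0,1] the partial derivative in `y` is continuous at `y₀` uniformly in `t`.
The mean value inequality on the convex set `S` intersected with a small ball then bounds the
first-order remainder by ε‖y - y₀‖ uniformly in `t`, and this survives integration. Boundary points
of `S` are allowed. -/
theorem hasFDerivWithinAt_integral_of_contDiffOn {E G : Type} [NormedAddCommGroup E]
    [NormedSpace ℝ E] [NormedAddCommGroup G] [NormedSpace ℝ G] [CompleteSpace G] {S : Set E}
    (hS : Convex ℝ S) (hSu : UniqueDiffOn ℝ S) {F : E × ℝ → G}
    (hF : ContDiffOn ℝ 1 F (S ×ˢ Icc (0 : ℝ) 1)) {y₀ : E} (hy₀ : y₀ ∈ S) :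
    HasFDerivWithinAt (fun y => ∫ t in (0 : ℝ)..1, F (y, t))
      (∫ t in (0 : ℝ)..1, (fderivWithin ℝ F (S ×ˢ Icc (0 : ℝ) 1) (y₀, t)).comp
        (ContinuousLinearMap.inl ℝ E ℝ)) S y₀ := by
  set T : Set (E × ℝ) := S ×ˢ Icc (0 : ℝ) 1 with hT
  have hTu : UniqueDiffOn ℝ T := hSu.prod (uniqueDiffOn_Icc zero_lt_one)
  set F1 : E × ℝ → E →L[ℝ] G := fun z =>
    (fderivWithin ℝ F T z).comp (ContinuousLinearMap.inl ℝ E ℝ) with hF1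
  have hF1c : ContinuousOn F1 T :=
    (hF.continuousOn_fderivWithin hTu le_rfl).clm_comp continuousOn_const
  have hslice : ∀ y ∈ S, ContinuousOn (fun t : ℝ => (y, t)) (uIcc (0 : ℝ) 1) ∧
      MapsTo (fun t : ℝ => (y, t)) (uIcc (0 : ℝ) 1) T := by
    intro y hy
    refine ⟨by fun_prop, fun t ht => ⟨hy, by rwa [uIcc_of_le zero_le_one] at ht⟩⟩
  have hFi : ∀ y ∈ S, IntervalIntegrable (fun t => F (y, t)) volume 0 1 := fun y hy =>
    (hF.continuousOn.comp (hslice y hy).1 (hslice y hy).2).intervalIntegrable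
  have hF1i : ∀ y ∈ S, IntervalIntegrable (fun t => F1 (y, t)) volume 0 1 := fun y hy =>
    (hF1c.comp (hslice y hy).1 (hslice y hy).2).intervalIntegrable
  have hder : ∀ y ∈ S, ∀ t ∈ Icc (0 : ℝ) 1,
      HasFDerivWithinAt (fun y => F (y, t)) (F1 (y, t)) S y := by
    intro y hy t ht
    have h1 : HasFDerivWithinAt F (fderivWithin ℝ F T (y, t)) T (y, t) :=
      ((hF.differentiableOn one_ne_zero) (y, t) ⟨hy, ht⟩).hasFDerivWithinAt
    have h2 : HasFDerivWithinAt (fun y : E => (y, t)) (ContinuousLinearMap.inl ℝ E ℝ) S y :=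
      (hasFDerivAt_prodMk_left y t).hasFDerivWithinAt
    have h3 : MapsTo (fun y : E => (y, t)) S T := fun y' hy' => ⟨hy', ht⟩
    exact h1.comp y h2 h3
  rw [hasFDerivWithinAt_iff_isLittleO, Asymptotics.isLittleO_iff]
  intro ε hε
  obtain ⟨v, hv, hvε⟩ := isCompact_Icc.mem_uniformity_of_prod (f := fun y t => F1 (y, t))
    (s := S) (k := Icc (0 : ℝ) 1) (q := y₀) (by simpa [Function.uncurry_def] using hF1c) hy₀
    (Metric.dist_mem_uniformity hε)
  obtain ⟨δ, hδ, hδv⟩ := Metric.mem_nhdsWithin_iff.1 hv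
  filter_upwards [inter_mem_nhdsWithin S (Metric.ball_mem_nhds y₀ hδ)] with y hy
  have key : ∀ t ∈ Icc (0 : ℝ) 1,
      ‖F (y, t) - F (y₀, t) - F1 (y₀, t) (y - y₀)‖ ≤ ε * ‖y - y₀‖ := by
    intro t ht
    refine (hS.inter (convex_ball y₀ δ)).norm_image_sub_le_of_norm_hasFDerivWithin_le'
      (f := fun y => F (y, t)) (f' := fun y => F1 (y, t)) (φ := F1 (y₀, t))
      (fun x hx => (hder x hx.1 t ht).mono inter_subset_left) (fun x hx => ?_)
      ⟨hy₀, Metric.mem_ball_self hδ⟩ hy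
    have := hvε x (hδv ⟨hx.2, hx.1⟩) t ht
    rw [← dist_eq_norm]
    exact le_of_lt this
  have e1 : (∫ t in (0 : ℝ)..1, F (y, t)) - (∫ t in (0 : ℝ)..1, F (y₀, t)) -
      (∫ t in (0 : ℝ)..1, F1 (y₀, t)) (y - y₀) =
      ∫ t in (0 : ℝ)..1, (F (y, t) - F (y₀, t) - F1 (y₀, t) (y - y₀)) := by
    rw [intervalIntegral.integral_sub ((hFi y hy.1).sub (hFi y₀ hy₀)) ?_,
      intervalIntegral.integral_sub (hFi y hy.1) (hFi y₀ hy₀),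
      ContinuousLinearMap.intervalIntegral_apply (hF1i y₀ hy₀)]
    exact ((hF1c.comp (hslice y₀ hy₀).1 (hslice y₀ hy₀).2).clm_apply
      continuousOn_const).intervalIntegrable
  rw [e1]
  have := intervalIntegral.norm_integral_le_of_norm_le_const (a := 0) (b := 1)
    (f := fun t => F (y, t) - F (y₀, t) - F1 (y₀, t) (y - y₀)) (C := ε * ‖y - y₀‖)
    (fun t ht => key t (by
      rw [uIoc_of_le zero_le_one] at ht; exact Ioc_subset_Icc_self ht))
  simpa using this

/-- Induction on the order of differentiability. The target `G` is quantified inside the induction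
because the derivative takes values in `E →L[ℝ] G`. -/
theorem contDiffOn_integral_nat {E : Type} [NormedAddCommGroup E]
    [NormedSpace ℝ E] {S : Set E} (hS : Convex ℝ S) (hSu : UniqueDiffOn ℝ S) (m : ℕ) :
    ∀ {G : Type} [NormedAddCommGroup G] [NormedSpace ℝ G] [CompleteSpace G] {F : E × ℝ → G},
      ContDiffOn ℝ ∞ F (S ×ˢ Icc (0 : ℝ) 1) →
      ContDiffOn ℝ m (fun y => ∫ t in (0 : ℝ)..1, F (y, t)) S := by
  have hTu : UniqueDiffOn ℝ (S ×ˢ Icc (0 : ℝ) 1) := hSu.prod (uniqueDiffOn_Icc zero_lt_one)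
  induction m with
  | zero =>
    intro G _ _ _ F hF
    rw [Nat.cast_zero, contDiffOn_zero]
    exact fun y hy => (hasFDerivWithinAt_integral_of_contDiffOn hS hSu
      (hF.of_le (by exact_mod_cast le_top)) hy).continuousWithinAt
  | succ m ih =>
    intro G _ _ _ F hF
    rw [Nat.cast_succ, contDiffOn_succ_iff_fderivWithin hSu]
    have hd := fun y (hy : y ∈ S) => hasFDerivWithinAt_integral_of_contDiffOn hS hSu
      (hF.of_le (by exact_mod_cast le_top)) hy
    refine ⟨fun y hy => (hd y hy).differentiableWithinAt, by simp, ?_⟩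
    refine (ih (F := fun z => (fderivWithin ℝ F (S ×ˢ Icc (0 : ℝ) 1) z).comp
      (ContinuousLinearMap.inl ℝ E ℝ)) ?_).congr
      (fun y hy => (hd y hy).fderivWithin (hSu y hy))
    exact (hF.fderivWithin hTu (by simp)).clm_comp contDiffOn_const

/-- Integrals over the parameter interval `[0,1]` of smooth functions on `S × [0,1]`, for a convex
set `S`, are smooth on `S`. -/
theorem contDiffOn_integral {E : Type} [NormedAddCommGroup E]
    [NormedSpace ℝ E] {S : Set E} (hS : Convex ℝ S) (hSu : UniqueDiffOn ℝ S)
    {G : Type} [NormedAddCommGroup G] [NormedSpace ℝ G] [CompleteSpace G] {F : E × ℝ → G}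
    (hF : ContDiffOn ℝ ∞ F (S ×ˢ Icc (0 : ℝ) 1)) :
    ContDiffOn ℝ ∞ (fun y => ∫ t in (0 : ℝ)..1, F (y, t)) S :=
  contDiffOn_infty.2 fun m => contDiffOn_integral_nat hS hSu m hF

/-- **Hadamard's lemma** on a convex set `S`: a smooth function vanishing on `{l = 0}` is divisible
by the linear form `l`. -/
theorem exists_smooth_factor {E : Type} [NormedAddCommGroup E]
    [NormedSpace ℝ E] {S : Set E} (hS : Convex ℝ S) (hSu : UniqueDiffOn ℝ S)
    {f : E → ℝ} (hf : ContDiffOn ℝ ∞ f S) (l : E →L[ℝ] ℝ) (e : E)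
    (hmaps : ∀ y ∈ S, ∀ t ∈ Icc (0 : ℝ) 1, y - ((1 - t) * l y) • e ∈ S)
    (h0 : ∀ y ∈ S, f (y - l y • e) = 0) :
    ∃ g : E → ℝ, ContDiffOn ℝ ∞ g S ∧ (∀ y ∈ S, f y = l y * g y) ∧
      ∀ y ∈ S, l y = 0 → g y = fderivWithin ℝ f S y e := by
  -- The path t ↦ P (y, t) runs from y - l(y) e, where `f` vanishes, to y with velocity l(y) e. The
  -- quotient is the mean of the derivative of `f` along `e` over this path; for l(y) = 0 the path
  -- is constant.
  let P : E × ℝ → E := fun z => z.1 - ((1 - z.2) * l z.1) • e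
  have hP : ContDiff ℝ ∞ P := by
    have : ContDiff ℝ ∞ fun z : E × ℝ => l z.1 := l.contDiff.comp contDiff_fst
    exact contDiff_fst.sub (((contDiff_const.sub contDiff_snd).mul this).smul contDiff_const)
  have hPm : MapsTo P (S ×ˢ Icc (0 : ℝ) 1) S := fun z hz => hmaps z.1 hz.1 z.2 hz.2
  have hf' : ContDiffOn ℝ ∞ (fun y => fderivWithin ℝ f S y e) S :=
    (hf.fderivWithin hSu (by simp)).clm_apply contDiffOn_const
  refine ⟨fun y => ∫ t in (0 : ℝ)..1, fderivWithin ℝ f S (P (y, t)) e,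
    contDiffOn_integral hS hSu (F := fun z => fderivWithin ℝ f S (P z) e)
      (hf'.comp hP.contDiffOn hPm), ?_, ?_⟩
  · intro y hy
    have hPd : ∀ t, HasDerivAt (fun t : ℝ => P (y, t)) (l y • e) t := by
      intro t
      have h1 : HasDerivAt (fun t : ℝ => (1 - t) * l y) (-1 * l y) t :=
        ((hasDerivAt_id t).const_sub 1).mul_const _
      have := (h1.smul_const e).const_sub y
      simpa [P] using this
    have hPc : Continuous fun t : ℝ => P (y, t) := hP.continuous.comp (by fun_prop)
    have hPm' : MapsTo (fun t : ℝ => P (y, t)) (Icc 0 1) S := fun t ht => hPm ⟨hy, ht⟩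
    have hc : ContinuousOn (fun t : ℝ => fderivWithin ℝ f S (P (y, t)) e) (Icc 0 1) :=
      hf'.continuousOn.comp hPc.continuousOn hPm'
    have key : ∫ t in (0 : ℝ)..1, l y * fderivWithin ℝ f S (P (y, t)) e =
        f (P (y, 1)) - f (P (y, 0)) := by
      refine intervalIntegral.integral_eq_sub_of_hasDerivAt_of_le zero_le_one
        (f := fun t => f (P (y, t)))
        (hf.continuousOn.comp hPc.continuousOn hPm') (fun t ht => ?_) ?_
      · have h1 : HasFDerivWithinAt f (fderivWithin ℝ f S (P (y, t))) S (P (y, t)) :=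
          ((hf.differentiableOn (by simp)) _ (hPm' (Ioo_subset_Icc_self ht))).hasFDerivWithinAt
        have h2 := h1.comp_hasDerivWithinAt t (hPd t).hasDerivWithinAt hPm'
        have h3 := h2.hasDerivAt (Icc_mem_nhds ht.1 ht.2)
        simpa [Function.comp_def] using h3
      · exact (ContinuousOn.intervalIntegrable (by
          rw [uIcc_of_le zero_le_one]; exact continuousOn_const.mul hc))
    rw [intervalIntegral.integral_const_mul] at key
    rw [key]
    simp [P, h0 y hy]
  · intro y hy hl
    simp [P, hl]

end

/-! ### Quadrants, corner data and integrable monomials -/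

noncomputable section

/-- The closed quadrant `[0,∞)ⁿ`. -/
def quad (n : ℕ) : Set (EuclideanSpace ℝ (Fin n)) := {y | ∀ i, 0 ≤ y i}

/-- The open quadrant `(0,∞)ⁿ`. -/
def openQuad (n : ℕ) : Set (EuclideanSpace ℝ (Fin n)) := {y | ∀ i, 0 < y i}

theorem continuous_coord {n : ℕ} (i : Fin n) :
    Continuous fun y : EuclideanSpace ℝ (Fin n) => y i := by fun_prop

theorem convex_quad (n : ℕ) : Convex ℝ (quad n) := EuclideanQuadrant.convex

theorem isClosed_quad (n : ℕ) : IsClosed (quad n) := by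
  simp only [quad, ofPred_forall]
  exact isClosed_iInter fun i => isClosed_le continuous_const (continuous_coord i)

theorem interior_quad (n : ℕ) : interior (quad n) = openQuad n :=
  interior_euclideanQuadrant n 2 0

theorem isOpen_openQuad (n : ℕ) : IsOpen (openQuad n) := interior_quad n ▸ isOpen_interior

theorem openQuad_subset (n : ℕ) : openQuad n ⊆ quad n := fun _ hy i => (hy i).le

theorem openQuad_nonempty (n : ℕ) : (openQuad n).Nonempty :=
  ⟨WithLp.toLp 2 fun _ => 1, fun i => by simp⟩

theorem uniqueDiffOn_quad (n : ℕ) : UniqueDiffOn ℝ (quad n) :=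
  uniqueDiffOn_convex (convex_quad n) (by rw [interior_quad]; exact openQuad_nonempty n)

theorem closure_openQuad (n : ℕ) : closure (openQuad n) = quad n := by
  rw [← interior_quad, (convex_quad n).closure_interior_eq_closure_of_nonempty_interior
    (by rw [interior_quad]; exact openQuad_nonempty n), (isClosed_quad n).closure_eq]

theorem quad_ae_eq (n : ℕ) : (openQuad n : Set _) =ᵐ[volume] quad n := by
  rw [← interior_quad]
  exact interior_ae_eq_of_null_frontier ((convex_quad n).addHaar_frontier volume)

theorem uniqueDiffOn_inter_quad {n : ℕ} {W : Set (EuclideanSpace ℝ (Fin n))} (hW : IsOpen W) :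
    UniqueDiffOn ℝ (W ∩ quad n) := by
  rw [inter_comm]; exact (uniqueDiffOn_quad n).inter hW

/-- A function which is smooth on `W ∩ A` and vanishes outside of a closed subset of the open set
`W` is smooth on `A`. -/
theorem contDiffOn_of_support {E G : Type*} [NormedAddCommGroup E] [NormedSpace ℝ E]
    [NormedAddCommGroup G] [NormedSpace ℝ G] {A W K : Set E} (hW : IsOpen W) (hK : IsClosed K)
    (hKW : K ⊆ W) {f : E → G} (hf : ContDiffOn ℝ ∞ f (W ∩ A)) (h0 : ∀ y ∈ A, y ∉ K → f y = 0) :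
    ContDiffOn ℝ ∞ f A := by
  intro y hy
  by_cases hyK : y ∈ K
  · have := hf y ⟨hKW hyK, hy⟩
    rw [inter_comm] at this
    exact (contDiffWithinAt_inter (hW.mem_nhds (hKW hyK))).1 this
  · have : f =ᶠ[𝓝[A] y] fun _ => 0 := by
      filter_upwards [inter_mem_nhdsWithin A (hK.isOpen_compl.mem_nhds hyK)] with z hz
      exact h0 z hz.1 hz.2
    exact (contDiffWithinAt_const (c := (0 : G))).congr_of_eventuallyEq this (h0 y hy hyK)

/-- Data describing how `N` nonnegative functions look like near a corner: the functions with index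
`i ∈ S` are the coordinates `y (ℓ i)`, up to smooth positive factors, the other ones are positive. -/
structure CornerData (n N : ℕ) where
  W : Set (EuclideanSpace ℝ (Fin n))
  isOpen : IsOpen W
  S : Finset (Fin N)
  idx : Fin N → Fin n
  injOn : ∀ i ∈ S, ∀ j ∈ S, idx i = idx j → i = j
  g : Fin N → EuclideanSpace ℝ (Fin n) → ℝ
  smooth : ∀ i, ContDiffOn ℝ ∞ (g i) (W ∩ quad n)
  pos : ∀ i, ∀ y ∈ W ∩ quad n, 0 < g i y

namespace CornerData

variable {n N : ℕ} (D : CornerData n N)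

/-- The coordinate belonging to `i`. -/
def coord (i : Fin N) (y : EuclideanSpace ℝ (Fin n)) : ℝ := if i ∈ D.S then y (D.idx i) else 1

/-- The `i`-th function. -/
def rho (i : Fin N) (y : EuclideanSpace ℝ (Fin n)) : ℝ := D.coord i y * D.g i y

/-- The integrand `∏ ρ_i ^ s_i`. -/
def rhoPow (s : Fin N → ℂ) (y : EuclideanSpace ℝ (Fin n)) : ℂ := ∏ i, (D.rho i y : ℂ) ^ s i

/-- `φ` is smooth on the quadrant, with compact support in `W`. -/
def Test (φ : EuclideanSpace ℝ (Fin n) → ℂ) : Prop :=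
  ContDiffOn ℝ ∞ φ (quad n) ∧ ∃ K ⊆ D.W, IsCompact K ∧ ∀ y ∈ quad n, y ∉ K → φ y = 0

/-- The integral of `∏ ρ_i ^ s_i φ`. -/
def integral (φ : EuclideanSpace ℝ (Fin n) → ℂ) (s : Fin N → ℂ) : ℂ :=
  ∫ y in openQuad n, D.rhoPow s y * φ y

/-- The domain `{Re s_i > -1 - r_i, i ∈ S}`. -/
def dom (r : Fin N → ℝ) : Set (Fin N → ℂ) := {s | ∀ i ∈ D.S, -1 - r i < (s i).re}

variable {D}

theorem coord_pos (i : Fin N) {y : EuclideanSpace ℝ (Fin n)} (hy : y ∈ openQuad n) :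
    0 < D.coord i y := by
  unfold coord; split_ifs
  · exact hy _
  · exact one_pos

theorem coord_nonneg (i : Fin N) {y : EuclideanSpace ℝ (Fin n)} (hy : y ∈ quad n) :
    0 ≤ D.coord i y := by
  unfold coord; split_ifs
  · exact hy _
  · exact zero_le_one

theorem contDiff_coord (i : Fin N) : ContDiff ℝ ∞ (D.coord i) := by
  unfold coord; split_ifs
  · exact (EuclideanSpace.proj (𝕜 := ℝ) (D.idx i)).contDiff
  · exact contDiff_const

theorem rho_pos (i : Fin N) {y : EuclideanSpace ℝ (Fin n)} (hy : y ∈ openQuad n) (hW : y ∈ D.W) :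
    0 < D.rho i y := mul_pos (coord_pos i hy) (D.pos i y ⟨hW, openQuad_subset n hy⟩)

theorem rho_smooth (i : Fin N) : ContDiffOn ℝ ∞ (D.rho i) (D.W ∩ quad n) :=
  (contDiff_coord i).contDiffOn.mul (D.smooth i)

theorem rho_continuousOn (i : Fin N) : ContinuousOn (D.rho i) (D.W ∩ quad n) :=
  (rho_smooth i).continuousOn

theorem rhoPow_continuousOn (s : Fin N → ℂ) : ContinuousOn (D.rhoPow s) (D.W ∩ openQuad n) := by
  unfold rhoPow
  refine continuousOn_finsetProd _ fun i _ => ?_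
  refine ContinuousOn.cpow_const (Complex.continuous_ofReal.comp_continuousOn
    ((rho_continuousOn i).mono (inter_subset_inter_right _ (openQuad_subset n)))) fun y hy => ?_
  exact Complex.ofReal_mem_slitPlane.2 (rho_pos i hy.2 hy.1)

theorem norm_rhoPow (s : Fin N → ℂ) {y : EuclideanSpace ℝ (Fin n)} (hy : y ∈ openQuad n)
    (hW : y ∈ D.W) : ‖D.rhoPow s y‖ = ∏ i, D.rho i y ^ (s i).re := by
  unfold rhoPow
  rw [norm_prod]
  exact Finset.prod_congr rfl fun i _ =>
    Complex.norm_cpow_eq_rpow_re_of_pos (rho_pos i hy hW) _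

theorem Test.mul_left {φ : EuclideanSpace ℝ (Fin n) → ℂ} (hφ : D.Test φ)
    {u : EuclideanSpace ℝ (Fin n) → ℂ} (hu : ContDiffOn ℝ ∞ u (D.W ∩ quad n)) :
    D.Test fun y => u y * φ y := by
  obtain ⟨hs, K, hKW, hK, h0⟩ := hφ
  refine ⟨contDiffOn_of_support D.isOpen hK.isClosed hKW (hu.mul (hs.mono inter_subset_right))
    fun y hy hyK => by simp [h0 y hy hyK], K, hKW, hK, fun y hy hyK => by simp [h0 y hy hyK]⟩

theorem Test.deriv {φ : EuclideanSpace ℝ (Fin n) → ℂ} (hφ : D.Test φ)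
    (v : EuclideanSpace ℝ (Fin n)) : D.Test fun y => fderivWithin ℝ φ (quad n) y v := by
  obtain ⟨hs, K, hKW, hK, h0⟩ := hφ
  refine ⟨(hs.fderivWithin (uniqueDiffOn_quad n) (by simp)).clm_apply contDiffOn_const,
    K, hKW, hK, fun y hy hyK => ?_⟩
  have : φ =ᶠ[𝓝[quad n] y] fun _ => 0 := by
    filter_upwards [inter_mem_nhdsWithin (quad n) (hK.isClosed.isOpen_compl.mem_nhds hyK)]
      with z hz using h0 z hz.1 hz.2
  simp only [this.fderivWithin_eq (h0 y hy hyK)]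
  simp

end CornerData

/-- Products of powers of the coordinates, with exponents `> -1`, are locally integrable. -/
theorem integrableOn_prod_rpow {n : ℕ} (b : Fin n → ℝ) (hb : ∀ j, -1 < b j) (R : ℝ) :
    IntegrableOn (fun y : EuclideanSpace ℝ (Fin n) => ∏ j, y j ^ b j)
      (openQuad n ∩ {y | ∀ j, y j ≤ R}) := by
  have h1 : ∀ j, Integrable ((Ioc 0 R).indicator fun t : ℝ => t ^ b j) := by
    intro j
    rw [integrable_indicator_iff measurableSet_Ioc]
    by_cases hR : 0 ≤ R
    · exact (intervalIntegrable_iff_integrableOn_Ioc_of_le hR).1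
        (intervalIntegral.intervalIntegrable_rpow' (hb j))
    · rw [Ioc_eq_empty (by linarith)]; exact integrableOn_empty
  have h2 := Integrable.fintype_prod (f := fun j => (Ioc 0 R).indicator fun t : ℝ => t ^ b j) h1
  have h3 := (EuclideanSpace.volume_preserving_symm_measurableEquiv_toLp
    (Fin n)).integrable_comp_of_integrable h2
  have hm : MeasurableSet (openQuad n ∩ {y | ∀ j, y j ≤ R}) := by
    refine (isOpen_openQuad n).measurableSet.inter (IsClosed.measurableSet ?_)
    simp only [ofPred_forall]
    exact isClosed_iInter fun i => isClosed_le (continuous_coord i) continuous_const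
  rw [← integrable_indicator_iff hm]
  refine h3.congr (Eventually.of_forall fun y => ?_)
  by_cases hy : y ∈ openQuad n ∩ {y | ∀ j, y j ≤ R}
  · rw [indicator_of_mem hy]
    refine Finset.prod_congr rfl fun j _ => ?_
    rw [indicator_of_mem]
    · rfl
    · exact ⟨hy.1 j, hy.2 j⟩
  · rw [indicator_of_notMem hy]
    have : ∃ j, y j ∉ Ioc 0 R := by
      by_contra h
      push Not at h
      exact hy ⟨fun j => (h j).1, fun j => (h j).2⟩
    obtain ⟨j, hj⟩ := this
    exact Finset.prod_eq_zero (Finset.mem_univ j) (indicator_of_notMem hj _)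

end

/-! ### Convergence and analyticity of corner integrals -/

noncomputable section

namespace CornerData

variable {n N : ℕ} {D : CornerData n N}

/-- The exponents of the coordinates, given exponents of the functions. -/
def expo (D : CornerData n N) (a : Fin N → ℝ) (j : Fin n) : ℝ :=
  ∑ i ∈ D.S with D.idx i = j, a i

/-- Distinct functions in `S` belong to distinct coordinates, so the sum has at most one term.
Without this, exponents could accumulate on one coordinate and destroy integrability. -/
theorem expo_gt {a : Fin N → ℝ} (ha : ∀ i ∈ D.S, -1 < a i) (j : Fin n) : -1 < D.expo a j := by
  unfold expo
  by_cases h : ∃ i ∈ D.S, D.idx i = j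
  · obtain ⟨i, hi, hj⟩ := h
    have : D.S.filter (fun i => D.idx i = j) = {i} := by
      ext k
      simp only [Finset.mem_filter, Finset.mem_singleton]
      constructor
      · rintro ⟨hk, hkj⟩; exact D.injOn k hk i hi (hkj.trans hj.symm)
      · rintro rfl; exact ⟨hi, hj⟩
    rw [this, Finset.sum_singleton]; exact ha i hi
  · have : D.S.filter (fun i => D.idx i = j) = ∅ := by
      ext k
      simp only [Finset.mem_filter, Finset.notMem_empty, iff_false]
      rintro ⟨hk, hkj⟩; exact h ⟨k, hk, hkj⟩
    rw [this, Finset.sum_empty]; norm_num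

theorem prod_coord_rpow (a : Fin N → ℝ) {y : EuclideanSpace ℝ (Fin n)} (hy : y ∈ openQuad n) :
    ∏ i, D.coord i y ^ a i = ∏ j, y j ^ D.expo a j := by
  have h1 : ∀ i, D.coord i y ^ a i = if i ∈ D.S then y (D.idx i) ^ a i else 1 := by
    intro i; unfold coord; split_ifs <;> simp
  have h2 : ∀ j, y j ^ D.expo a j = ∏ i ∈ D.S with D.idx i = j, y (D.idx i) ^ a i := by
    intro j
    unfold expo
    rw [Real.rpow_sum_of_pos (hy j)]
    refine Finset.prod_congr rfl fun i hi => ?_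
    rw [(Finset.mem_filter.1 hi).2]
  simp only [h1, h2]
  rw [Finset.prod_fiberwise, Finset.prod_ite_mem, Finset.univ_inter]

/-- The positive factors are bounded away from zero and infinity on the compact part of the
quadrant, so only the powers of the coordinates matter, whatever the signs of the exponents. -/
theorem exists_bound {K : Set (EuclideanSpace ℝ (Fin n))} (hK : IsCompact K) (hKW : K ⊆ D.W)
    (a : Fin N → ℝ) : ∃ C : ℝ, 0 ≤ C ∧ ∀ y ∈ openQuad n ∩ K,
      ∏ i, D.rho i y ^ a i ≤ C * ∏ j, y j ^ D.expo a j := by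
  have hc : ContinuousOn (fun y => ∏ i, D.g i y ^ a i) (K ∩ quad n) := by
    refine continuousOn_finsetProd _ fun i _ => ?_
    refine ContinuousOn.rpow_const ((D.smooth i).continuousOn.mono
      (inter_subset_inter_left _ hKW)) fun y hy => Or.inl (D.pos i y ⟨hKW hy.1, hy.2⟩).ne'
  obtain ⟨C, hC⟩ := (hK.inter_right (isClosed_quad n)).exists_bound_of_continuousOn hc
  refine ⟨max C 0, le_max_right _ _, fun y hy => ?_⟩
  have hyK : y ∈ K ∩ quad n := ⟨hy.2, openQuad_subset n hy.1⟩
  have h1 : ∏ i, D.rho i y ^ a i = (∏ i, D.g i y ^ a i) * ∏ j, y j ^ D.expo a j := by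
    rw [← prod_coord_rpow a hy.1, ← Finset.prod_mul_distrib]
    refine Finset.prod_congr rfl fun i _ => ?_
    rw [rho, Real.mul_rpow (coord_pos i hy.1).le (D.pos i y ⟨hKW hyK.1, hyK.2⟩).le, mul_comm]
  rw [h1]
  refine mul_le_mul_of_nonneg_right ?_ (Finset.prod_nonneg fun j _ =>
    Real.rpow_nonneg (hy.1 j).le _)
  exact ((le_abs_self _).trans (hC y hyK)).trans (le_max_left _ _)

theorem integrableOn_rpow {K : Set (EuclideanSpace ℝ (Fin n))} (hK : IsCompact K) (hKW : K ⊆ D.W)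
    {φ : EuclideanSpace ℝ (Fin n) → ℂ} (hφ : ContinuousOn φ (quad n))
    {a : Fin N → ℝ} (ha : ∀ i ∈ D.S, -1 < a i) :
    IntegrableOn (fun y => (∏ i, D.rho i y ^ a i) * ‖φ y‖) (openQuad n ∩ K) := by
  have hsub : openQuad n ∩ K ⊆ D.W ∩ quad n := fun y hy => ⟨hKW hy.2, openQuad_subset n hy.1⟩
  have hm : MeasurableSet (openQuad n ∩ K) :=
    (isOpen_openQuad n).measurableSet.inter hK.isClosed.measurableSet
  obtain ⟨C, hC0, hC⟩ := exists_bound hK hKW a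
  obtain ⟨B, hB⟩ := (hK.inter_right (isClosed_quad n)).exists_bound_of_continuousOn
    (hφ.mono inter_subset_right)
  obtain ⟨R, hR⟩ := hK.isBounded.exists_norm_le
  have hi := (integrableOn_prod_rpow (D.expo a) (expo_gt ha) R).mono_set
    (s := openQuad n ∩ K) (fun y hy => ⟨hy.1, fun j => (le_abs_self _).trans
      ((PiLp.norm_apply_le y j).trans (hR y hy.2))⟩)
  refine (hi.const_mul (C * B)).mono' ?_ ?_
  · refine ContinuousOn.aestronglyMeasurable ?_ hm
    refine ContinuousOn.mul (continuousOn_finsetProd _ fun i _ => ?_)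
      (hφ.norm.mono fun y hy => openQuad_subset n hy.1)
    exact ContinuousOn.rpow_const ((rho_continuousOn i).mono hsub)
      fun y hy => Or.inl (rho_pos i hy.1 (hKW hy.2)).ne'
  · refine (ae_restrict_iff' hm).2 (Eventually.of_forall fun y hy => ?_)
    have h0 : 0 ≤ ∏ i, D.rho i y ^ a i :=
      Finset.prod_nonneg fun i _ => Real.rpow_nonneg (rho_pos i hy.1 (hKW hy.2)).le _
    have h0' : 0 ≤ ∏ j, y j ^ D.expo a j :=
      Finset.prod_nonneg fun j _ => Real.rpow_nonneg (hy.1 j).le _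
    rw [Real.norm_of_nonneg (by positivity)]
    calc (∏ i, D.rho i y ^ a i) * ‖φ y‖ ≤ (C * ∏ j, y j ^ D.expo a j) * B :=
          mul_le_mul (hC y hy) (hB y ⟨hy.2, openQuad_subset n hy.1⟩) (norm_nonneg _) (by positivity)
      _ = _ := by ring

theorem Test.integrableOn {φ : EuclideanSpace ℝ (Fin n) → ℂ} (hφ : D.Test φ) {s : Fin N → ℂ}
    (hs : s ∈ D.dom 0) : IntegrableOn (fun y => D.rhoPow s y * φ y) (openQuad n) := by
  obtain ⟨hsm, K, hKW, hK, h0⟩ := hφ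
  have hm : MeasurableSet (openQuad n ∩ K) :=
    (isOpen_openQuad n).measurableSet.inter hK.isClosed.measurableSet
  have h1 := integrableOn_rpow (D := D) hK hKW hsm.continuousOn (a := fun i => (s i).re)
    (fun i hi => by simpa using hs i hi)
  have h2 : IntegrableOn (fun y => D.rhoPow s y * φ y) (openQuad n ∩ K) := by
    refine Integrable.mono' h1 (ContinuousOn.aestronglyMeasurable (((rhoPow_continuousOn s).mono
      fun y hy => ⟨hKW hy.2, hy.1⟩).mul (hsm.continuousOn.mono
        fun y hy => openQuad_subset n hy.1)) hm) ?_
    refine (ae_restrict_iff' hm).2 (Eventually.of_forall fun y hy => ?_)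
    rw [norm_mul, norm_rhoPow s hy.1 (hKW hy.2)]
  refine h2.of_forall_sdiff_eq_zero (isOpen_openQuad n).measurableSet fun y hy => ?_
  have : y ∉ K := fun h => hy.2 ⟨hy.1, h⟩
  simp [h0 y (openQuad_subset n hy.1) this]

theorem rhoPow_eq_exp (s : Fin N → ℂ) {y : EuclideanSpace ℝ (Fin n)} (hy : y ∈ openQuad n)
    (hW : y ∈ D.W) : D.rhoPow s y = Complex.exp (∑ i, (Real.log (D.rho i y) : ℂ) * s i) := by
  rw [Complex.exp_sum]
  refine Finset.prod_congr rfl fun i _ => ?_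
  have := rho_pos i hy hW
  rw [Complex.cpow_def_of_ne_zero (by exact_mod_cast this.ne'), Complex.ofReal_log this.le]

/-- Since ∏ ρ_i^(s_i) = exp(∑ s_i log ρ_i), `analyticAt_integral_exp` applies with `L` built from
the logarithms. On a compact set |log ρ_i| ≤ C - log ρ_i, so exp(r‖L‖) costs a constant times ∏
ρ_i^(-r). For small `r` the lowered exponents of the functions in `S` are still above -1. -/
theorem Test.analyticAt {φ : EuclideanSpace ℝ (Fin n) → ℂ} (hφ : D.Test φ) {s₀ : Fin N → ℂ}
    (hs : s₀ ∈ D.dom 0) : AnalyticAt ℂ (D.integral φ) s₀ := by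
  obtain ⟨hsm, K, hKW, hK, h0⟩ := hφ
  have hm : MeasurableSet (openQuad n ∩ K) :=
    (isOpen_openQuad n).measurableSet.inter hK.isClosed.measurableSet
  have hsub : openQuad n ∩ K ⊆ D.W ∩ openQuad n := fun y hy => ⟨hKW hy.2, hy.1⟩
  have hsub' : openQuad n ∩ K ⊆ quad n := fun y hy => openQuad_subset n hy.1
  let L : EuclideanSpace ℝ (Fin n) → (Fin N → ℂ) →L[ℂ] ℂ := fun y =>
    ∑ i, (Real.log (D.rho i y) : ℂ) • ContinuousLinearMap.proj (R := ℂ) (φ := fun _ => ℂ) i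
  have hLc : ContinuousOn L (openQuad n ∩ K) := by
    refine continuousOn_finsetSum _ fun i _ => ?_
    refine ContinuousOn.smul (Complex.continuous_ofReal.comp_continuousOn ?_) continuousOn_const
    exact ContinuousOn.log ((rho_continuousOn i).mono fun y hy => ⟨hKW hy.2, hsub' hy⟩)
      fun y hy => (rho_pos i hy.1 (hKW hy.2)).ne'
  have hcc : ContinuousOn (fun y => D.rhoPow s₀ y * φ y) (openQuad n ∩ K) :=
    ((rhoPow_continuousOn s₀).mono hsub).mul (hsm.continuousOn.mono hsub')
  obtain ⟨r, hr, hr1⟩ : ∃ r : ℝ, 0 < r ∧ ∀ i ∈ D.S, -1 < (s₀ i).re - r := by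
    have : ∀ᶠ r in 𝓝[>] (0 : ℝ), ∀ i ∈ D.S, -1 < (s₀ i).re - r := by
      rw [Finset.eventually_all]
      intro i hi
      have h1 : -1 < (s₀ i).re - 0 := by simpa using hs i hi
      have h2 : Tendsto (fun r : ℝ => (s₀ i).re - r) (𝓝[>] 0) (𝓝 ((s₀ i).re - 0)) :=
        ((continuous_const.sub continuous_id).tendsto 0).mono_left nhdsWithin_le_nhds
      exact h2.eventually (lt_mem_nhds h1)
    obtain ⟨r, h1, h2⟩ := (this.and self_mem_nhdsWithin).exists
    exact ⟨r, h2, h1⟩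
  have hlog : ∃ C : ℝ, ∀ i, ∀ y ∈ openQuad n ∩ K, |Real.log (D.rho i y)| ≤
      C - Real.log (D.rho i y) := by
    have h1 : ∀ i, ∃ C : ℝ, ∀ y ∈ K ∩ quad n, ‖D.rho i y‖ ≤ C := fun i =>
      (hK.inter_right (isClosed_quad n)).exists_bound_of_continuousOn
        ((rho_continuousOn i).mono (inter_subset_inter_left _ hKW))
    choose C hC using h1
    -- The factor 2 covers positive logarithms, where the claim reads 2 log ρ ≤ C; summing makes the
    -- constant independent of `i`.
    refine ⟨∑ i, 2 * |C i|, fun i y hy => ?_⟩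
    have hp := rho_pos i hy.1 (hKW hy.2)
    have h2 : D.rho i y ≤ |C i| := (le_abs_self _).trans ((hC i y ⟨hy.2, hsub' hy⟩).trans
      (le_abs_self _))
    have h3 : Real.log (D.rho i y) ≤ |C i| :=
      (Real.log_le_sub_one_of_pos hp).trans (by linarith)
    have h4 : 2 * |C i| ≤ ∑ i, 2 * |C i| :=
      Finset.single_le_sum (f := fun i => 2 * |C i|) (fun i _ => by positivity) (Finset.mem_univ i)
    have h5 := abs_nonneg (C i)
    rw [abs_le]; constructor <;> linarith
  obtain ⟨C, hC⟩ := hlog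
  have hint := integrableOn_rpow (D := D) hK hKW hsm.continuousOn
    (a := fun i => (s₀ i).re - r) hr1
  have key := analyticAt_integral_exp (μ := volume.restrict (openQuad n ∩ K)) (L := L)
    (c := fun y => D.rhoPow s₀ y * φ y) (hLc.aestronglyMeasurable hm) (hcc.aestronglyMeasurable hm)
    hr ?_ s₀
  · refine key.congr (Eventually.of_forall fun s => ?_)
    unfold integral
    rw [setIntegral_eq_of_subset_of_forall_sdiff_eq_zero (s := openQuad n ∩ K)
      (t := openQuad n) (isOpen_openQuad n).measurableSet inter_subset_left]
    · refine setIntegral_congr_fun hm fun y hy => ?_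
      rw [rhoPow_eq_exp s hy.1 (hKW hy.2), rhoPow_eq_exp s₀ hy.1 (hKW hy.2), mul_right_comm,
        ← Complex.exp_add]
      congr 2
      simp only [L, sum_apply, _root_.smul_apply,
        ContinuousLinearMap.proj_apply, Pi.sub_apply, smul_eq_mul]
      rw [← Finset.sum_add_distrib]
      exact Finset.sum_congr rfl fun i _ => by ring
    · intro y hy
      have : y ∉ K := fun h => hy.2 ⟨hy.1, h⟩
      simp [h0 y (openQuad_subset n hy.1) this]
  · refine Integrable.mono' (hint.const_mul (Real.exp (r * ∑ i : Fin N, C))) ?_ ?_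
    · exact (hcc.norm.mul (Real.continuous_exp.comp_continuousOn
        (continuousOn_const.mul hLc.norm))).aestronglyMeasurable hm
    · refine (ae_restrict_iff' hm).2 (Eventually.of_forall fun y hy => ?_)
      have hpos := fun i => rho_pos (D := D) i hy.1 (hKW hy.2)
      have hLn : ‖L y‖ ≤ ∑ i, (C - Real.log (D.rho i y)) := by
        refine (norm_sum_le _ _).trans (Finset.sum_le_sum fun i _ => ?_)
        rw [norm_smul]
        refine le_trans ?_ (hC i y hy)
        have h1 : ‖(ContinuousLinearMap.proj (R := ℂ) (φ := fun _ : Fin N => ℂ) i)‖ ≤ 1 :=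
          ContinuousLinearMap.opNorm_le_bound _ zero_le_one fun v => by
            simpa using norm_le_pi_norm v i
        calc _ ≤ ‖(Real.log (D.rho i y) : ℂ)‖ * 1 := by gcongr
          _ = _ := by simp
      rw [Real.norm_of_nonneg (by positivity), norm_mul, norm_rhoPow s₀ hy.1 (hKW hy.2)]
      have h1 : Real.exp (r * ‖L y‖) ≤ Real.exp (r * ∑ i : Fin N, C) *
          ∏ i, D.rho i y ^ (-r) := by
        have e : ∀ i, D.rho i y ^ (-r) = Real.exp (-(r * Real.log (D.rho i y))) := by
          intro i; rw [Real.rpow_def_of_pos (hpos i)]; congr 1; ring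
        simp only [e]
        rw [← Real.exp_sum, ← Real.exp_add]
        refine Real.exp_le_exp.2 ?_
        calc r * ‖L y‖ ≤ r * ∑ i, (C - Real.log (D.rho i y)) := by gcongr
          _ = _ := by
            rw [Finset.sum_sub_distrib, Finset.sum_neg_distrib, ← Finset.mul_sum]; ring
      have h0' : 0 ≤ (∏ i, D.rho i y ^ (s₀ i).re) * ‖φ y‖ := mul_nonneg
        (Finset.prod_nonneg fun i _ => Real.rpow_nonneg (hpos i).le _) (norm_nonneg _)
      refine (mul_le_mul_of_nonneg_left h1 h0').trans (le_of_eq ?_)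
      have e2 : ∏ i, D.rho i y ^ ((s₀ i).re - r) =
          (∏ i, D.rho i y ^ (s₀ i).re) * ∏ i, D.rho i y ^ (-r) := by
        rw [← Finset.prod_mul_distrib]
        exact Finset.prod_congr rfl fun i _ => by rw [← Real.rpow_add (hpos i)]; rfl
      rw [e2]; ring

end CornerData

end

/-! ### Differentiating the corner integrand -/

noncomputable section

namespace CornerData

variable {n N : ℕ} {D : CornerData n N}

/-- The domain of exponents with positive real parts. -/
def posDom (D : CornerData n N) : Set (Fin N → ℂ) := {s | ∀ i ∈ D.S, 0 < (s i).re}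

theorem rhoPow_add_single {i : Fin N} (s : Fin N → ℂ) {y : EuclideanSpace ℝ (Fin n)}
    (hy : y ∈ openQuad n) (hW : y ∈ D.W) :
    D.rhoPow (s + Pi.single i 1) y = D.rho i y * D.rhoPow s y := by
  unfold rhoPow
  have h : ∀ l, (D.rho l y : ℂ) ^ (s + Pi.single i 1 : Fin N → ℂ) l =
      (if l = i then (D.rho l y : ℂ) else 1) * (D.rho l y : ℂ) ^ s l := by
    intro l
    by_cases hl : l = i
    · subst hl
      have hp : (D.rho l y : ℂ) ≠ 0 := by exact_mod_cast (rho_pos l hy hW).ne'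
      simp [Complex.cpow_add _ _ hp, mul_comm]
    · simp [hl]
  simp only [h, Finset.prod_mul_distrib]
  simp

/-- The derivative of the `l`-th positive factor in the direction of the `j`-th coordinate. -/
def gDeriv (D : CornerData n N) (l : Fin N) (j : Fin n) (y : EuclideanSpace ℝ (Fin n)) : ℝ :=
  fderivWithin ℝ (D.g l) (D.W ∩ quad n) y (EuclideanSpace.single j 1)

theorem gDeriv_smooth (l : Fin N) (j : Fin n) :
    ContDiffOn ℝ ∞ (D.gDeriv l j) (D.W ∩ quad n) :=
  ((D.smooth l).fderivWithin (uniqueDiffOn_inter_quad D.isOpen) (by simp)).clm_apply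
    contDiffOn_const

/-- Logarithmic differentiation. By injectivity of `idx` on `S`, the coordinate attached to `i`
enters no other ρ_l except through its smooth positive factor, so the singular term 1/y_j carries
s_i alone. -/
theorem hasLineDerivAt_rhoPow {i : Fin N} (hi : i ∈ D.S) (s : Fin N → ℂ)
    {y : EuclideanSpace ℝ (Fin n)} (hy : y ∈ openQuad n) (hW : y ∈ D.W) :
    HasLineDerivAt ℝ (D.rhoPow s) (D.rhoPow s y * (s i / (y (D.idx i) : ℂ) +
      ∑ l, s l * (D.gDeriv l (D.idx i) y / D.g l y : ℝ))) y
      (EuclideanSpace.single (D.idx i) 1) := by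
  set e : EuclideanSpace ℝ (Fin n) := EuclideanSpace.single (D.idx i) 1 with he
  have hopen : D.W ∩ openQuad n ∈ 𝓝 y := (D.isOpen.inter (isOpen_openQuad n)).mem_nhds ⟨hW, hy⟩
  have hg : ∀ l, HasLineDerivAt ℝ (D.g l) (D.gDeriv l (D.idx i) y) y e := by
    intro l
    have h1 : HasFDerivWithinAt (D.g l) (fderivWithin ℝ (D.g l) (D.W ∩ quad n) y)
        (D.W ∩ quad n) y :=
      ((D.smooth l).differentiableOn (by simp) y ⟨hW, openQuad_subset n hy⟩).hasFDerivWithinAt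
    have h2 := h1.hasFDerivAt
      (mem_of_superset hopen (inter_subset_inter_right _ (openQuad_subset n)))
    exact h2.hasLineDerivAt e
  have hcd : ∀ l, HasLineDerivAt ℝ (D.coord l) (if l = i then 1 else 0) y e := by
    intro l
    unfold coord
    by_cases hl : l ∈ D.S
    · simp only [hl, if_true]
      have h1 := ((EuclideanSpace.proj (𝕜 := ℝ) (D.idx l) :
        EuclideanSpace ℝ (Fin n) →L[ℝ] ℝ).hasFDerivAt (x := y)).hasLineDerivAt e
      have h2 : (EuclideanSpace.proj (𝕜 := ℝ) (D.idx l) : EuclideanSpace ℝ (Fin n) →L[ℝ] ℝ) e =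
          if l = i then 1 else 0 := by
        by_cases hli : l = i
        · subst hli; simp [he]
        · have : D.idx l ≠ D.idx i := fun h => hli (D.injOn l hl i hi h)
          simp [he, hli, this]
      rw [h2] at h1
      exact h1
    · have : l ≠ i := fun h => hl (h ▸ hi)
      simp only [hl, if_false, this]
      exact hasDerivAt_const _ _
  have hr : ∀ l, HasLineDerivAt ℝ (D.rho l)
      ((if l = i then 1 else 0) * D.g l y + D.coord l y * D.gDeriv l (D.idx i) y) y e := by
    intro l
    have := HasDerivAt.mul (hcd l) (hg l)
    unfold HasLineDerivAt
    convert! this using 1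
    simp
  have hlog : ∀ l, HasLineDerivAt ℝ (fun y => Real.log (D.rho l y))
      ((if l = i then (y (D.idx i))⁻¹ else 0) + D.gDeriv l (D.idx i) y / D.g l y) y e := by
    intro l
    have h0 := (rho_pos l hy hW).ne'
    have h1 := HasDerivAt.log (hr l) (by simpa using h0)
    have hg0 := (D.pos l y ⟨hW, openQuad_subset n hy⟩).ne'
    have hc0 := (coord_pos (D := D) l hy).ne'
    unfold HasLineDerivAt
    convert! h1 using 1
    simp only [zero_smul, add_zero]
    unfold rho at h0 ⊢
    by_cases hl : l = i
    · subst hl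
      have : D.coord l y = y (D.idx l) := by simp [coord, hi]
      rw [this] at *
      have hy0 := (hy (D.idx l)).ne'
      simp only [if_true]
      field_simp
    · simp only [hl, if_false, zero_mul, zero_add]
      field_simp
  have hexp : HasLineDerivAt ℝ (fun y => Complex.exp (∑ l, (Real.log (D.rho l y) : ℂ) * s l))
      (Complex.exp (∑ l, (Real.log (D.rho l y) : ℂ) * s l) *
        ∑ l, (((if l = i then (y (D.idx i))⁻¹ else 0) + D.gDeriv l (D.idx i) y / D.g l y : ℝ) : ℂ)
          * s l) y e := by
    have h1 : HasDerivAt (fun t : ℝ => ∑ l, (Real.log (D.rho l (y + t • e)) : ℂ) * s l)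
        (∑ l, (((if l = i then (y (D.idx i))⁻¹ else 0) + D.gDeriv l (D.idx i) y / D.g l y : ℝ) : ℂ)
          * s l) 0 :=
      HasDerivAt.fun_sum fun l _ => (HasDerivAt.ofReal_comp (hlog l)).mul_const _
    have := h1.cexp
    simpa [HasLineDerivAt] using this
  have hcongr : (fun t : ℝ => D.rhoPow s (y + t • e)) =ᶠ[𝓝 0]
      fun t : ℝ => Complex.exp (∑ l, (Real.log (D.rho l (y + t • e)) : ℂ) * s l) := by
    have hcont : Tendsto (fun t : ℝ => y + t • e) (𝓝 0) (𝓝 y) := by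
      have : Continuous fun t : ℝ => y + t • e := by fun_prop
      simpa using this.tendsto 0
    filter_upwards [hcont hopen] with t ht
    exact rhoPow_eq_exp s ht.2 ht.1
  have := HasDerivAt.congr_of_eventuallyEq hexp hcongr
  unfold HasLineDerivAt
  convert! this using 1
  rw [rhoPow_eq_exp s hy hW]
  congr 1
  simp only [Complex.ofReal_add, add_mul, Finset.sum_add_distrib]
  congr 1
  · rw [Finset.sum_eq_single i]
    · simp [div_eq_inv_mul]
    · intro l _ hl; simp [hl]
    · simp
  · exact Finset.sum_congr rfl fun l _ => mul_comm _ _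

/-- For i ∈ S the condition Re s_i > 0 makes t ↦ t^(s_i) continuous at t = 0; for the other indices
ρ_i is positive on `W`. Continuity up to the boundary removes boundary terms from the integration by
parts. -/
theorem rhoPow_mul_continuousOn {φ : EuclideanSpace ℝ (Fin n) → ℂ} (hφ : D.Test φ)
    {s : Fin N → ℂ} (hs : s ∈ D.posDom) :
    ContinuousOn (fun y => D.rhoPow s y * φ y) (quad n) := by
  obtain ⟨hsm, K, hKW, hK, h0⟩ := hφ
  have h1 : ContinuousOn (fun y => D.rhoPow s y * φ y) (D.W ∩ quad n) := by
    refine ContinuousOn.mul ?_ (hsm.continuousOn.mono inter_subset_right)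
    refine continuousOn_finsetProd _ fun i _ y hy => ?_
    have h2 : ContinuousWithinAt (D.rho i) (D.W ∩ quad n) y := rho_continuousOn i y hy
    have h3 : ContinuousAt (fun a : ℝ => (a : ℂ) ^ s i) (D.rho i y) := by
      refine Complex.continuousAt_ofReal_cpow_const _ _ ?_
      by_cases hi : i ∈ D.S
      · exact Or.inl (hs i hi)
      · right
        have := D.pos i y hy
        simp [rho, coord, hi, this.ne']
    exact h3.comp_continuousWithinAt h2
  intro y hy
  by_cases hyK : y ∈ K
  · have := h1 y ⟨hKW hyK, hy⟩
    rw [inter_comm] at this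
    exact (continuousWithinAt_inter (D.isOpen.mem_nhds (hKW hyK))).1 this
  · have : (fun y => D.rhoPow s y * φ y) =ᶠ[𝓝[quad n] y] fun _ => 0 := by
      filter_upwards [inter_mem_nhdsWithin (quad n) (hK.isClosed.isOpen_compl.mem_nhds hyK)]
        with z hz
      simp [h0 z hz.1 hz.2]
    exact continuousWithinAt_const.congr_of_eventuallyEq this (by simp [h0 y hy hyK])

/-- The derivative of `y_j ∏ ρ_i ^ s_i φ`, up to the factor `∏ ρ_i ^ s_i`. -/
def divTest (D : CornerData n N) (i : Fin N) (s : Fin N → ℂ) (φ : EuclideanSpace ℝ (Fin n) → ℂ)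
    (y : EuclideanSpace ℝ (Fin n)) : ℂ :=
  (s i + 1) * φ y + (y (D.idx i) : ℂ) *
    (fderivWithin ℝ φ (quad n) y (EuclideanSpace.single (D.idx i) 1) +
      ∑ l, s l * ((D.gDeriv l (D.idx i) y / D.g l y : ℝ) : ℂ) * φ y)

/-- Extension by zero moves the integration by parts to all of ℝⁿ, provided the line derivative
exists at every point. Lines in direction j change only y_j, so a nonpositive coordinate other than
y_j keeps the whole line off the open quadrant. -/
theorem hasLineDerivAt_indicator {φ : EuclideanSpace ℝ (Fin n) → ℂ} (hφ : D.Test φ)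
    {s : Fin N → ℂ} (hs : s ∈ D.posDom) {i : Fin N} (hi : i ∈ D.S)
    (y : EuclideanSpace ℝ (Fin n)) :
    HasLineDerivAt ℝ
      ((openQuad n).indicator fun y => (y (D.idx i) : ℂ) * (D.rhoPow s y * φ y))
      ((openQuad n).indicator (fun y => D.rhoPow s y * D.divTest i s φ y) y) y
      (EuclideanSpace.single (D.idx i) 1) := by
  set e : EuclideanSpace ℝ (Fin n) := EuclideanSpace.single (D.idx i) 1 with he
  have hline : Continuous fun t : ℝ => y + t • e := by fun_prop
  have hline0 : Tendsto (fun t : ℝ => y + t • e) (𝓝 0) (𝓝 y) := by simpa using hline.tendsto 0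
  have hcoord : ∀ (t : ℝ) (j : Fin n), (y + t • e) j = y j + if j = D.idx i then t else 0 := by
    intro t j; simp [he]
  have hcontΦ := rhoPow_mul_continuousOn hφ hs
  have hφ' := hφ
  obtain ⟨hsm, K, hKW, hK, h0⟩ := hφ
  have hder0 : ∀ y ∈ openQuad n, y ∉ K →
      fderivWithin ℝ φ (quad n) y (EuclideanSpace.single (D.idx i) 1) = 0 := by
    intro y hy hyK
    have : φ =ᶠ[𝓝[quad n] y] fun _ => 0 := by
      filter_upwards [inter_mem_nhdsWithin (quad n) (hK.isClosed.isOpen_compl.mem_nhds hyK)]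
        with z hz using h0 z hz.1 hz.2
    simp only [this.fderivWithin_eq (h0 y (openQuad_subset n hy) hyK)]
    simp
  by_cases hy : y ∈ openQuad n
  · rw [indicator_of_mem hy]
    have hev : (fun t : ℝ => (openQuad n).indicator
        (fun y => (y (D.idx i) : ℂ) * (D.rhoPow s y * φ y)) (y + t • e)) =ᶠ[𝓝 0]
        fun t : ℝ => (((y + t • e) (D.idx i) : ℝ) : ℂ) *
          (D.rhoPow s (y + t • e) * φ (y + t • e)) := by
      filter_upwards [hline0 ((isOpen_openQuad n).mem_nhds hy)] with t ht
      exact indicator_of_mem (s := openQuad n) ht _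
    by_cases hyK : y ∈ K
    · have h1 := hasLineDerivAt_rhoPow hi s hy (hKW hyK)
      have h2 : HasLineDerivAt ℝ φ (fderivWithin ℝ φ (quad n) y e) y e := by
        have h3 : HasFDerivWithinAt φ (fderivWithin ℝ φ (quad n) y) (quad n) y :=
          (hsm.differentiableOn (by simp) y (openQuad_subset n hy)).hasFDerivWithinAt
        exact (h3.hasFDerivAt (mem_of_superset ((isOpen_openQuad n).mem_nhds hy)
          (openQuad_subset n))).hasLineDerivAt e
      have h4 : HasDerivAt (fun t : ℝ => (((y + t • e) (D.idx i) : ℝ) : ℂ)) 1 0 := by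
        have : HasDerivAt (fun t : ℝ => (y + t • e) (D.idx i)) 1 0 := by
          simp only [hcoord, if_true]
          exact (hasDerivAt_id (0 : ℝ)).const_add _
        simpa using this.ofReal_comp
      have h5 := h4.mul (HasDerivAt.mul h1 h2)
      refine HasDerivAt.congr_of_eventuallyEq ?_ hev
      convert! h5 using 1
      have hyj : (y (D.idx i) : ℂ) ≠ 0 := by exact_mod_cast (hy _).ne'
      simp only [Pi.mul_apply, zero_smul, add_zero, divTest, ← he, ← Finset.sum_mul]
      field_simp
      ring
    · have : D.rhoPow s y * D.divTest i s φ y = 0 := by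
        simp [divTest, h0 y (openQuad_subset n hy) hyK, hder0 y hy hyK]
      rw [this]
      refine (hasDerivAt_const (0 : ℝ) (0 : ℂ)).congr_of_eventuallyEq ?_
      filter_upwards [hev, hline0 (hK.isClosed.isOpen_compl.mem_nhds hyK),
        hline0 ((isOpen_openQuad n).mem_nhds hy)] with t ht htK htQ
      rw [ht]
      simp [h0 _ (openQuad_subset n htQ) htK]
  · rw [indicator_of_notMem hy]
    by_cases hl : ∃ l, l ≠ D.idx i ∧ y l ≤ 0
    · obtain ⟨l, hli, hl⟩ := hl
      refine (hasDerivAt_const (0 : ℝ) (0 : ℂ)).congr_of_eventuallyEq (Eventually.of_forall ?_)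
      intro t
      refine indicator_of_notMem (fun h => ?_) _
      have := h l
      rw [hcoord] at this
      simp only [hli, if_false, add_zero] at this
      linarith
    · push Not at hl
      have hj : y (D.idx i) ≤ 0 := by
        by_contra h
        push Not at h
        refine hy fun l => ?_
        by_cases hli : l = D.idx i
        · rw [hli]; exact h
        · exact hl l hli
      have hmem : ∀ t : ℝ, y + t • e ∈ openQuad n → 0 < y (D.idx i) + t := by
        intro t ht
        have := ht (D.idx i)
        rw [hcoord] at this
        simpa using this
      rcases hj.lt_or_eq with hj | hj
      · refine (hasDerivAt_const (0 : ℝ) (0 : ℂ)).congr_of_eventuallyEq ?_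
        have : ∀ᶠ t : ℝ in 𝓝 0, t < -y (D.idx i) := gt_mem_nhds (by linarith)
        filter_upwards [this] with t ht
        refine indicator_of_notMem (fun h => ?_) _
        have := hmem t h
        linarith
      -- This is the delicate case: y_j = 0 and the other coordinates are positive. The factor y_j
      -- cancels the increment `t` in the difference quotient, which leaves ∏ ρ_l^(s_l) φ; this is
      -- continuous and zero at `y` because Re s_i > 0.
      · have hyq : y ∈ quad n := by
          intro l
          by_cases hli : l = D.idx i
          · rw [hli, hj]
          · exact (hl l hli).le
        have hzero : D.rhoPow s y * φ y = 0 := by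
          have : D.rhoPow s y = 0 := by
            refine Finset.prod_eq_zero (Finset.mem_univ i) ?_
            have h1 : D.rho i y = 0 := by simp [rho, coord, hi, hj]
            have h2 : s i ≠ 0 := fun h => by have := hs i hi; rw [h] at this; simp at this
            simp [h1, h2]
          simp [this]
        unfold HasLineDerivAt
        rw [hasDerivAt_iff_isLittleO, Asymptotics.isLittleO_iff]
        intro ε hε
        have h1 := hcontΦ y hyq
        rw [Metric.continuousWithinAt_iff] at h1
        obtain ⟨δ, hδ, hδ'⟩ := h1 ε hε
        filter_upwards [hline0 (Metric.ball_mem_nhds y hδ)] with t ht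
        have hn : (openQuad n).indicator
          (fun y => (y (D.idx i) : ℂ) * (D.rhoPow s y * φ y)) (y + (0 : ℝ) • e) = 0 := by
          rw [zero_smul, add_zero, indicator_of_notMem hy]
        rw [hn]
        simp only [sub_zero, smul_zero]
        by_cases htq : y + t • e ∈ openQuad n
        · rw [indicator_of_mem htq, norm_mul, mul_comm]
          have h2 := hδ' (openQuad_subset n htq) ht
          rw [hzero, dist_zero_right] at h2
          have h3 : ‖(((y + t • e) (D.idx i) : ℝ) : ℂ)‖ = ‖t‖ := by
            rw [hcoord, hj]; simp
          rw [h3]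
          exact mul_le_mul_of_nonneg_right h2.le (norm_nonneg _)
        · rw [indicator_of_notMem htq, norm_zero]; positivity

end CornerData

end

/-! ### Integration by parts and iterated shifts of the exponents -/

noncomputable section

namespace CornerData

variable {n N : ℕ} {D : CornerData n N}

theorem posDom_subset (r : Fin N → ℝ) (hr : ∀ i, 0 ≤ r i) : D.posDom ⊆ D.dom r := by
  intro s hs i hi
  have := hs i hi
  have := hr i
  linarith

theorem add_single_re (s : Fin N → ℂ) (i l : Fin N) :
    ((s + Pi.single i 1 : Fin N → ℂ) l).re = (s l).re + if l = i then 1 else 0 := by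
  by_cases h : l = i
  · subst h; simp
  · simp [h]

theorem posDom_add_single {s : Fin N → ℂ} (hs : s ∈ D.posDom) (i : Fin N) :
    s + Pi.single i 1 ∈ D.posDom := by
  intro l hl
  rw [add_single_re]
  have := hs l hl
  split_ifs <;> linarith

/-- The test function produced by differentiating `φ` in the direction of the `i`-th function. -/
def derivTest (D : CornerData n N) (i : Fin N) (φ : EuclideanSpace ℝ (Fin n) → ℂ)
    (y : EuclideanSpace ℝ (Fin n)) : ℂ :=
  (((D.g i y)⁻¹ : ℝ) : ℂ) * fderivWithin ℝ φ (quad n) y (EuclideanSpace.single (D.idx i) 1)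

/-- The test functions produced by differentiating the positive factors. -/
def logTest (D : CornerData n N) (i l : Fin N) (φ : EuclideanSpace ℝ (Fin n) → ℂ)
    (y : EuclideanSpace ℝ (Fin n)) : ℂ :=
  ((D.gDeriv l (D.idx i) y * (D.g l y)⁻¹ * (D.g i y)⁻¹ : ℝ) : ℂ) * φ y

theorem inv_g_smooth (i : Fin N) : ContDiffOn ℝ ∞ (fun y => (D.g i y)⁻¹) (D.W ∩ quad n) :=
  (D.smooth i).inv fun y hy => (D.pos i y hy).ne'

theorem _root_.ContDiffOn.complex_ofReal {E : Type*} [NormedAddCommGroup E] [NormedSpace ℝ E]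
    {f : E → ℝ} {A : Set E} (hf : ContDiffOn ℝ ∞ f A) : ContDiffOn ℝ ∞ (fun y => (f y : ℂ)) A :=
  Complex.ofRealCLM.contDiff.comp_contDiffOn hf

theorem Test.derivTest {φ : EuclideanSpace ℝ (Fin n) → ℂ} (hφ : D.Test φ) (i : Fin N) :
    D.Test (D.derivTest i φ) :=
  (hφ.deriv (EuclideanSpace.single (D.idx i) 1)).mul_left (inv_g_smooth i).complex_ofReal

theorem Test.logTest {φ : EuclideanSpace ℝ (Fin n) → ℂ} (hφ : D.Test φ) (i l : Fin N) :
    D.Test (D.logTest i l φ) :=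
  hφ.mul_left (((gDeriv_smooth l _).mul (inv_g_smooth l)).mul (inv_g_smooth i)).complex_ofReal

/-- The functional equation: one integration by parts shifts an exponent by one. -/
theorem Test.functional_equation {φ : EuclideanSpace ℝ (Fin n) → ℂ} (hφ : D.Test φ)
    {s : Fin N → ℂ} (hs : s ∈ D.posDom) {i : Fin N} (hi : i ∈ D.S) :
    (s i + 1) * D.integral φ s = -(D.integral (D.derivTest i φ) (s + Pi.single i 1) +
      ∑ l, s l * D.integral (D.logTest i l φ) (s + Pi.single i 1)) := by
  have hs0 : s ∈ D.dom 0 := posDom_subset 0 (fun _ => le_rfl) hs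
  have hs1 : s + Pi.single i 1 ∈ D.dom 0 :=
    posDom_subset 0 (fun _ => le_rfl) (posDom_add_single hs i)
  have hcoordφ : D.Test fun y => (y (D.idx i) : ℂ) * φ y :=
    hφ.mul_left (u := fun y => (y (D.idx i) : ℂ))
      ((EuclideanSpace.proj (𝕜 := ℝ) (D.idx i)).contDiff.contDiffOn.complex_ofReal)
  have i1 := (hφ.integrableOn hs0).const_mul (s i + 1)
  have i2 := (hφ.derivTest i).integrableOn hs1
  have i3 := fun l => ((hφ.logTest i l).integrableOn hs1).const_mul (s l)
  have i3' := integrable_finsetSum Finset.univ fun l _ => i3 l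
  have i23 : IntegrableOn (fun y => D.rhoPow (s + Pi.single i 1) y * D.derivTest i φ y +
      ∑ l, s l * (D.rhoPow (s + Pi.single i 1) y * D.logTest i l φ y)) (openQuad n) := i2.add i3'
  -- Every term other than (s_i + 1) φ carries a factor y_j = ρ_i / g_i. The ρ_i raises the exponent
  -- and 1/g_i is absorbed in the new test function.
  have hpt : ∀ y ∈ openQuad n, D.rhoPow s y * D.divTest i s φ y =
      (s i + 1) * (D.rhoPow s y * φ y) +
      (D.rhoPow (s + Pi.single i 1) y * D.derivTest i φ y +
      ∑ l, s l * (D.rhoPow (s + Pi.single i 1) y * D.logTest i l φ y)) := by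
    intro y hy
    by_cases hyW : y ∈ D.W
    · have hg : ∀ l, (D.g l y : ℂ) ≠ 0 := fun l => by
        exact_mod_cast (D.pos l y ⟨hyW, openQuad_subset n hy⟩).ne'
      have hr : (D.rho i y : ℂ) = y (D.idx i) * D.g i y := by simp [rho, coord, hi]
      rw [rhoPow_add_single s hy hyW, hr]
      unfold divTest CornerData.derivTest CornerData.logTest
      have h1 : ∀ l, s l * ((y (D.idx i) : ℂ) * D.g i y * D.rhoPow s y *
          (((D.gDeriv l (D.idx i) y * (D.g l y)⁻¹ * (D.g i y)⁻¹ : ℝ) : ℂ) * φ y)) =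
          D.rhoPow s y * y (D.idx i) *
            (s l * ((D.gDeriv l (D.idx i) y / D.g l y : ℝ) : ℂ) * φ y) := by
        intro l
        have := hg l
        have := hg i
        push_cast
        field_simp
      simp only [h1, ← Finset.mul_sum]
      have := hg i
      push_cast
      field_simp
    · obtain ⟨hsm, K, hKW, hK, h0⟩ := hφ
      have hyK : y ∉ K := fun h => hyW (hKW h)
      have : φ =ᶠ[𝓝[quad n] y] fun _ => 0 := by
        filter_upwards [inter_mem_nhdsWithin (quad n) (hK.isClosed.isOpen_compl.mem_nhds hyK)]
          with z hz using h0 z hz.1 hz.2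
      have hφy := h0 y (openQuad_subset n hy) hyK
      simp [divTest, CornerData.derivTest, CornerData.logTest, hφy, this.fderivWithin_eq hφy]
  have hm := (isOpen_openQuad n).measurableSet
  have hdiv : IntegrableOn (fun y => D.rhoPow s y * D.divTest i s φ y) (openQuad n) :=
    IntegrableOn.congr_fun (i1.add i23) (fun y hy => (hpt y hy).symm) hm
  -- Integration by parts against the constant function 1: both the extension by zero and its line
  -- derivative are integrable, so the latter has integral zero.
  have hzero : ∫ y in openQuad n, D.rhoPow s y * D.divTest i s φ y = 0 := by
    rw [← integral_indicator hm]
    have hI : Integrable ((openQuad n).indicator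
        fun y => (y (D.idx i) : ℂ) * (D.rhoPow s y * φ y)) := by
      rw [integrable_indicator_iff hm]
      refine (hcoordφ.integrableOn hs0).congr_fun (fun y _ => ?_) hm
      ring
    have := integral_bilinear_hasLineDerivAt_right_eq_neg_left_of_integrable
      (μ := (volume : Measure (EuclideanSpace ℝ (Fin n)))) (B := ContinuousLinearMap.mul ℝ ℂ)
      (f := (openQuad n).indicator fun y => (y (D.idx i) : ℂ) * (D.rhoPow s y * φ y))
      (f' := (openQuad n).indicator fun y => D.rhoPow s y * D.divTest i s φ y)
      (g := fun _ => 1) (g' := fun _ => 0) (v := EuclideanSpace.single (D.idx i) 1)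
      (by simpa using (integrable_indicator_iff hm).2 hdiv) (by simp) (by simpa using hI)
      (fun y _ => hasLineDerivAt_indicator hφ hs hi y) (fun y _ => by
        unfold HasLineDerivAt; exact hasDerivAt_const _ _)
    simpa using this
  have hsum : ∫ y in openQuad n, D.rhoPow s y * D.divTest i s φ y =
      (s i + 1) * D.integral φ s + (D.integral (D.derivTest i φ) (s + Pi.single i 1) +
      ∑ l, s l * D.integral (D.logTest i l φ) (s + Pi.single i 1)) := by
    rw [setIntegral_congr_fun hm fun y hy => hpt y hy, integral_add i1 i23,
      integral_add i2 i3', integral_finsetSum _ fun l _ => i3 l]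
    simp only [integral_const_mul, CornerData.integral]
  rw [hsum] at hzero
  exact eq_neg_of_add_eq_zero_left hzero

/-- The product of the linear factors at the first `r i` poles in the `i`-th variable. -/
def poleProd (D : CornerData n N) (r : Fin N → ℕ) (s : Fin N → ℂ) : ℂ :=
  ∏ i ∈ D.S, ∏ l ∈ Finset.range (r i), (s i + 1 + l)

theorem poleProd_add_single (r : Fin N → ℕ) (s : Fin N → ℂ) {i : Fin N} (hi : i ∈ D.S) :
    D.poleProd (r + Pi.single i 1) s = (s i + 1) * D.poleProd r (s + Pi.single i 1) := by
  unfold poleProd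
  rw [← Finset.mul_prod_erase _ _ hi, ← Finset.mul_prod_erase _ _ hi, ← mul_assoc]
  congr 1
  · simp only [Pi.add_apply, Pi.single_eq_same]
    rw [Finset.prod_range_succ', mul_comm]
    simp only [Nat.cast_zero, add_zero]
    congr 1
    refine Finset.prod_congr rfl fun l _ => ?_
    push_cast; ring
  · refine Finset.prod_congr rfl fun l hl => ?_
    have : l ≠ i := Finset.ne_of_mem_erase hl
    simp [this]

/-- Induction on the total number of shifts, each an application of the functional equation. The
test function is quantified inside because every shift produces new ones. The identity is only
needed for positive real parts; the identity theorem propagates it later. -/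
theorem Test.exists_analytic (k : ℕ) : ∀ (r : Fin N → ℕ), (∀ i ∉ D.S, r i = 0) → ∑ i, r i = k →
    ∀ {φ : EuclideanSpace ℝ (Fin n) → ℂ}, D.Test φ → ∃ H : (Fin N → ℂ) → ℂ,
      AnalyticOnNhd ℂ H (D.dom fun i => r i) ∧
        ∀ s ∈ D.posDom, D.poleProd r s * D.integral φ s = H s := by
  induction k with
  | zero =>
    intro r _ hr φ hφ
    have hr0 : r = 0 := by
      ext i
      exact (Finset.sum_eq_zero_iff.1 hr) i (Finset.mem_univ i)
    subst hr0
    refine ⟨D.integral φ, fun s hs => hφ.analyticAt (fun i hi => by simpa using hs i hi),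
      fun s _ => ?_⟩
    simp [poleProd]
  | succ k ih =>
    intro r hrS hr φ hφ
    obtain ⟨i, hi⟩ : ∃ i, r i ≠ 0 := by
      by_contra h
      push Not at h
      simp [h] at hr
    have hiS : i ∈ D.S := by
      by_contra h; exact hi (hrS i h)
    set r' : Fin N → ℕ := r - Pi.single i 1 with hr'
    have hrr : r = r' + Pi.single i 1 := by
      ext l
      by_cases hl : l = i
      · subst hl; simp [hr']; omega
      · simp [hr', hl]
    have hr'S : ∀ l ∉ D.S, r' l = 0 := fun l hl => by simp [hr', hrS l hl]
    have hsum : ∑ l, r' l = k := by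
      rw [hrr] at hr
      simp only [Pi.add_apply, Finset.sum_add_distrib, Finset.sum_pi_single', Finset.mem_univ,
        if_true] at hr
      omega
    obtain ⟨H₀, hH₀, hH₀'⟩ := ih r' hr'S hsum (hφ.derivTest i)
    choose H₁ hH₁ hH₁' using fun l => ih r' hr'S hsum (hφ.logTest i l)
    -- Raising s_i by one and lowering the admissible number of shifts in direction `i` by one move
    -- the bound on Re s_i by the same amount.
    have hshift : ∀ s ∈ D.dom fun i => r i, s + Pi.single i 1 ∈ D.dom fun i => (r' i : ℝ) := by
      intro s hs l hl
      have h1 := hs l hl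
      rw [add_single_re]
      rw [hrr] at h1
      by_cases hli : l = i
      · subst hli
        simp at h1
        simp; linarith
      · simp [hli] at h1
        simp [hli]; linarith
    refine ⟨fun s => -(H₀ (s + Pi.single i 1) + ∑ l, s l * H₁ l (s + Pi.single i 1)), ?_, ?_⟩
    · intro s hs
      have ha : AnalyticAt ℂ (fun s : Fin N → ℂ => s + Pi.single i 1) s :=
        analyticAt_id.add analyticAt_const
      refine AnalyticAt.neg (AnalyticAt.add ?_ ?_)
      · exact AnalyticAt.comp (g := H₀) (f := fun s => s + Pi.single i 1) (hH₀ _ (hshift s hs)) ha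
      · refine Finset.analyticAt_fun_sum _ fun l _ => AnalyticAt.mul ?_ ?_
        · exact (ContinuousLinearMap.proj (R := ℂ) (φ := fun _ : Fin N => ℂ) l).analyticAt s
        · exact AnalyticAt.comp (g := H₁ l) (f := fun s => s + Pi.single i 1)
            (hH₁ l _ (hshift s hs)) ha
    · intro s hs
      have e : D.poleProd r s * D.integral φ s =
          D.poleProd r' (s + Pi.single i 1) * ((s i + 1) * D.integral φ s) := by
        rw [hrr, poleProd_add_single r' s hiS]; ring
      rw [e, hφ.functional_equation hs hiS]
      have hs1 := posDom_add_single hs i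
      beta_reduce
      rw [← hH₀' _ hs1, mul_neg, mul_add, Finset.mul_sum]
      congr 2
      refine Finset.sum_congr rfl fun l _ => ?_
      rw [← hH₁' l _ hs1]; ring

end CornerData

end

/-! ### Meromorphic continuation of corner integrals -/

noncomputable section

open scoped Classical in
/-- `g` has at most simple poles, along hyperplanes `z_i = s` with `i ∈ S` and `s ∈ P i`. -/
def PolesOn {N : ℕ} (S : Finset (Fin N)) (P : Fin N → Set ℂ) (g : (Fin N → ℂ) → ℂ) : Prop :=
  ∀ w : Fin N → ℂ, ∃ h : (Fin N → ℂ) → ℂ, AnalyticAt ℂ h w ∧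
    ∀ᶠ z in 𝓝 w, (∀ i, z i ∉ P i) → (∏ i ∈ S with w i ∈ P i, (z i - w i)) * g z = h z

namespace CornerData

variable {n N : ℕ} {D : CornerData n N}

theorem isOpen_dom (r : Fin N → ℝ) : IsOpen (D.dom r) := by
  have : D.dom r = ⋂ i ∈ D.S, {s : Fin N → ℂ | -1 - r i < (s i).re} := by
    ext s; simp [dom]
  rw [this]
  exact isOpen_biInter_finset fun i _ => isOpen_lt continuous_const (by fun_prop)

theorem convex_dom (r : Fin N → ℝ) : Convex ℝ (D.dom r) := by
  intro x hx y hy a b ha hb hab i hi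
  have h1 := hx i hi
  have h2 := hy i hi
  simp only [Pi.add_apply, Pi.smul_apply, Complex.add_re, Complex.real_smul, Complex.mul_re,
    Complex.ofReal_re, Complex.ofReal_im, zero_mul, sub_zero]
  have hb' : b = 1 - a := by linarith
  subst hb'
  rcases ha.eq_or_lt with rfl | ha'
  · simpa using h2
  · nlinarith [mul_lt_mul_of_pos_left h1 ha', mul_le_mul_of_nonneg_left h2.le hb]

theorem isOpen_posDom : IsOpen D.posDom := by
  have : D.posDom = D.dom fun _ => -1 := by ext s; simp [dom, posDom]
  rw [this]; exact isOpen_dom _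

theorem one_mem_posDom : (fun _ => 1 : Fin N → ℂ) ∈ D.posDom := fun i _ => by simp

/-- Identity theorem: it suffices to compare analytic functions for positive exponents. -/
theorem eqOn_dom {r : Fin N → ℝ} (hr : ∀ i, 0 ≤ r i) {f g : (Fin N → ℂ) → ℂ}
    (hf : AnalyticOnNhd ℂ f (D.dom r)) (hg : AnalyticOnNhd ℂ g (D.dom r))
    (hfg : ∀ s ∈ D.posDom, f s = g s) : EqOn f g (D.dom r) :=
  hf.eqOn_of_preconnected_of_eventuallyEq hg (convex_dom r).isPreconnected
    (posDom_subset r hr one_mem_posDom)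
    (by filter_upwards [isOpen_posDom.mem_nhds one_mem_posDom] with s hs using hfg s hs)

theorem poleProd_analyticAt (r : Fin N → ℕ) (s : Fin N → ℂ) : AnalyticAt ℂ (D.poleProd r) s := by
  unfold poleProd
  refine Finset.analyticAt_fun_prod _ fun i _ => Finset.analyticAt_fun_prod _ fun l _ => ?_
  exact ((ContinuousLinearMap.proj (R := ℂ) (φ := fun _ : Fin N => ℂ) i).analyticAt s).add
    analyticAt_const |>.add analyticAt_const

/-- The meromorphic continuation of the corner integrals. -/
theorem Test.exists_continuation {φ : EuclideanSpace ℝ (Fin n) → ℂ} (hφ : D.Test φ) :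
    ∃ G : (Fin N → ℂ) → ℂ, (∀ s ∈ D.dom 0, G s = D.integral φ s) ∧
      PolesOn D.S (fun _ => poleSet 0) G := by
  classical
  let r : ℕ → Fin N → ℕ := fun R i => if i ∈ D.S then R else 0
  have hdomr : ∀ R, D.dom (fun i => (r R i : ℝ)) = D.dom fun _ => (R : ℝ) := by
    intro R; ext s
    refine forall₂_congr fun i hi => ?_
    simp [r, hi]
  choose H hH hH' using fun R => hφ.exists_analytic _ (r R) (fun i hi => by simp [r, hi]) rfl
  have hH : ∀ R, AnalyticOnNhd ℂ (H R) (D.dom fun _ => (R : ℝ)) := fun R => by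
    rw [← hdomr]; exact hH R
  let q : ℕ → (Fin N → ℂ) → ℂ := fun R s => D.poleProd (r R) s
  have hq0 : ∀ R s, (∀ i, s i ∉ poleSet 0) → q R s ≠ 0 := by
    intro R s hs
    refine Finset.prod_ne_zero_iff.2 fun i _ => Finset.prod_ne_zero_iff.2 fun l _ h => ?_
    exact hs i ⟨l, by push_cast; linear_combination h⟩
  have hI : ∀ R, ∀ s ∈ D.dom 0, q R s * D.integral φ s = H R s := by
    intro R
    refine eqOn_dom (r := 0) (fun _ => le_rfl)
      (fun s hs => (poleProd_analyticAt _ s).mul (hφ.analyticAt hs))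
      (fun s hs => hH R s fun i hi => ?_) (hH' R)
    have h1 := hs i hi
    have h2 : (0 : ℝ) ≤ R := Nat.cast_nonneg R
    simp only [Pi.zero_apply] at h1
    linarith
  -- The quotients H_R / q_R agree on common domains. Stated with cross multiplication, this is an
  -- identity of analytic functions, so it can be checked for positive real parts.
  have hHH : ∀ R R', ∀ s ∈ (D.dom fun _ => ((min R R' : ℕ) : ℝ)),
      q R' s * H R s = q R s * H R' s := by
    intro R R'
    refine eqOn_dom (fun _ => Nat.cast_nonneg _)
      (fun s hs => (poleProd_analyticAt _ s).mul (hH R s fun i hi => ?_))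
      (fun s hs => (poleProd_analyticAt _ s).mul (hH R' s fun i hi => ?_)) ?_
    · have h1 := hs i hi
      have h2 : ((min R R' : ℕ) : ℝ) ≤ R := by exact_mod_cast min_le_left R R'
      linarith
    · have h1 := hs i hi
      have h2 : ((min R R' : ℕ) : ℝ) ≤ R' := by exact_mod_cast min_le_right R R'
      linarith
    · intro s hs
      rw [← hH' R s hs, ← hH' R' s hs]
      simp only [q]; ring
  have hR : ∀ s : Fin N → ℂ, ∃ R : ℕ, s ∈ D.dom fun _ => (R : ℝ) := by
    intro s
    obtain ⟨R, hR⟩ := exists_nat_gt (∑ i, |(s i).re|)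
    refine ⟨R, fun i _ => ?_⟩
    have h1 : |(s i).re| ≤ ∑ i, |(s i).re| :=
      Finset.single_le_sum (f := fun i => |(s i).re|) (fun i _ => abs_nonneg _) (Finset.mem_univ i)
    have h2 := neg_abs_le (s i).re
    linarith
  choose Rs hRs using hR
  -- The integral itself is kept where it converges, so that agreement there holds at every point.
  -- On the polar hyperplanes the quotient takes the value of division by zero, which `PolesOn` does
  -- not see.
  refine ⟨fun s => if s ∈ D.dom 0 then D.integral φ s else H (Rs s) s / q (Rs s) s,
    fun s hs => by simp only [if_pos hs], fun w => ?_⟩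
  set R := Rs w with hRw
  have hG : ∀ s ∈ (D.dom fun _ => (R : ℝ)), (∀ i, s i ∉ poleSet 0) →
      (if s ∈ D.dom 0 then D.integral φ s else H (Rs s) s / q (Rs s) s) = H R s / q R s := by
    intro s hs hsP
    have h1 := hq0 R s hsP
    split_ifs with h0
    · rw [eq_div_iff h1, ← hI R s h0]; ring
    · have h2 := hq0 (Rs s) s hsP
      rw [div_eq_div_iff h2 h1]
      have : s ∈ D.dom fun _ => ((min R (Rs s) : ℕ) : ℝ) := by
        intro i hi
        have h3 := hs i hi
        have h4 := hRs s i hi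
        rw [Nat.cast_min]
        rcases min_choice (R : ℝ) (Rs s) with h | h <;> rw [h] <;> assumption
      have := hHH R (Rs s) s this
      linear_combination -this
  -- This is q_R without the linear factors that vanish at `w`. The removed factors are the s_i -
  -- w_i with i ∈ S and w_i a pole, one for each such `i`, so H_R / b is the required analytic
  -- function at `w`.
  let b : (Fin N → ℂ) → ℂ := fun s =>
    ∏ i ∈ D.S, ∏ l ∈ (Finset.range R).filter (fun l : ℕ => ¬ (w i + 1 + (l : ℂ) = 0)),
      (s i + 1 + (l : ℂ))
  have hba : AnalyticAt ℂ b w := by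
    refine Finset.analyticAt_fun_prod _ fun i _ => Finset.analyticAt_fun_prod _ fun l _ => ?_
    exact ((ContinuousLinearMap.proj (R := ℂ) (φ := fun _ : Fin N => ℂ) i).analyticAt w).add
      analyticAt_const |>.add analyticAt_const
  have hb0 : b w ≠ 0 := by
    refine Finset.prod_ne_zero_iff.2 fun i _ => Finset.prod_ne_zero_iff.2 fun l hl => ?_
    exact (Finset.mem_filter.1 hl).2
  have hqb : ∀ s, q R s = (∏ i ∈ D.S with w i ∈ poleSet 0, (s i - w i)) * b s := by
    intro s
    simp only [q, poleProd, b, Finset.prod_filter (fun i => w i ∈ poleSet 0)]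
    rw [← Finset.prod_mul_distrib]
    refine Finset.prod_congr rfl fun i hi => ?_
    have hri : r R i = R := by simp [r, hi]
    rw [hri, ← Finset.prod_filter_mul_prod_filter_not (Finset.range R)
      (fun l : ℕ => w i + 1 + (l : ℂ) = 0)]
    congr 1
    split_ifs with hP
    · obtain ⟨l₀, hl₀⟩ := hP
      have hl₀' : w i = -1 - (l₀ : ℂ) := by rw [hl₀]; push_cast; ring
      -- The chosen `R` has `w` in its domain, so -1 - R < Re w_i = -1 - l₀: the factor belonging to
      -- this pole does occur in q_R.
      have hlt : l₀ < R := by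
        have h1 := hRs w i hi
        rw [hl₀'] at h1
        simp at h1
        exact_mod_cast h1
      have : (Finset.range R).filter (fun l : ℕ => w i + 1 + (l : ℂ) = 0) = {l₀} := by
        ext l
        simp only [Finset.mem_filter, Finset.mem_range, Finset.mem_singleton, hl₀']
        constructor
        · rintro ⟨_, h⟩
          have : (l : ℂ) = l₀ := by linear_combination h
          exact_mod_cast this
        · rintro rfl; exact ⟨hlt, by ring⟩
      rw [this, Finset.prod_singleton, hl₀']; ring
    · have : (Finset.range R).filter (fun l : ℕ => w i + 1 + (l : ℂ) = 0) = ∅ := by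
        ext l
        simp only [Finset.mem_filter, Finset.notMem_empty, iff_false, not_and]
        intro _ h
        exact hP ⟨l, by push_cast; linear_combination h⟩
      rw [this, Finset.prod_empty]
  refine ⟨fun s => H R s / b s, (hH R w (hRs w)).div hba hb0, ?_⟩
  filter_upwards [(isOpen_dom _).mem_nhds (hRs w)] with s hs hsP
  have h1 := hq0 R s hsP
  rw [hG s hs hsP, hqb s]
  rw [hqb s] at h1
  have h2 := right_ne_zero_of_mul h1
  have h3 := left_ne_zero_of_mul h1
  field_simp

theorem mem_poleSet_sub (k : ℕ) (z : ℂ) : z - k ∈ poleSet 0 ↔ z ∈ poleSet k := by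
  refine exists_congr fun l => ?_
  push_cast
  constructor <;> intro h <;> linear_combination h

/-- The meromorphic continuation of the corner integrals, with shifted exponents. -/
theorem Test.exists_shifted_continuation {φ : EuclideanSpace ℝ (Fin n) → ℂ} (hφ : D.Test φ)
    (k : Fin N → ℕ) :
    ∃ G : (Fin N → ℂ) → ℂ,
      (∀ z : Fin N → ℂ, (∀ i, (k i : ℝ) - 1 < (z i).re) →
        G z = D.integral φ fun i => z i - k i) ∧
      PolesOn D.S (fun i => poleSet (k i)) G := by
  classical
  obtain ⟨G, hG, hP⟩ := hφ.exists_continuation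
  let T : (Fin N → ℂ) → Fin N → ℂ := fun z i => z i - k i
  have hT : ∀ w, AnalyticAt ℂ T w := fun w =>
    analyticAt_id.sub (analyticAt_const (v := fun i => (k i : ℂ)))
  refine ⟨fun z => G (T z), fun z hz => hG _ fun i _ => ?_, fun w => ?_⟩
  · have := hz i
    simp only [T, Pi.zero_apply, Complex.sub_re, Complex.natCast_re]
    linarith
  · obtain ⟨h, hh, hev⟩ := hP (T w)
    refine ⟨fun z => h (T z), AnalyticAt.comp (g := h) (f := T) hh (hT w), ?_⟩
    filter_upwards [(hT w).continuousAt.eventually hev] with z hz hzP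
    rw [← hz fun i hi => hzP i ((mem_poleSet_sub _ _).1 hi)]
    congr 1
    refine Finset.prod_congr (Finset.filter_congr fun i _ => (mem_poleSet_sub _ _).symm)
      fun i _ => ?_
    simp [T]

end CornerData

end

/-! ### Charts, changes of coordinates and invariance of depth -/

noncomputable section

variable {n : ℕ} {M : Type*} [TopologicalSpace M]

theorem range_cornerModel : range (cornerModel n) = quad n := range_euclideanQuadrant n

theorem extend_mem_quad (e : OpenPartialHomeomorph M (EuclideanQuadrant n)) (x : M) :
    e.extend (cornerModel n) x ∈ quad n := by
  rw [← range_cornerModel]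
  exact mem_range_self _

theorem extend_target_eq (e : OpenPartialHomeomorph M (EuclideanQuadrant n)) :
    ∃ O : Set (EuclideanSpace ℝ (Fin n)), IsOpen O ∧
      (e.extend (cornerModel n)).target = O ∩ quad n := by
  refine ⟨_, e.open_target.preimage (cornerModel n).continuous_symm, ?_⟩
  rw [e.extend_target, range_cornerModel]

theorem extend_target_subset (e : OpenPartialHomeomorph M (EuclideanQuadrant n)) :
    (e.extend (cornerModel n)).target ⊆ quad n := by
  obtain ⟨O, -, h⟩ := extend_target_eq e
  rw [h]; exact inter_subset_right

theorem extend_target_mem (e : OpenPartialHomeomorph M (EuclideanQuadrant n))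
    {y : EuclideanSpace ℝ (Fin n)} (hy : y ∈ (e.extend (cornerModel n)).target) :
    (e.extend (cornerModel n)).target ∈ 𝓝[quad n] y := by
  obtain ⟨O, hO, h⟩ := extend_target_eq e
  rw [h] at hy ⊢
  exact inter_mem (mem_nhdsWithin_of_mem_nhds (hO.mem_nhds hy.1)) self_mem_nhdsWithin

theorem tendsto_extend {e : OpenPartialHomeomorph M (EuclideanQuadrant n)} {x : M}
    (hx : x ∈ e.source) : Tendsto (e.extend (cornerModel n)) (𝓝 x)
      (𝓝[quad n] (e.extend (cornerModel n) x)) :=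
  tendsto_nhdsWithin_iff.2 ⟨(e.continuousAt_extend hx).tendsto,
    Eventually.of_forall fun _ => extend_mem_quad e _⟩

theorem tendsto_extend_symm (e : OpenPartialHomeomorph M (EuclideanQuadrant n))
    {y : EuclideanSpace ℝ (Fin n)} (hy : y ∈ (e.extend (cornerModel n)).target) :
    Tendsto (e.extend (cornerModel n)).symm (𝓝[quad n] y)
      (𝓝 ((e.extend (cornerModel n)).symm y)) := by
  have := (e.continuousOn_extend_symm (I := cornerModel n)) y hy
  exact this.mono_of_mem_nhdsWithin (extend_target_mem e hy)

theorem map_extend_symm (e : OpenPartialHomeomorph M (EuclideanQuadrant n))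
    {y : EuclideanSpace ℝ (Fin n)} (hy : y ∈ (e.extend (cornerModel n)).target) :
    (e.extend (cornerModel n)).symm y ∈ e.source := by
  rw [← e.extend_source (I := cornerModel n)]
  exact (e.extend (cornerModel n)).map_target hy

theorem map_extend {e : OpenPartialHomeomorph M (EuclideanQuadrant n)} {x : M}
    (hx : x ∈ e.source) : e.extend (cornerModel n) x ∈ (e.extend (cornerModel n)).target := by
  rw [← e.extend_source (I := cornerModel n)] at hx
  exact (e.extend (cornerModel n)).map_source hx

theorem extend_symm_apply {e : OpenPartialHomeomorph M (EuclideanQuadrant n)} {x : M}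
    (hx : x ∈ e.source) : (e.extend (cornerModel n)).symm (e.extend (cornerModel n) x) = x :=
  e.extend_left_inv hx

theorem extend_apply_symm (e : OpenPartialHomeomorph M (EuclideanQuadrant n))
    {y : EuclideanSpace ℝ (Fin n)} (hy : y ∈ (e.extend (cornerModel n)).target) :
    e.extend (cornerModel n) ((e.extend (cornerModel n)).symm y) = y :=
  (e.extend (cornerModel n)).right_inv hy

variable [ChartedSpace (EuclideanQuadrant n) M]

/-- Reading a function which is smooth on `A` in a chart. -/
theorem contDiffOn_comp_extend_symm {e : OpenPartialHomeomorph M (EuclideanQuadrant n)}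
    (he : e ∈ IsManifold.maximalAtlas (cornerModel n) ∞ M)
    {G : Type*} [NormedAddCommGroup G] [NormedSpace ℝ G] {F : M → G} {A : Set M}
    (hF : ContMDiffOn (cornerModel n) 𝓘(ℝ, G) ∞ F A) {B : Set (EuclideanSpace ℝ (Fin n))}
    (hB : B ⊆ (e.extend (cornerModel n)).target)
    (hBA : ∀ y ∈ B, (e.extend (cornerModel n)).symm y ∈ A) :
    ContDiffOn ℝ ∞ (F ∘ (e.extend (cornerModel n)).symm) B := by
  have h1 := contMDiffOn_extend_symm (I := cornerModel n) he
  rw [← contMDiffOn_iff_contDiffOn]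
  refine hF.comp (h1.mono fun y hy => ?_) hBA
  have := hB hy
  rw [e.extend_target'] at this
  exact this

variable [IsManifold (cornerModel n) ∞ M]

theorem contMDiffOn_extend' {e : OpenPartialHomeomorph M (EuclideanQuadrant n)}
    (he : e ∈ IsManifold.maximalAtlas (cornerModel n) ∞ M) :
    ContMDiffOn (cornerModel n) 𝓘(ℝ, EuclideanSpace ℝ (Fin n)) ∞ (e.extend (cornerModel n))
      e.source := e.contMDiffOn_extend he

/-- Chain rule: derivatives in terms of a chart. -/
theorem mfderiv_eq_fderivWithin_comp {e : OpenPartialHomeomorph M (EuclideanQuadrant n)}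
    (he : e ∈ IsManifold.maximalAtlas (cornerModel n) ∞ M)
    {G : Type*} [NormedAddCommGroup G] [NormedSpace ℝ G] {F : M → G} {A : Set M}
    (hF : ContMDiffOn (cornerModel n) 𝓘(ℝ, G) ∞ F A) {x : M} (hx : x ∈ e.source)
    (hA : A ∈ 𝓝 x) (X : TangentSpace (cornerModel n) x) :
    (mfderiv (cornerModel n) 𝓘(ℝ, G) F x X : G) =
      fderivWithin ℝ (F ∘ (e.extend (cornerModel n)).symm) (quad n) (e.extend (cornerModel n) x)
        (coordDeriv (e.extend (cornerModel n)) x X) := by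
  set y := e.extend (cornerModel n) x with hy
  have hyt := map_extend (n := n) hx
  have h1 : ContDiffWithinAt ℝ ∞ (F ∘ (e.extend (cornerModel n)).symm) (quad n) y := by
    have h2 := contDiffOn_comp_extend_symm he hF
      (B := (e.extend (cornerModel n)).target ∩ (e.extend (cornerModel n)).symm ⁻¹' A)
      inter_subset_left (fun y hy => hy.2)
    have hA' : A ∈ 𝓝 ((e.extend (cornerModel n)).symm y) := by
      rw [hy, extend_symm_apply hx]; exact hA
    have hyA : (e.extend (cornerModel n)).symm y ∈ A := mem_of_mem_nhds hA'
    refine (h2 y ⟨hyt, hyA⟩).mono_of_mem_nhdsWithin ?_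
    exact inter_mem (extend_target_mem e hyt) (tendsto_extend_symm e hyt hA')
  have h3 : HasFDerivWithinAt (F ∘ (e.extend (cornerModel n)).symm)
      (fderivWithin ℝ (F ∘ (e.extend (cornerModel n)).symm) (quad n) y) (quad n) y :=
    (h1.differentiableWithinAt (by simp)).hasFDerivWithinAt
  have h4 : MDifferentiableAt (cornerModel n) 𝓘(ℝ, EuclideanSpace ℝ (Fin n))
      (e.extend (cornerModel n)) x :=
    ((contMDiffOn_extend' he).contMDiffAt (e.open_source.mem_nhds hx)).mdifferentiableAt (by simp)
  have h5 := (h3.hasMFDerivWithinAt).comp x (h4.hasMFDerivAt.hasMFDerivWithinAt (s := univ))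
    (show univ ⊆ e.extend (cornerModel n) ⁻¹' quad n from fun z _ => extend_mem_quad e z)
  rw [hasMFDerivWithinAt_univ] at h5
  have h6 : F =ᶠ[𝓝 x] (F ∘ (e.extend (cornerModel n)).symm) ∘ e.extend (cornerModel n) := by
    filter_upwards [e.open_source.mem_nhds hx] with z hz
    simp only [Function.comp]
    rw [extend_symm_apply hz]
  have h7 := (h5.congr_of_eventuallyEq h6).mfderiv
  rw [h7]
  rfl

/-- The change of coordinates from the chart `e` to the chart `e'`. -/
def transition (e e' : OpenPartialHomeomorph M (EuclideanQuadrant n)) :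
    EuclideanSpace ℝ (Fin n) → EuclideanSpace ℝ (Fin n) :=
  e'.extend (cornerModel n) ∘ (e.extend (cornerModel n)).symm

variable {e e' : OpenPartialHomeomorph M (EuclideanQuadrant n)}

theorem coordDeriv_transition (he : e ∈ IsManifold.maximalAtlas (cornerModel n) ∞ M)
    (he' : e' ∈ IsManifold.maximalAtlas (cornerModel n) ∞ M) {x : M} (hx : x ∈ e.source)
    (hx' : x ∈ e'.source) (X : TangentSpace (cornerModel n) x) :
    coordDeriv (e'.extend (cornerModel n)) x X =
      fderivWithin ℝ (transition e e') (quad n) (e.extend (cornerModel n) x)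
        (coordDeriv (e.extend (cornerModel n)) x X) :=
  mfderiv_eq_fderivWithin_comp he (contMDiffOn_extend' he') hx (e'.open_source.mem_nhds hx') X

theorem transition_smooth (he : e ∈ IsManifold.maximalAtlas (cornerModel n) ∞ M)
    (he' : e' ∈ IsManifold.maximalAtlas (cornerModel n) ∞ M) {B : Set (EuclideanSpace ℝ (Fin n))}
    (hB : B ⊆ (e.extend (cornerModel n)).target)
    (hB' : ∀ y ∈ B, (e.extend (cornerModel n)).symm y ∈ e'.source) :
    ContDiffOn ℝ ∞ (transition e e') B :=
  contDiffOn_comp_extend_symm he (contMDiffOn_extend' he') hB hB'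

/-- The derivative of the coordinates, as a linear map on the tangent space. -/
def coordDerivL (e : OpenPartialHomeomorph M (EuclideanQuadrant n)) (x : M) :
    EuclideanSpace ℝ (Fin n) →L[ℝ] EuclideanSpace ℝ (Fin n) :=
  mfderiv (cornerModel n) 𝓘(ℝ, EuclideanSpace ℝ (Fin n)) (e.extend (cornerModel n)) x

theorem coordDeriv_eq (e : OpenPartialHomeomorph M (EuclideanQuadrant n)) (x : M)
    (X : TangentSpace (cornerModel n) x) :
    coordDeriv (e.extend (cornerModel n)) x X = coordDerivL e x X := rfl

theorem coordDerivL_transition (he : e ∈ IsManifold.maximalAtlas (cornerModel n) ∞ M)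
    (he' : e' ∈ IsManifold.maximalAtlas (cornerModel n) ∞ M) {x : M} (hx : x ∈ e.source)
    (hx' : x ∈ e'.source) (X : EuclideanSpace ℝ (Fin n)) :
    coordDerivL e' x X =
      fderivWithin ℝ (transition e e') (quad n) (e.extend (cornerModel n) x) (coordDerivL e x X) :=
  coordDeriv_transition he he' hx hx' X

theorem coordDerivL_injective (he : e ∈ IsManifold.maximalAtlas (cornerModel n) ∞ M) {x : M}
    (hx : x ∈ e.source) : Function.Injective (coordDerivL e x) := by
  have hc := IsManifold.chart_mem_maximalAtlas (I := cornerModel n) (n := ∞) x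
  have hxc := mem_chart_source (EuclideanQuadrant n) x
  have h1 : Function.Injective (coordDerivL (chartAt (EuclideanQuadrant n) x) x) :=
    (isInvertible_mfderiv_extChartAt (I := cornerModel n) (x := x)
      (mem_extChartAt_source x)).injective
  intro X Y hXY
  refine h1 ?_
  rw [coordDerivL_transition he hc hx hxc, coordDerivL_transition he hc hx hxc, hXY]

theorem coordDerivL_surjective (he : e ∈ IsManifold.maximalAtlas (cornerModel n) ∞ M) {x : M}
    (hx : x ∈ e.source) : Function.Surjective (coordDerivL e x) :=
  LinearMap.surjective_of_injective (f := (coordDerivL e x).toLinearMap)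
    (coordDerivL_injective he hx)

theorem fderivWithin_transition_injective
    (he : e ∈ IsManifold.maximalAtlas (cornerModel n) ∞ M)
    (he' : e' ∈ IsManifold.maximalAtlas (cornerModel n) ∞ M) {x : M} (hx : x ∈ e.source)
    (hx' : x ∈ e'.source) : Function.Injective
      (fderivWithin ℝ (transition e e') (quad n) (e.extend (cornerModel n) x)) := by
  intro v w hvw
  obtain ⟨X, rfl⟩ := coordDerivL_surjective he hx v
  obtain ⟨Y, rfl⟩ := coordDerivL_surjective he hx w
  have : coordDerivL e' x X = coordDerivL e' x Y := by
    rw [coordDerivL_transition he he' hx hx', coordDerivL_transition he he' hx hx']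
    exact hvw
  rw [coordDerivL_injective he' hx' this]

/-- The derivative of the change of coordinates is injective and maps vectors tangent to the
boundary stratum in one chart to vectors tangent to it in the other. Comparing the dimensions of the
two strata compares the numbers of vanishing coordinates. -/
theorem ncard_zero_le (he : e ∈ IsManifold.maximalAtlas (cornerModel n) ∞ M)
    (he' : e' ∈ IsManifold.maximalAtlas (cornerModel n) ∞ M) {x : M} (hx : x ∈ e.source)
    (hx' : x ∈ e'.source) :
    {i | e'.extend (cornerModel n) x i = 0}.ncard ≤ {i | e.extend (cornerModel n) x i = 0}.ncard := by
  classical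
  set y := e.extend (cornerModel n) x with hy
  set τ := transition e e' with hτ
  have hyt := map_extend (n := n) hx
  have hτy : τ y = e'.extend (cornerModel n) x := by
    simp only [hτ, transition, Function.comp, hy]; rw [extend_symm_apply hx]
  have hd : HasFDerivWithinAt τ (fderivWithin ℝ τ (quad n) y) (quad n) y := by
    have h2 := transition_smooth he he'
      (B := (e.extend (cornerModel n)).target ∩ (e.extend (cornerModel n)).symm ⁻¹' e'.source)
      inter_subset_left (fun y hy => hy.2)
    have hA' : e'.source ∈ 𝓝 ((e.extend (cornerModel n)).symm y) := by
      rw [hy, extend_symm_apply hx]; exact e'.open_source.mem_nhds hx'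
    have hyA : (e.extend (cornerModel n)).symm y ∈ e'.source := mem_of_mem_nhds hA'
    refine (((h2 y ⟨hyt, hyA⟩).mono_of_mem_nhdsWithin ?_).differentiableWithinAt
      (by simp)).hasFDerivWithinAt
    exact inter_mem (extend_target_mem e hyt) (tendsto_extend_symm e hyt hA')
  set D := fderivWithin ℝ τ (quad n) y with hD
  have hinj : Function.Injective D := fderivWithin_transition_injective he he' hx hx'
  -- For such `v` the line y + t v stays in the quadrant for small `t` of both signs. A coordinate
  -- of its image that vanishes at t = 0 is nonnegative, so it has a minimum there and derivative
  -- zero.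
  have key : ∀ v : EuclideanSpace ℝ (Fin n), (∀ i, y i = 0 → v i = 0) →
      ∀ i, e'.extend (cornerModel n) x i = 0 → D v i = 0 := by
    intro v hv i hi
    have hs : {t : ℝ | y + t • v ∈ quad n} ∈ 𝓝 (0 : ℝ) := by
      have : ∀ᶠ t : ℝ in 𝓝 0, ∀ l, 0 ≤ (y + t • v) l := by
        rw [eventually_all]
        intro l
        rcases (extend_mem_quad e x l).lt_or_eq with h | h
        · have hc : Continuous fun t : ℝ => (y + t • v) l := by simp; fun_prop
          have h0 : 0 < (y + (0 : ℝ) • v) l := by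
            rw [zero_smul, add_zero]; exact h
          exact ((hc.tendsto 0).eventually (lt_mem_nhds h0)).mono fun t ht => ht.le
        · refine Eventually.of_forall fun t => ?_
          have h' : y l = 0 := h.symm
          simp [h', hv l h']
      exact this
    have hcurve : HasDerivAt (fun t : ℝ => y + t • v) v 0 := by
      simpa using ((hasDerivAt_id (0 : ℝ)).smul_const v).const_add y
    have h1 : HasDerivWithinAt (τ ∘ fun t : ℝ => y + t • v) (D v)
        {t : ℝ | y + t • v ∈ quad n} 0 := by
      have hd' : HasFDerivWithinAt τ D (quad n) (y + (0 : ℝ) • v) := by simpa using hd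
      exact hd'.comp_hasDerivWithinAt 0 hcurve.hasDerivWithinAt (fun t ht => ht)
    have h2 := h1.hasDerivAt hs
    have h3 : HasDerivAt (fun t : ℝ => τ (y + t • v) i) (D v i) 0 := by
      have := ((EuclideanSpace.proj (𝕜 := ℝ) i : EuclideanSpace ℝ (Fin n) →L[ℝ] ℝ).hasFDerivAt
        (x := τ (y + (0 : ℝ) • v))).comp_hasDerivAt (0 : ℝ) h2
      exact this
    refine IsLocalMin.hasDerivAt_eq_zero ?_ h3
    refine Eventually.of_forall fun t => ?_
    simp only [zero_smul, add_zero, hτy, hi]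
    exact extend_mem_quad e' _ i
  let ext : ({i // ¬ (y i = 0)} → ℝ) → EuclideanSpace ℝ (Fin n) := fun u =>
    WithLp.toLp 2 fun j => if h : y j = 0 then 0 else u ⟨j, h⟩
  have hext_add : ∀ u v, ext (u + v) = ext u + ext v := by
    intro u v
    refine PiLp.ext fun j => ?_
    by_cases h : y j = 0 <;> simp [ext, h]
  have hext_smul : ∀ (c : ℝ) u, ext (c • u) = c • ext u := by
    intro c u
    refine PiLp.ext fun j => ?_
    by_cases h : y j = 0 <;> simp [ext, h]
  let A : ({i // ¬ (y i = 0)} → ℝ) →ₗ[ℝ] ({i // ¬ (e'.extend (cornerModel n) x i = 0)} → ℝ) :=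
    { toFun := fun u i => D (ext u) i
      map_add' := fun u v => by ext i; rw [hext_add, map_add]; rfl
      map_smul' := fun c u => by ext i; rw [hext_smul, map_smul]; rfl }
  have hA : Function.Injective A := by
    rw [← LinearMap.ker_eq_bot, LinearMap.ker_eq_bot']
    intro u hu
    have h0 : D (ext u) = 0 := by
      ext i
      by_cases hi : e'.extend (cornerModel n) x i = 0
      · exact key _ (fun j hj => by simp [ext, hj]) i hi
      · exact congrFun hu ⟨i, hi⟩
    have h1 := hinj (h0.trans (map_zero D).symm)
    ext ⟨j, hj⟩
    have := congrArg (fun v : EuclideanSpace ℝ (Fin n) => v j) h1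
    simpa [ext, hj] using this
  have h1 := LinearMap.finrank_le_finrank_of_injective hA
  rw [Module.finrank_fintype_fun_eq_card, Module.finrank_fintype_fun_eq_card,
    Fintype.card_subtype_compl, Fintype.card_subtype_compl] at h1
  have h2 : ∀ p : Fin n → Prop, {i | p i}.ncard = Fintype.card {i // p i} := by
    intro p
    rw [← Nat.card_eq_fintype_card]
    rfl
  rw [h2, h2]
  have h3 := Fintype.card_subtype_le (fun i => y i = 0)
  have h4 := Fintype.card_subtype_le (fun i => e'.extend (cornerModel n) x i = 0)
  omega

/-- The depth can be computed in any chart. -/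
theorem depth_eq (he : e ∈ IsManifold.maximalAtlas (cornerModel n) ∞ M) {x : M}
    (hx : x ∈ e.source) : depth n x = {i | e.extend (cornerModel n) x i = 0}.ncard := by
  have hc := IsManifold.chart_mem_maximalAtlas (I := cornerModel n) (n := ∞) x
  have hxc := mem_chart_source (EuclideanQuadrant n) x
  exact le_antisymm (ncard_zero_le he hc hx hxc) (ncard_zero_le hc he hxc hx)

theorem mem_interior_iff_depth {x : M} : x ∈ (cornerModel n).interior M ↔ depth n x = 0 := by
  have h1 : x ∈ (cornerModel n).interior M ↔
      extChartAt (cornerModel n) x x ∈ openQuad n := by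
    rw [← interior_quad, ← range_cornerModel]; rfl
  have h2 : extChartAt (cornerModel n) x x ∈ quad n :=
    extend_mem_quad (chartAt (EuclideanQuadrant n) x) x
  rw [h1, depth, Set.ncard_eq_zero, eq_empty_iff_forall_notMem]
  refine forall_congr' fun i => ?_
  have := h2 i
  constructor
  · intro h; exact h.ne'
  · intro h; exact lt_of_le_of_ne this (fun h' => h h'.symm)

theorem mem_interior_iff (he : e ∈ IsManifold.maximalAtlas (cornerModel n) ∞ M) {x : M}
    (hx : x ∈ e.source) :
    x ∈ (cornerModel n).interior M ↔ e.extend (cornerModel n) x ∈ openQuad n := by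
  rw [mem_interior_iff_depth, depth_eq he hx, Set.ncard_eq_zero, eq_empty_iff_forall_notMem]
  refine forall_congr' fun i => ?_
  have := extend_mem_quad e x i
  constructor
  · intro h; exact lt_of_le_of_ne this (fun h' => h h'.symm)
  · intro h; exact h.ne'

end

/-! ### Coordinate cubes and boundary defining functions in a chart -/

noncomputable section

/-- Open cubes in `ℝⁿ`. -/
def cube {n : ℕ} (y₀ : EuclideanSpace ℝ (Fin n)) (r : ℝ) : Set (EuclideanSpace ℝ (Fin n)) :=
  {y | ∀ i, |y i - y₀ i| < r}

theorem isOpen_cube {n : ℕ} (y₀ : EuclideanSpace ℝ (Fin n)) (r : ℝ) : IsOpen (cube y₀ r) := by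
  simp only [cube, ofPred_forall]
  exact isOpen_iInter_of_finite fun i => isOpen_lt (by fun_prop) continuous_const

theorem mem_cube_self {n : ℕ} (y₀ : EuclideanSpace ℝ (Fin n)) {r : ℝ} (hr : 0 < r) :
    y₀ ∈ cube y₀ r := fun i => by simpa using hr

theorem convex_cube {n : ℕ} (y₀ : EuclideanSpace ℝ (Fin n)) (r : ℝ) : Convex ℝ (cube y₀ r) := by
  intro x hx y hy a b ha hb hab i
  have h1 := abs_lt.1 (hx i)
  have h2 := abs_lt.1 (hy i)
  have h3 : (a • x + b • y) i - y₀ i = a * (x i - y₀ i) + b * (y i - y₀ i) := by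
    simp only [PiLp.add_apply, PiLp.smul_apply, smul_eq_mul]
    have : y₀ i = (a + b) * y₀ i := by rw [hab, one_mul]
    linear_combination -this
  rw [h3]
  have hb' : b = 1 - a := by linarith
  subst hb'
  rcases ha.eq_or_lt with rfl | ha'
  · simpa using hy i
  · rw [abs_lt]
    constructor <;> nlinarith [mul_lt_mul_of_pos_left h1.1 ha', mul_lt_mul_of_pos_left h1.2 ha',
      mul_le_mul_of_nonneg_left h2.1.le hb, mul_le_mul_of_nonneg_left h2.2.le hb]

theorem exists_cube_subset {n : ℕ} {y₀ : EuclideanSpace ℝ (Fin n)}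
    {O : Set (EuclideanSpace ℝ (Fin n))} (hO : O ∈ 𝓝 y₀) : ∃ r > 0, cube y₀ r ⊆ O := by
  have h1 : (WithLp.toLp 2 : (Fin n → ℝ) → EuclideanSpace ℝ (Fin n)) ⁻¹' O ∈ 𝓝 (y₀.ofLp) :=
    (PiLp.continuous_toLp 2 (fun _ : Fin n => ℝ)).continuousAt.preimage_mem_nhds (by simpa using hO)
  obtain ⟨r, hr, hrO⟩ := Metric.mem_nhds_iff.1 h1
  refine ⟨r, hr, fun y hy => ?_⟩
  have : y.ofLp ∈ Metric.ball y₀.ofLp r := by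
    rw [Metric.mem_ball, dist_pi_lt_iff hr]
    intro i
    rw [Real.dist_eq]; exact hy i
  simpa using hrO this

variable {n : ℕ} {M : Type*} [TopologicalSpace M] [ChartedSpace (EuclideanQuadrant n) M]

/-- Small cubes around a point in a chart: they lie in the target of the chart and only meet those
boundary hyperplanes which pass through the point. -/
theorem exists_chart_cube {e : OpenPartialHomeomorph M (EuclideanQuadrant n)} {q : M}
    (hq : q ∈ e.source) {O : Set (EuclideanSpace ℝ (Fin n))}
    (hO : O ∈ 𝓝 (e.extend (cornerModel n) q)) : ∃ r > 0,
      cube (e.extend (cornerModel n) q) r ∩ quad n ⊆ (e.extend (cornerModel n)).target ∧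
      cube (e.extend (cornerModel n) q) r ⊆ O ∧
      ∀ y ∈ cube (e.extend (cornerModel n) q) r, ∀ j, e.extend (cornerModel n) q j ≠ 0 →
        0 < y j := by
  obtain ⟨O', hO', hO'e⟩ := extend_target_eq e
  have hqt := map_extend (n := n) hq
  rw [hO'e] at hqt
  set y₀ := e.extend (cornerModel n) q with hy₀
  have h1 : {y : EuclideanSpace ℝ (Fin n) | ∀ j, y₀ j ≠ 0 → 0 < y j} ∈ 𝓝 y₀ := by
    have : ∀ᶠ y in 𝓝 y₀, ∀ j, y₀ j ≠ 0 → 0 < y j := by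
      rw [eventually_all]
      intro j
      by_cases hj : y₀ j = 0
      · simp [hj]
      · have h2 : 0 < y₀ j := lt_of_le_of_ne (extend_mem_quad e q j) (Ne.symm hj)
        exact ((continuous_coord j).continuousAt.eventually (lt_mem_nhds h2)).mono
          fun y hy _ => hy
    exact this
  obtain ⟨r, hr, hrs⟩ := exists_cube_subset (inter_mem (inter_mem hO (hO'.mem_nhds hqt.1)) h1)
  refine ⟨r, hr, fun y hy => ?_, fun y hy => (hrs hy).1.1, fun y hy => (hrs hy).2⟩
  rw [hO'e]; exact ⟨(hrs hy.1).1.2, hy.2⟩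

variable {N : ℕ} {F : Fin N → Set M} {ρ : Fin N → SmoothFun n M}

theorem IsHyperfaceSystem.exists_face (hF : IsHyperfaceSystem n F ρ) {q : M}
    (hq : depth n q = 1) :
    ∃ i, F i = closure (connectedComponentIn {x : M | depth n x = 1} q) := by
  have : closure (connectedComponentIn {x : M | depth n x = 1} q) ∈ Set.range F := by
    rw [hF.range_eq]; exact ⟨q, hq, rfl⟩
  exact this

theorem IsHyperfaceSystem.exists_point (hF : IsHyperfaceSystem n F ρ) (i : Fin N) :
    ∃ q, depth n q = 1 ∧ F i = closure (connectedComponentIn {x : M | depth n x = 1} q) := by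
  have : F i ∈ hyperfaces n M := by rw [← hF.range_eq]; exact mem_range_self i
  exact this

/-- One-sided derivatives along a ray are unique, and near the start of the ray the function is
zero. It kills the derivatives of a defining function along its own face. -/
theorem deriv_eq_zero_of_vanishing {f : EuclideanSpace ℝ (Fin n) → ℝ}
    {y v : EuclideanSpace ℝ (Fin n)} (hf : DifferentiableWithinAt ℝ f (quad n) y)
    (hq : ∀ t : ℝ, 0 ≤ t → y + t • v ∈ quad n) (h0 : ∀ᶠ t : ℝ in 𝓝[≥] 0, f (y + t • v) = 0) :
    fderivWithin ℝ f (quad n) y v = 0 := by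
  have hd : HasFDerivWithinAt f (fderivWithin ℝ f (quad n) y) (quad n) (y + (0 : ℝ) • v) := by
    simpa using hf.hasFDerivWithinAt
  have hcurve : HasDerivAt (fun t : ℝ => y + t • v) v 0 := by
    simpa using ((hasDerivAt_id (0 : ℝ)).smul_const v).const_add y
  have h1 : HasDerivWithinAt (f ∘ fun t : ℝ => y + t • v) (fderivWithin ℝ f (quad n) y v)
      (Ici 0) 0 := hd.comp_hasDerivWithinAt 0 hcurve.hasDerivWithinAt (fun t ht => hq t ht)
  have h2 : HasDerivWithinAt (f ∘ fun t : ℝ => y + t • v) 0 (Ici 0) 0 :=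
    (hasDerivWithinAt_const (0 : ℝ) (Ici 0) (0 : ℝ)).congr_of_eventuallyEq h0
      (h0.self_of_nhdsWithin self_mem_Ici)
  exact (uniqueDiffOn_Ici (0 : ℝ) 0 self_mem_Ici).eq_deriv _ h1 h2

theorem add_single_mem_quad {y : EuclideanSpace ℝ (Fin n)} (hy : y ∈ quad n) (m : Fin n) {t : ℝ}
    (ht : 0 ≤ t) : y + t • EuclideanSpace.single m (1 : ℝ) ∈ quad n := by
  intro l
  have := hy l
  by_cases h : l = m
  · subst h; simp; linarith
  · simp [h, this]

variable [IsManifold (cornerModel n) ∞ M]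

theorem contDiffOn_fun_chart {e : OpenPartialHomeomorph M (EuclideanQuadrant n)}
    (he : e ∈ IsManifold.maximalAtlas (cornerModel n) ∞ M) (f : SmoothFun n M) :
    ContDiffOn ℝ ∞ (f ∘ (e.extend (cornerModel n)).symm) (e.extend (cornerModel n)).target :=
  contDiffOn_comp_extend_symm he (f.contMDiff.contMDiffOn (s := univ)) subset_rfl
    fun _ _ => mem_univ _

theorem IsBoundaryDefining.exists_deriv_ne {G : Set M} {f : SmoothFun n M}
    (hf : IsBoundaryDefining n G f) {e : OpenPartialHomeomorph M (EuclideanQuadrant n)}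
    (he : e ∈ IsManifold.maximalAtlas (cornerModel n) ∞ M) {y : EuclideanSpace ℝ (Fin n)}
    (hy : y ∈ (e.extend (cornerModel n)).target)
    (hG : (e.extend (cornerModel n)).symm y ∈ G) : ∃ m, fderivWithin ℝ
      (f ∘ (e.extend (cornerModel n)).symm) (quad n) y (EuclideanSpace.single m 1) ≠ 0 := by
  by_contra h
  push Not at h
  have h0 : fderivWithin ℝ (f ∘ (e.extend (cornerModel n)).symm) (quad n) y = 0 := by
    refine ContinuousLinearMap.coe_injective
      ((EuclideanSpace.basisFun (Fin n) ℝ).toBasis.ext fun m => ?_)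
    simpa using h m
  refine hf.deriv_ne _ hG ?_
  refine ContinuousLinearMap.ext fun X => ?_
  have h1 := mfderiv_eq_fderivWithin_comp he (f.contMDiff.contMDiffOn (s := univ))
    (map_extend_symm e hy) univ_mem X
  rw [extend_apply_symm e hy, h0] at h1
  exact h1

end

/-! ### Local normal form of the boundary defining functions -/

noncomputable section

variable {n : ℕ} {M : Type*} [TopologicalSpace M] [ChartedSpace (EuclideanQuadrant n) M]
variable {N : ℕ} {F : Fin N → Set M} {ρ : Fin N → SmoothFun n M}

/-- The points of a cube on exactly one boundary hyperplane. -/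
def facePart (y₀ : EuclideanSpace ℝ (Fin n)) (r : ℝ) (j : Fin n) :
    Set (EuclideanSpace ℝ (Fin n)) := {y | y ∈ cube y₀ r ∧ y j = 0 ∧ ∀ l, l ≠ j → 0 < y l}

theorem facePart_subset_quad (y₀ : EuclideanSpace ℝ (Fin n)) (r : ℝ) (j : Fin n) :
    facePart y₀ r j ⊆ quad n := by
  intro y hy l
  by_cases h : l = j
  · rw [h, hy.2.1]
  · exact (hy.2.2 l h).le

theorem convex_facePart (y₀ : EuclideanSpace ℝ (Fin n)) (r : ℝ) (j : Fin n) :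
    Convex ℝ (facePart y₀ r j) := by
  intro x hx y hy a b ha hb hab
  refine ⟨convex_cube y₀ r hx.1 hy.1 ha hb hab, by simp [hx.2.1, hy.2.1], fun l hl => ?_⟩
  have h1 := hx.2.2 l hl
  have h2 := hy.2.2 l hl
  simp only [PiLp.add_apply, PiLp.smul_apply, smul_eq_mul]
  rcases ha.eq_or_lt with rfl | ha'
  · have : b = 1 := by linarith
    simpa [this] using h2
  · have := mul_pos ha' h1
    have := mul_nonneg hb h2.le
    linarith

theorem exists_mem_facePart {y₀ : EuclideanSpace ℝ (Fin n)} (hy₀ : y₀ ∈ quad n) {r : ℝ}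
    (hr : 0 < r) {j : Fin n} (hj : y₀ j = 0) : ∃ h, h ∈ facePart y₀ r j := by
  refine ⟨WithLp.toLp 2 fun l => if l = j then 0 else y₀ l + r / 2, fun l => ?_, by simp,
    fun l hl => ?_⟩
  · by_cases h : l = j
    · subst h; simpa [hj] using hr
    · simp only [h, if_false, add_sub_cancel_left]
      rw [abs_of_pos (by linarith)]; linarith
  · simp only [hl, if_false]
    have := hy₀ l
    linarith

/-- On the segment from `y` to `h` the j-th coordinate stays zero while the others become positive
at once. Points of a boundary hyperplane are thus limits of points lying on no other one. -/
theorem mem_closure_facePart {y₀ : EuclideanSpace ℝ (Fin n)} {r : ℝ} {j : Fin n}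
    {h : EuclideanSpace ℝ (Fin n)} (hh : h ∈ facePart y₀ r j) {y : EuclideanSpace ℝ (Fin n)}
    (hy : y ∈ cube y₀ r ∩ quad n) (hj : y j = 0) :
    Tendsto (fun t : ℝ => (1 - t) • y + t • h) (𝓝[>] 0) (𝓝[quad n] y) ∧
      ∀ᶠ t : ℝ in 𝓝[>] 0, (1 - t) • y + t • h ∈ facePart y₀ r j := by
  have hev : ∀ᶠ t : ℝ in 𝓝[>] 0, (1 - t) • y + t • h ∈ facePart y₀ r j := by
    have h1 : ∀ᶠ t : ℝ in 𝓝[>] 0, t < 1 := nhdsWithin_le_nhds (gt_mem_nhds one_pos)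
    filter_upwards [h1, self_mem_nhdsWithin] with t ht1 ht0
    rw [mem_Ioi] at ht0
    refine ⟨convex_cube y₀ r hy.1 hh.1 (by linarith) ht0.le (by ring), by simp [hj, hh.2.1],
      fun l hl => ?_⟩
    have h3 := hy.2 l
    have h4 := hh.2.2 l hl
    simp only [PiLp.add_apply, PiLp.smul_apply, smul_eq_mul]
    have := mul_pos ht0 h4
    have := mul_nonneg (by linarith : 0 ≤ 1 - t) h3
    linarith
  refine ⟨tendsto_nhdsWithin_iff.2 ⟨?_, hev.mono fun t ht => facePart_subset_quad _ _ _ ht⟩, hev⟩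
  have hc : Continuous fun t : ℝ => (1 - t) • y + t • h := by fun_prop
  have := hc.tendsto 0
  simp only [sub_zero, one_smul, zero_smul, add_zero] at this
  exact this.mono_left nhdsWithin_le_nhds

variable [IsManifold (cornerModel n) ∞ M]

/-- In a chart around `q`, the boundary defining functions of the faces through `q` are, up to
smooth positive factors, the coordinates vanishing at `q`. -/
theorem IsHyperfaceSystem.exists_cornerData [T2Space M] (hn : 0 < n)
    (hF : IsHyperfaceSystem n F ρ)
    {e : OpenPartialHomeomorph M (EuclideanQuadrant n)}
    (he : e ∈ IsManifold.maximalAtlas (cornerModel n) ∞ M) {q : M} (hq : q ∈ e.source)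
    {O : Set (EuclideanSpace ℝ (Fin n))} (hO : O ∈ 𝓝 (e.extend (cornerModel n) q)) :
    ∃ D : CornerData n N, e.extend (cornerModel n) q ∈ D.W ∧ D.W ⊆ O ∧
      D.W ∩ quad n ⊆ (e.extend (cornerModel n)).target ∧
      (∀ i, ∀ y ∈ D.W ∩ quad n, ρ i ((e.extend (cornerModel n)).symm y) = D.rho i y) ∧
      (∀ i ∈ D.S, e.extend (cornerModel n) q (D.idx i) = 0) ∧
      (∀ j, e.extend (cornerModel n) q j = 0 → ∃ i ∈ D.S, D.idx i = j) ∧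
      ∀ y ∈ D.W, ∀ j, e.extend (cornerModel n) q j ≠ 0 → 0 < y j := by
  classical
  set y₀ := e.extend (cornerModel n) q with hy₀
  set σ := (e.extend (cornerModel n)).symm with hσ
  have hy₀q : y₀ ∈ quad n := extend_mem_quad e q
  obtain ⟨r, hr, hrt, hrO, hrpos⟩ := exists_chart_cube hq hO
  set B := cube y₀ r ∩ quad n with hB
  set D₁ : Set M := {x : M | depth n x = 1} with hD₁
  set f : Fin N → EuclideanSpace ℝ (Fin n) → ℝ := fun i => ρ i ∘ σ with hf
  have hfs : ∀ i, ContDiffOn ℝ ∞ (f i) B := fun i => (contDiffOn_fun_chart he (ρ i)).mono hrt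
  have hBconv : Convex ℝ B := (convex_cube y₀ r).inter (convex_quad n)
  have hBu : UniqueDiffOn ℝ B := uniqueDiffOn_inter_quad (isOpen_cube y₀ r)
  have hBmem : ∀ y ∈ B, B ∈ 𝓝[quad n] y := fun y hy =>
    inter_mem (mem_nhdsWithin_of_mem_nhds ((isOpen_cube y₀ r).mem_nhds hy.1)) self_mem_nhdsWithin
  have hfd : ∀ i, ∀ y ∈ B, DifferentiableWithinAt ℝ (f i) (quad n) y := fun i y hy =>
    ((hfs i y hy).mono_of_mem_nhdsWithin (hBmem y hy)).differentiableWithinAt (by simp)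
  have hfB : ∀ i, ∀ y ∈ B, fderivWithin ℝ (f i) B y = fderivWithin ℝ (f i) (quad n) y := by
    intro i y hy
    rw [hB, inter_comm]
    exact fderivWithin_inter ((isOpen_cube y₀ r).mem_nhds hy.1)
  have hdepth : ∀ j, ∀ y ∈ facePart y₀ r j, σ y ∈ D₁ := by
    intro j y hy
    have hyt := hrt ⟨hy.1, facePart_subset_quad _ _ _ hy⟩
    change depth n (σ y) = 1
    rw [depth_eq he (map_extend_symm e hyt), extend_apply_symm e hyt]
    have : {i | y i = 0} = {j} := by
      ext l
      simp only [mem_ofPred_eq, mem_singleton_iff]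
      constructor
      · intro h; by_contra hl; exact (hy.2.2 l hl).ne' h
      · rintro rfl; exact hy.2.1
    rw [this, ncard_singleton]
  choose h hh using fun (j : {j : Fin n // y₀ j = 0}) => exists_mem_facePart hy₀q hr j.2
  -- `R i j` says that the hyperplane y_j = 0 belongs to F_i near `q`. The depth-one points of the
  -- cube on this hyperplane form a convex set, so they lie in one component, and the sample point
  -- `h` identifies it.
  let R : Fin N → Fin n → Prop := fun i j =>
    ∃ hj : y₀ j = 0, F i = closure (connectedComponentIn D₁ (σ (h ⟨j, hj⟩)))
  have hRex : ∀ j, y₀ j = 0 → ∃ i, R i j := by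
    intro j hj
    obtain ⟨i, hi⟩ := hF.exists_face (hdepth j _ (hh ⟨j, hj⟩))
    exact ⟨i, hj, hi⟩
  have hpart : ∀ j (hj : y₀ j = 0), ∀ y ∈ facePart y₀ r j,
      σ y ∈ connectedComponentIn D₁ (σ (h ⟨j, hj⟩)) := by
    intro j hj y hy
    have hc : ContinuousOn σ (facePart y₀ r j) :=
      (e.continuousOn_extend_symm (I := cornerModel n)).mono fun z hz =>
        hrt ⟨hz.1, facePart_subset_quad _ _ _ hz⟩
    have := ((convex_facePart y₀ r j).isPreconnected.image σ hc).subset_connectedComponentIn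
      (mem_image_of_mem σ (hh ⟨j, hj⟩))
      (by rintro _ ⟨z, hz, rfl⟩; exact hdepth j z hz)
    exact this (mem_image_of_mem σ hy)
  -- A point of F_i is a limit of depth-one points of its component. Each of these, when near `y`,
  -- lies on exactly one hyperplane, whose component must then be that of F_i. If no hyperplane of
  -- F_i contained `y`, points near `y` would avoid all of them.
  have hzero : ∀ i, ∀ y ∈ B, f i y = 0 ↔ ∃ j, R i j ∧ y j = 0 := by
    intro i y hy
    have hyt := hrt hy
    rw [show f i y = 0 ↔ σ y ∈ F i from (hF.defining i).zero_iff _]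
    constructor
    · intro hyF
      obtain ⟨p, hp, hFp⟩ := hF.exists_point i
      by_contra hcon
      push Not at hcon
      rw [hFp, mem_closure_iff_frequently] at hyF
      refine hyF ?_
      have ht := tendsto_extend (n := n) (map_extend_symm e hyt)
      rw [extend_apply_symm e hyt] at ht
      have h1 : ∀ᶠ z in 𝓝[quad n] y, ∀ j, R i j → z j ≠ 0 := by
        refine Eventually.filter_mono nhdsWithin_le_nhds ?_
        rw [eventually_all]
        intro j
        by_cases hRj : R i j
        · filter_upwards [(continuous_coord j).continuousAt.eventually_ne (hcon j hRj)] with z hz _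
            using hz
        · exact Eventually.of_forall fun z hz => absurd hz hRj
      filter_upwards [ht h1, ht (hBmem y hy),
        e.open_source.mem_nhds (map_extend_symm e hyt)] with x hx1 hx2 hx3 hxC
      have hx4 : depth n x = 1 := connectedComponentIn_subset {x : M | depth n x = 1} p hxC
      rw [depth_eq he hx3, ncard_eq_one] at hx4
      obtain ⟨j, hj⟩ := hx4
      have hxj : e.extend (cornerModel n) x j = 0 := by
        have : j ∈ ({j} : Set (Fin n)) := rfl
        rw [← hj] at this; exact this
      have hy₀j : y₀ j = 0 := by
        by_contra hne
        exact (hrpos _ hx2.1 j hne).ne' hxj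
      have hxf : e.extend (cornerModel n) x ∈ facePart y₀ r j := by
        refine ⟨hx2.1, hxj, fun l hl => ?_⟩
        refine lt_of_le_of_ne (hx2.2 l) fun h0 => hl ?_
        have : l ∈ {i | e.extend (cornerModel n) x i = 0} := h0.symm
        rw [hj] at this; exact this
      have h5 := hpart j hy₀j _ hxf
      rw [hσ, extend_symm_apply hx3] at h5
      refine hx1 j ⟨hy₀j, ?_⟩ hxj
      rw [hFp, connectedComponentIn_eq hxC, connectedComponentIn_eq h5]
    · rintro ⟨j, ⟨hj, hRj⟩, hyj⟩
      rw [hRj]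
      obtain ⟨h1, h2⟩ := mem_closure_facePart (hh ⟨j, hj⟩) hy hyj
      exact mem_closure_of_tendsto ((tendsto_extend_symm e hyt).comp h1)
        (h2.mono fun t ht => hpart j hj _ ht)
  have htang : ∀ i j, R i j → ∀ y ∈ B, y j = 0 → ∀ m, m ≠ j →
      fderivWithin ℝ (f i) (quad n) y (EuclideanSpace.single m 1) = 0 := by
    intro i j hRj y hy hyj m hm
    refine deriv_eq_zero_of_vanishing (hfd i y hy)
      (fun t ht => add_single_mem_quad hy.2 m ht) ?_
    have hc : Tendsto (fun t : ℝ => y + t • EuclideanSpace.single m (1 : ℝ)) (𝓝[≥] 0) (𝓝 y) := by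
      have hc : Continuous fun t : ℝ => y + t • EuclideanSpace.single m (1 : ℝ) := by fun_prop
      have := hc.tendsto 0
      rw [zero_smul, add_zero] at this
      exact this.mono_left nhdsWithin_le_nhds
    filter_upwards [hc ((isOpen_cube y₀ r).mem_nhds hy.1), self_mem_nhdsWithin] with t ht ht0
    refine (hzero i _ ⟨ht, add_single_mem_quad hy.2 m ht0⟩).2 ⟨j, hRj, ?_⟩
    simp [hyj, Ne.symm hm]
  have hne : ∀ i, ∀ y ∈ B, f i y = 0 → ∃ m,
      fderivWithin ℝ (f i) (quad n) y (EuclideanSpace.single m 1) ≠ 0 := fun i y hy h0 =>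
    (hF.defining i).exists_deriv_ne he (hrt hy) (((hF.defining i).zero_iff _).1 h0)
  have hy₀B : y₀ ∈ B := ⟨mem_cube_self y₀ hr, hy₀q⟩
  -- A face cannot meet itself at `q`: vanishing on two hyperplanes would kill every partial
  -- derivative of ρ_i at `q`, against dρ_i ≠ 0.
  have hRinj : ∀ i j l, R i j → R i l → j = l := by
    intro i j l hj hl
    by_contra hjl
    obtain ⟨m, hm⟩ := hne i y₀ hy₀B ((hzero i y₀ hy₀B).2 ⟨j, hj, hj.1⟩)
    by_cases hmj : m = j
    · exact hm (htang i l hl y₀ hy₀B hl.1 m (by rw [hmj]; exact hjl))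
    · exact hm (htang i j hj y₀ hy₀B hj.1 m hmj)
  have hRuniq : ∀ i k j, R i j → R k j → i = k := by
    rintro i k j ⟨hj, h1⟩ ⟨_, h2⟩
    exact hF.injective (h1.trans h2.symm)
  -- Faces that miss `q` get the irrelevant coordinate 0, which exists because n > 0.
  have hidx : ∀ i, ∃ j : Fin n, (∃ j, R i j) → R i j := by
    intro i
    by_cases hex : ∃ j, R i j
    · exact ⟨hex.choose, fun _ => hex.choose_spec⟩
    · exact ⟨⟨0, hn⟩, fun h => absurd h hex⟩
  choose idx hidx using hidx
  have hg : ∀ i, ∃ g : EuclideanSpace ℝ (Fin n) → ℝ, ContDiffOn ℝ ∞ g B ∧ (∀ y ∈ B, 0 < g y) ∧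
      ∀ y ∈ B, f i y = (if ∃ j, R i j then y (idx i) else 1) * g y := by
    intro i
    by_cases hex : ∃ j, R i j
    · have hRi := hidx i hex
      set j := idx i with hj
      have hfz : ∀ y ∈ B, f i y = 0 ↔ y j = 0 := by
        intro y hy
        rw [hzero i y hy]
        constructor
        · rintro ⟨l, hl, hyl⟩; rwa [hRinj i j l hRi hl]
        · intro h; exact ⟨j, hRi, h⟩
      have hscale : ∀ y ∈ B, ∀ t ∈ Icc (0 : ℝ) 1,
          y - ((1 - t) * y j) • EuclideanSpace.single j (1 : ℝ) ∈ B := by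
        intro y hy t ht
        have hcoord : ∀ l, (y - ((1 - t) * y j) • EuclideanSpace.single j (1 : ℝ)) l =
            if l = j then t * y j else y l := by
          intro l
          by_cases hl : l = j
          · subst hl; simp; ring
          · simp [hl]
        have hyj := hy.2 j
        refine ⟨fun l => ?_, fun l => ?_⟩
        · rw [hcoord]
          split_ifs with hl
          · have h1 := hy.1 j
            rw [hl, hRi.1, sub_zero] at *
            rw [abs_of_nonneg hyj] at h1
            rw [abs_of_nonneg (mul_nonneg ht.1 hyj)]
            nlinarith [ht.2]
          · exact hy.1 l
        · rw [hcoord]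
          split_ifs with hl
          · exact mul_nonneg ht.1 hyj
          · exact hy.2 l
      obtain ⟨g, hgs, hgf, hgd⟩ := exists_smooth_factor hBconv hBu (hfs i)
        (EuclideanSpace.proj (𝕜 := ℝ) j) (EuclideanSpace.single j 1)
        (fun y hy t ht => hscale y hy t ht) (fun y hy => by
          have h1 := hscale y hy 0 ⟨le_rfl, zero_le_one⟩
          simp only [sub_zero, one_mul] at h1
          refine (hfz _ h1).2 ?_
          simp)
      have hgf' : ∀ y ∈ B, f i y = y j * g y := hgf
      have hgpos : ∀ y ∈ B, y j ≠ 0 → 0 < g y := by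
        intro y hy hyj
        have h1 : 0 < y j := lt_of_le_of_ne (hy.2 j) (Ne.symm hyj)
        have h2 : 0 ≤ f i y := (hF.defining i).nonneg _
        have h3 : f i y ≠ 0 := fun h => hyj ((hfz y hy).1 h)
        have h4 : 0 < y j * g y := by rw [← hgf' y hy]; exact lt_of_le_of_ne h2 h3.symm
        exact (mul_pos_iff_of_pos_left h1).1 h4
      refine ⟨g, hgs, fun y hy => ?_, fun y hy => by rw [if_pos hex]; exact hgf' y hy⟩
      -- On the hyperplane `g` is the j-th partial derivative of `f i`, the only one that can be
      -- non-zero, so g ≠ 0. Being a limit of positive values, it is positive.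
      by_cases hyj : y j = 0
      · have h1 : g y ≠ 0 := by
          intro h0
          obtain ⟨m, hm⟩ := hne i y hy ((hfz y hy).2 hyj)
          by_cases hmj : m = j
          · have h2 := hgd y hy hyj
            rw [hfB i y hy, h0] at h2
            rw [hmj] at hm
            exact hm h2.symm
          · exact hm (htang i j hRi y hy hyj m hmj)
        have hc : Tendsto (fun t : ℝ => y + t • EuclideanSpace.single j (1 : ℝ)) (𝓝[>] 0)
            (𝓝 y) := by
          have hc : Continuous fun t : ℝ => y + t • EuclideanSpace.single j (1 : ℝ) := by fun_prop
          have := hc.tendsto 0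
          rw [zero_smul, add_zero] at this
          exact this.mono_left nhdsWithin_le_nhds
        have hcB : ∀ᶠ t : ℝ in 𝓝[>] 0, y + t • EuclideanSpace.single j (1 : ℝ) ∈ B := by
          filter_upwards [hc ((isOpen_cube y₀ r).mem_nhds hy.1), self_mem_nhdsWithin] with t ht ht0
          exact ⟨ht, add_single_mem_quad hy.2 j (le_of_lt ht0)⟩
        have h2 : Tendsto (fun t : ℝ => g (y + t • EuclideanSpace.single j (1 : ℝ))) (𝓝[>] 0)
            (𝓝 (g y)) := (hgs.continuousOn y hy).tendsto.comp (tendsto_nhdsWithin_iff.2 ⟨hc, hcB⟩)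
        refine lt_of_le_of_ne (ge_of_tendsto h2 ?_) h1.symm
        filter_upwards [hcB, self_mem_nhdsWithin] with t ht ht0
        refine (hgpos _ ht ?_).le
        have : 0 < t := ht0
        simp [hyj, this.ne']
      · exact hgpos y hy hyj
    · refine ⟨f i, hfs i, fun y hy => ?_, fun y hy => by rw [if_neg hex, one_mul]⟩
      refine lt_of_le_of_ne ((hF.defining i).nonneg _) fun h0 => ?_
      obtain ⟨j, hj, -⟩ := (hzero i y hy).1 h0.symm
      exact hex ⟨j, hj⟩
  choose g hgs hgpos hgf using hg
  refine ⟨{ W := cube y₀ r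
            isOpen := isOpen_cube y₀ r
            S := Finset.univ.filter fun i => ∃ j, R i j
            idx := idx
            injOn := fun i hi k hk hik => ?_
            g := g
            smooth := hgs
            pos := hgpos }, mem_cube_self y₀ hr, hrO, hrt, fun i y hy => ?_, fun i hi => ?_,
            fun j hj => ?_, hrpos⟩
  · have h1 := hidx i (Finset.mem_filter.1 hi).2
    have h2 := hidx k (Finset.mem_filter.1 hk).2
    rw [← hik] at h2
    exact hRuniq i k _ h1 h2
  · have := hgf i y hy
    simp only [CornerData.rho, CornerData.coord, Finset.mem_filter, Finset.mem_univ, true_and]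
    exact this
  · exact (hidx i (Finset.mem_filter.1 hi).2).1
  · obtain ⟨i, hi⟩ := hRex j hj
    exact ⟨i, Finset.mem_filter.2 ⟨Finset.mem_univ i, j, hi⟩, hRinj i _ _ (hidx i ⟨j, hi⟩) hi⟩

end

/-! ### Jacobians and determinants of local frames -/

noncomputable section

variable {n : ℕ}

/-- The standard basis of `ℝⁿ`. -/
def stdBasis (n : ℕ) : Module.Basis (Fin n) ℝ (EuclideanSpace ℝ (Fin n)) :=
  (EuclideanSpace.basisFun (Fin n) ℝ).toBasis

theorem stdBasis_apply (i : Fin n) : stdBasis n i = EuclideanSpace.single i 1 := by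
  simp [stdBasis]

theorem stdBasis_repr (v : EuclideanSpace ℝ (Fin n)) (i : Fin n) : (stdBasis n).repr v i = v i := by
  simp [stdBasis]

theorem contDiff_det : ContDiff ℝ ∞ fun A : Fin n → Fin n → ℝ => (Matrix.of A).det := by
  simp only [Matrix.det_apply', Matrix.of_apply]
  refine ContDiff.sum fun σ _ => contDiff_const.mul (contDiff_prod fun i _ => ?_)
  exact contDiff_apply_apply ℝ ℝ (σ i) i

theorem linearMap_det_eq (f : EuclideanSpace ℝ (Fin n) →L[ℝ] EuclideanSpace ℝ (Fin n)) :
    LinearMap.det (f : EuclideanSpace ℝ (Fin n) →ₗ[ℝ] EuclideanSpace ℝ (Fin n)) =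
      (Matrix.of fun i j => f (EuclideanSpace.single j 1) i).det := by
  rw [← LinearMap.det_toMatrix (stdBasis n)]
  congr 1

theorem basis_det_combination (A : Fin n → Fin n → ℝ) (w : Fin n → EuclideanSpace ℝ (Fin n)) :
    (stdBasis n).det (fun i => ∑ k, A i k • w k) = (Matrix.of A).det * (stdBasis n).det w := by
  rw [Module.Basis.det_apply, Module.Basis.det_apply, mul_comm, ← Matrix.det_transpose (Matrix.of A),
    ← Matrix.det_mul]
  congr 1
  ext i j
  simp only [Module.Basis.toMatrix_apply, stdBasis_repr, Matrix.mul_apply, Matrix.transpose_apply,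
    Matrix.of_apply]
  rw [WithLp.ofLp_sum, Finset.sum_apply]
  exact Finset.sum_congr rfl fun k _ => by simp [mul_comm]

theorem basis_det_diagonal (c : Fin n → ℝ) :
    (stdBasis n).det (fun i => c i • EuclideanSpace.single i (1 : ℝ)) = ∏ i, c i := by
  have h : (fun i => c i • EuclideanSpace.single i (1 : ℝ)) = fun i => c i • stdBasis n i := by
    ext1 i; rw [stdBasis_apply]
  rw [h]
  have := (stdBasis n).det.toMultilinearMap.map_smul_univ c (stdBasis n)
  simpa [Module.Basis.det_self] using this

variable {M : Type*} [TopologicalSpace M] [ChartedSpace (EuclideanQuadrant n) M]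
  [IsManifold (cornerModel n) ∞ M]

variable {e e' : OpenPartialHomeomorph M (EuclideanQuadrant n)}

/-- The Jacobian determinant of a change of coordinates. -/
def jacobian (e e' : OpenPartialHomeomorph M (EuclideanQuadrant n))
    (y : EuclideanSpace ℝ (Fin n)) : ℝ :=
  LinearMap.det (fderivWithin ℝ (transition e e') (quad n) y :
    EuclideanSpace ℝ (Fin n) →ₗ[ℝ] EuclideanSpace ℝ (Fin n))

theorem jacobian_ne_zero (he : e ∈ IsManifold.maximalAtlas (cornerModel n) ∞ M)
    (he' : e' ∈ IsManifold.maximalAtlas (cornerModel n) ∞ M) {x : M} (hx : x ∈ e.source)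
    (hx' : x ∈ e'.source) : jacobian e e' (e.extend (cornerModel n) x) ≠ 0 := by
  have h1 := fderivWithin_transition_injective he he' hx hx'
  have h2 : LinearMap.ker ((fderivWithin ℝ (transition e e') (quad n)
      (e.extend (cornerModel n) x) :
      EuclideanSpace ℝ (Fin n) →ₗ[ℝ] EuclideanSpace ℝ (Fin n))) = ⊥ :=
    LinearMap.ker_eq_bot.2 h1
  exact fun h0 => (LinearMap.bot_lt_ker_of_det_eq_zero h0).ne' h2

theorem jacobian_smooth (he : e ∈ IsManifold.maximalAtlas (cornerModel n) ∞ M)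
    (he' : e' ∈ IsManifold.maximalAtlas (cornerModel n) ∞ M)
    {W : Set (EuclideanSpace ℝ (Fin n))} (hW : IsOpen W)
    (hWt : W ∩ quad n ⊆ (e.extend (cornerModel n)).target)
    (hWe : ∀ y ∈ W ∩ quad n, (e.extend (cornerModel n)).symm y ∈ e'.source) :
    ContDiffOn ℝ ∞ (jacobian e e') (W ∩ quad n) := by
  have h1 := transition_smooth he he' hWt hWe
  have h2 := h1.fderivWithin (uniqueDiffOn_inter_quad hW) (m := ∞) (by simp)
  have h3 : ContDiffOn ℝ ∞ (fun y => fderivWithin ℝ (transition e e') (quad n) y)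
      (W ∩ quad n) := by
    refine h2.congr fun y hy => ?_
    rw [inter_comm]
    exact (fderivWithin_inter (hW.mem_nhds hy.1)).symm
  have h4 : ∀ y, jacobian e e' y = (Matrix.of fun i j =>
      (fderivWithin ℝ (transition e e') (quad n) y (EuclideanSpace.single j 1)) i).det :=
    fun y => linearMap_det_eq _
  refine ContDiffOn.congr ?_ (fun y _ => h4 y)
  refine contDiff_det.comp_contDiffOn (contDiffOn_pi.2 fun i => contDiffOn_pi.2 fun j => ?_)
  exact (EuclideanSpace.proj (𝕜 := ℝ) i : EuclideanSpace ℝ (Fin n) →L[ℝ] ℝ).contDiff.comp_contDiffOn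
    (h3.clm_apply contDiffOn_const)

/-- The determinant of a family of `n` vector fields in a chart. -/
def frameDet (e : OpenPartialHomeomorph M (EuclideanQuadrant n)) (v : Fin n → VField n M) (x : M) :
    ℝ := (stdBasis n).det fun i => coordDerivL e x (v i x)

theorem frameDet_transition (he : e ∈ IsManifold.maximalAtlas (cornerModel n) ∞ M)
    (he' : e' ∈ IsManifold.maximalAtlas (cornerModel n) ∞ M) {x : M} (hx : x ∈ e.source)
    (hx' : x ∈ e'.source) (v : Fin n → VField n M) :
    frameDet e' v x = jacobian e e' (e.extend (cornerModel n) x) * frameDet e v x := by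
  unfold frameDet jacobian
  rw [← Module.Basis.det_comp]
  congr 1
  ext1 i
  exact coordDerivL_transition he he' hx hx' _

theorem frameDet_combination (e : OpenPartialHomeomorph M (EuclideanQuadrant n))
    {v v' : Fin n → VField n M} {x : M} {A : Fin n → Fin n → ℝ}
    (h : ∀ i, v' i x = ∑ k, A i k • v k x) :
    frameDet e v' x = (Matrix.of A).det * frameDet e v x := by
  unfold frameDet
  rw [← basis_det_combination]
  congr 1
  ext1 i
  rw [h i]
  have h1 : coordDerivL e x (∑ k, A i k • v k x) = ∑ k, coordDerivL e x (A i k • v k x) :=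
    map_sum (coordDerivL e x) _ _
  refine h1.trans (Finset.sum_congr rfl fun k _ => ?_)
  exact map_smul (coordDerivL e x) (A i k) (v k x)

/-- The interior is dense because the open quadrant is dense in the closed one. Identities and
estimates at boundary points are deduced from the interior in this way. -/
theorem interior_mem_of_frequently (q : M) : ∃ᶠ x in 𝓝 q, x ∈ (cornerModel n).interior M := by
  set e := chartAt (EuclideanQuadrant n) q
  have he := IsManifold.chart_mem_maximalAtlas (I := cornerModel n) (n := ∞) q
  have hq := mem_chart_source (EuclideanQuadrant n) q
  have hyt := map_extend (n := n) hq
  have h1 : ∃ᶠ y in 𝓝[quad n] (e.extend (cornerModel n) q), y ∈ openQuad n := by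
    have h2 := extend_mem_quad e q
    rw [← closure_openQuad, mem_closure_iff_frequently] at h2
    intro h3
    exact h2 ((eventually_nhdsWithin_iff.1 h3).mono fun y hy hy' =>
      hy (openQuad_subset n hy') hy')
  have h2 := tendsto_extend_symm e hyt
  rw [extend_symm_apply hq] at h2
  refine h2.frequently ?_
  refine (h1.and_eventually (extend_target_mem e hyt)).mono fun y hy => ?_
  rw [mem_interior_iff he (map_extend_symm e hy.2), extend_apply_symm e hy.2]
  exact hy.1

namespace LieStructure

variable {V : LieStructure n M}

theorem IsLocalFrame.exists_matrix {U U' : Set M} {v v' : Fin n → VField n M}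
    (hv : V.IsLocalFrame U v) (hv' : V.IsLocalFrame U' v') : ∃ A : M → Fin n → Fin n → ℝ,
      (∀ i k, ContMDiffOn (cornerModel n) 𝓘(ℝ, ℝ) ∞ (fun x => A x i k) U) ∧
        ∀ x ∈ U, ∀ i, v' i x = ∑ k, A x i k • v k x := by
  choose A hA hA' using fun i => hv.span (v' i) (hv'.mem i)
  exact ⟨fun x i k => A i k x, fun i k => hA i k, fun x hx i => hA' i x hx⟩

theorem contMDiffOn_det {U : Set M} {A : M → Fin n → Fin n → ℝ}
    (hA : ∀ i k, ContMDiffOn (cornerModel n) 𝓘(ℝ, ℝ) ∞ (fun x => A x i k) U) :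
    ContMDiffOn (cornerModel n) 𝓘(ℝ, ℝ) ∞ (fun x => (Matrix.of (A x)).det) U := by
  have h1 : ContMDiffOn (cornerModel n) 𝓘(ℝ, Fin n → Fin n → ℝ) ∞ A U :=
    contMDiffOn_pi_space.2 fun i => contMDiffOn_pi_space.2 fun k => hA i k
  exact contDiff_det.contMDiff.comp_contMDiffOn h1

/-- The determinants of two local frames are comparable. -/
theorem IsLocalFrame.exists_le {U U' : Set M} {v v' : Fin n → VField n M}
    (hv : V.IsLocalFrame U v) (hv' : V.IsLocalFrame U' v')
    (he : e ∈ IsManifold.maximalAtlas (cornerModel n) ∞ M)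
    (he' : e' ∈ IsManifold.maximalAtlas (cornerModel n) ∞ M) {q : M} (hq : q ∈ e.source)
    (hq' : q ∈ e'.source) (hqU : q ∈ U) :
    ∃ C : ℝ, 0 < C ∧ ∀ᶠ x in 𝓝 q, |frameDet e' v' x| ≤ C * |frameDet e v x| := by
  obtain ⟨A, hA, hA'⟩ := hv.exists_matrix hv'
  have hdet : ContinuousAt (fun x => (Matrix.of (A x)).det) q :=
    (contMDiffOn_det hA).continuousOn.continuousAt (hv.isOpen.mem_nhds hqU)
  have hO : e.source ∩ e'.source ∈ 𝓝 q :=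
    inter_mem (e.open_source.mem_nhds hq) (e'.open_source.mem_nhds hq')
  have hj : ContinuousAt (fun x => jacobian e e' (e.extend (cornerModel n) x)) q := by
    obtain ⟨O, hO, hOe⟩ := extend_target_eq e
    have hyt := map_extend (n := n) hq
    have h1 : ∀ᶠ y in 𝓝[quad n] (e.extend (cornerModel n) q),
        (e.extend (cornerModel n)).symm y ∈ e'.source := by
      have := tendsto_extend_symm e hyt
      rw [extend_symm_apply hq] at this
      exact this (e'.open_source.mem_nhds hq')
    obtain ⟨W, hWo, hyW, hW⟩ := mem_nhdsWithin.1 (inter_mem h1 (extend_target_mem e hyt))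
    have h2 := (jacobian_smooth he he' hWo (fun y hy => (hW hy).2)
      (fun y hy => (hW hy).1)).continuousOn _ ⟨hyW, extend_mem_quad e q⟩
    have h3 : ContinuousWithinAt (jacobian e e') (quad n) (e.extend (cornerModel n) q) := by
      rw [inter_comm] at h2
      exact (continuousWithinAt_inter (hWo.mem_nhds hyW)).1 h2
    exact h3.tendsto.comp (tendsto_extend hq)
  have hprod := (hj.mul hdet).abs
  refine ⟨|jacobian e e' (e.extend (cornerModel n) q) * (Matrix.of (A q)).det| + 1, by positivity, ?_⟩
  filter_upwards [hO, hv.isOpen.mem_nhds hqU, hprod.eventually (gt_mem_nhds (lt_add_one _))]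
    with x hx hxU hlt
  rw [frameDet_transition he he' hx.1 hx.2, frameDet_combination e (hA' x hxU), ← mul_assoc,
    abs_mul]
  exact mul_le_mul_of_nonneg_right hlt.le (abs_nonneg _)

/-- The determinant of the generators in an exact chart. -/
theorem frameDet_exact {p x : M} {a : Fin n → Fin n → ℕ} {v : Fin n → VField n M}
    (h : ∀ i : Fin n, coordDeriv (e.extend (cornerModel n)) x (v i x) =
      (∏ j with e.extend (cornerModel n) p j = 0, e.extend (cornerModel n) x j ^ a i j) •
        EuclideanSpace.single i (1 : ℝ)) :
    frameDet e v x = ∏ j with e.extend (cornerModel n) p j = 0,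
      e.extend (cornerModel n) x j ^ ∑ i, a i j := by
  unfold frameDet
  have : (fun i => coordDerivL e x (v i x)) = fun i =>
      (∏ j with e.extend (cornerModel n) p j = 0, e.extend (cornerModel n) x j ^ a i j) •
        EuclideanSpace.single i (1 : ℝ) := funext h
  rw [this, basis_det_diagonal, Finset.prod_comm]
  exact Finset.prod_congr rfl fun j _ => Finset.prod_pow_eq_pow_sum _ _ _

end LieStructure

end

/-! ### Well-definedness of the degeneracy index -/

noncomputable section

variable {n : ℕ} {M : Type*} [TopologicalSpace M] [ChartedSpace (EuclideanQuadrant n) M]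
  [IsManifold (cornerModel n) ∞ M] [T2Space M]
variable {N : ℕ} {F : Fin N → Set M} {ρ : Fin N → SmoothFun n M}
variable {e e' : OpenPartialHomeomorph M (EuclideanQuadrant n)}

theorem IsHyperfaceSystem.rho_pos (hn : 0 < n) (hF : IsHyperfaceSystem n F ρ) (i : Fin N) {x : M}
    (hx : x ∈ (cornerModel n).interior M) : 0 < ρ i x := by
  have he := IsManifold.chart_mem_maximalAtlas (I := cornerModel n) (n := ∞) x
  have hxs := mem_chart_source (EuclideanQuadrant n) x
  obtain ⟨D, hDq, -, -, hDρ, -⟩ := hF.exists_cornerData hn he hxs univ_mem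
  have h1 := hDρ i _ ⟨hDq, extend_mem_quad _ x⟩
  rw [extend_symm_apply hxs] at h1
  rw [h1]
  exact CornerData.rho_pos i ((mem_interior_iff he hxs).1 hx) hDq

/-- Adjoining a limit point keeps a set connected, so components are closed in `D`. Consequently the
depth-one points of a face are a single component. -/
theorem mem_component_of_mem_closure {X : Type*} [TopologicalSpace X] {D : Set X} {p q : X}
    (hp : p ∈ D) (hq : q ∈ D) (h : q ∈ closure (connectedComponentIn D p)) :
    q ∈ connectedComponentIn D p := by
  have h1 : IsPreconnected (insert q (connectedComponentIn D p)) :=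
    isPreconnected_connectedComponentIn.subset_closure (subset_insert _ _)
      (insert_subset h subset_closure)
  exact h1.subset_connectedComponentIn (mem_insert_of_mem _ (mem_connectedComponentIn hp))
    (insert_subset hq (connectedComponentIn_subset D p)) (mem_insert _ _)

namespace LieStructure

variable (V : LieStructure n M)

/-- The determinant of a local frame of `V` at `q` vanishes like `r ^ k`. -/
def HasOrder (r : M → ℝ) (q : M) (k : ℕ) : Prop :=
  ∃ e ∈ IsManifold.maximalAtlas (cornerModel n) ∞ M, q ∈ e.source ∧
    ∃ (U : Set M) (v : Fin n → VField n M), V.IsLocalFrame U v ∧ q ∈ U ∧ ∃ C : ℝ, 0 < C ∧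
      ∀ᶠ x in 𝓝 q, |frameDet e v x| ≤ C * r x ^ k ∧ r x ^ k ≤ C * |frameDet e v x|

variable {V}

/-- Comparability of frame determinants gives r^k ≤ const · r^k' near `q`. As interior points with r
> 0 and r → 0 accumulate at `q`, this is impossible for k' > k. -/
theorem HasOrder.le {r : M → ℝ} (hr : Continuous r)
    (hpos : ∀ x ∈ (cornerModel n).interior M, 0 < r x) {q : M} (hq : r q = 0) {k k' : ℕ}
    (h : V.HasOrder r q k) (h' : V.HasOrder r q k') : k' ≤ k := by
  by_contra hlt
  push Not at hlt
  obtain ⟨e, he, hqe, U, v, hv, hqU, C, hC, hev⟩ := h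
  obtain ⟨e', he', hqe', U', v', hv', hqU', C', hC', hev'⟩ := h'
  obtain ⟨B, hB, hcomp⟩ := hv'.exists_le hv he' he hqe' hqe hqU'
  have hsmall : ∀ᶠ x in 𝓝 q, C * B * C' * r x ^ (k' - k) < 1 := by
    have hc : Continuous fun x => C * B * C' * r x ^ (k' - k) := by fun_prop
    have h0 : C * B * C' * r q ^ (k' - k) < 1 := by
      rw [hq, zero_pow (by omega)]; simp
    exact hc.continuousAt.eventually (gt_mem_nhds h0)
  obtain ⟨x, hx, h1, h2, h3, h4⟩ := ((interior_mem_of_frequently (n := n) q).and_eventually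
    (hev.and (hev'.and (hcomp.and hsmall)))).exists
  have hrx := hpos x hx
  have h5 : r x ^ k ≤ C * B * C' * r x ^ (k' - k) * r x ^ k := by
    calc r x ^ k ≤ C * |frameDet e v x| := h1.2
      _ ≤ C * (B * |frameDet e' v' x|) := by gcongr
      _ ≤ C * (B * (C' * r x ^ k')) := by gcongr; exact h2.1
      _ = C * B * C' * (r x ^ (k' - k) * r x ^ k) := by
        rw [← pow_add, Nat.sub_add_cancel hlt.le]; ring
      _ = _ := by ring
  have h6 : 0 < r x ^ k := pow_pos hrx k
  have : (C * B * C' * r x ^ (k' - k)) * r x ^ k < 1 * r x ^ k :=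
    mul_lt_mul_of_pos_right h4 h6
  linarith

theorem HasOrder.unique {r : M → ℝ} (hr : Continuous r)
    (hpos : ∀ x ∈ (cornerModel n).interior M, 0 < r x) {q : M} (hq : r q = 0) {k k' : ℕ}
    (h : V.HasOrder r q k) (h' : V.HasOrder r q k') : k = k' :=
  le_antisymm (h'.le hr hpos hq h) (h.le hr hpos hq h')

/-- Near a point of depth one, the determinant of the frame in an exact chart vanishes like
the corresponding power of the boundary defining function. -/
theorem hasOrder_of_exact (hn : 0 < n) (hF : IsHyperfaceSystem n F ρ)
    (he : e ∈ IsManifold.maximalAtlas (cornerModel n) ∞ M) {p q : M} (hq : q ∈ e.source)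
    {a : Fin n → Fin n → ℕ} {U : Set M} {v : Fin n → VField n M} (hv : V.IsLocalFrame U v)
    (hqU : q ∈ U)
    (hform : ∀ x ∈ U, ∀ i : Fin n, coordDeriv (e.extend (cornerModel n)) x (v i x) =
      (∏ j with e.extend (cornerModel n) p j = 0, e.extend (cornerModel n) x j ^ a i j) •
        EuclideanSpace.single i (1 : ℝ))
    {j : Fin n} (hpj : e.extend (cornerModel n) p j = 0)
    (hql : ∀ l ≠ j, 0 < e.extend (cornerModel n) q l) {i : Fin N} (hqF : q ∈ F i) :
    V.HasOrder (ρ i) q (∑ m, a m j) := by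
  obtain ⟨D, hDq, -, hDt, hDρ, hDS, -, -⟩ := hF.exists_cornerData hn he hq univ_mem
  have hy₀ := extend_mem_quad e q
  have hiS : i ∈ D.S := by
    by_contra hi
    have h1 := hDρ i _ ⟨hDq, hy₀⟩
    rw [extend_symm_apply hq, ((hF.defining i).zero_iff q).2 hqF] at h1
    have h2 := D.pos i _ ⟨hDq, hy₀⟩
    simp only [CornerData.rho, CornerData.coord, if_neg hi, one_mul] at h1
    linarith
  have hij : D.idx i = j := by
    by_contra hne
    exact (hql _ hne).ne' (hDS i hiS)
  set κ := ∑ m, a m j with hκ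
  -- This is the frame determinant divided by ρ_i^κ. The coordinates other than x_j are positive at
  -- `q`, so `w` is continuous and positive there and stays between half and twice its value nearby.
  let w : EuclideanSpace ℝ (Fin n) → ℝ := fun y =>
    (∏ l ∈ (Finset.univ.filter fun l => e.extend (cornerModel n) p l = 0).erase j,
      y l ^ ∑ m, a m l) * (D.g i y ^ κ)⁻¹
  have hwc : ContinuousWithinAt w (quad n) (e.extend (cornerModel n) q) := by
    have h1 : ContinuousWithinAt (D.g i) (quad n) (e.extend (cornerModel n) q) := by
      have := (D.smooth i).continuousOn _ ⟨hDq, hy₀⟩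
      rw [inter_comm] at this
      exact (continuousWithinAt_inter (D.isOpen.mem_nhds hDq)).1 this
    refine ContinuousWithinAt.mul ?_ ((h1.pow κ).inv₀ (pow_pos (D.pos i _ ⟨hDq, hy₀⟩) κ).ne')
    exact (continuous_finsetProd _ fun l _ => (continuous_coord l).pow _).continuousWithinAt
  have hw0 : 0 < w (e.extend (cornerModel n) q) := by
    refine mul_pos (Finset.prod_pos fun l hl => ?_) (inv_pos.2 (pow_pos (D.pos i _ ⟨hDq, hy₀⟩) κ))
    exact pow_pos (hql l (Finset.ne_of_mem_erase hl)) _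
  set c := w (e.extend (cornerModel n) q) with hc
  have hwt : Tendsto (fun x => w (e.extend (cornerModel n) x)) (𝓝 q) (𝓝 c) :=
    hwc.tendsto.comp (tendsto_extend hq)
  have hDev : ∀ᶠ x in 𝓝 q, e.extend (cornerModel n) x ∈ D.W :=
    (e.continuousAt_extend hq).eventually (D.isOpen.mem_nhds hDq)
  refine ⟨e, he, hq, U, v, hv, hqU, max (2 * c) (c / 2)⁻¹, by positivity, ?_⟩
  filter_upwards [hDev, e.open_source.mem_nhds hq, hv.isOpen.mem_nhds hqU,
    hwt.eventually (gt_mem_nhds (by linarith : c < 2 * c)),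
    hwt.eventually (lt_mem_nhds (by linarith : c / 2 < c))] with x hxD hxe hxU hlt hgt
  have hxq := extend_mem_quad e x
  have hgx := D.pos i _ ⟨hxD, hxq⟩
  have h1 : ρ i x = e.extend (cornerModel n) x j * D.g i (e.extend (cornerModel n) x) := by
    have := hDρ i _ ⟨hxD, hxq⟩
    rw [extend_symm_apply hxe] at this
    rw [this, CornerData.rho, CornerData.coord, if_pos hiS, hij]
  have h2 : frameDet e v x = ρ i x ^ κ * w (e.extend (cornerModel n) x) := by
    rw [frameDet_exact (hform x hxU), ← Finset.mul_prod_erase _ _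
      (Finset.mem_filter.2 ⟨Finset.mem_univ j, hpj⟩), h1, mul_pow]
    simp only [w]
    have := (pow_pos hgx κ).ne'
    field_simp
    exact mul_comm _ _
  have h3 : 0 ≤ ρ i x ^ κ := pow_nonneg ((hF.defining i).nonneg x) κ
  have h4 : |frameDet e v x| = ρ i x ^ κ * w (e.extend (cornerModel n) x) := by
    rw [h2, abs_of_nonneg (mul_nonneg h3 (by linarith))]
  rw [h4]
  constructor
  · rw [mul_comm]
    exact mul_le_mul_of_nonneg_right (hlt.le.trans (le_max_left _ _)) h3
  · calc ρ i x ^ κ = (c / 2)⁻¹ * (ρ i x ^ κ * (c / 2)) := by field_simp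
      _ ≤ max (2 * c) (c / 2)⁻¹ * (ρ i x ^ κ * w (e.extend (cornerModel n) x)) := by
        gcongr
        exact le_max_right _ _

theorem mem_boundary_of_depth_ne {p : M} (h : depth n p ≠ 0) : p ∈ (cornerModel n).boundary M := by
  rw [← ModelWithCorners.compl_interior]
  exact fun hi => h (mem_interior_iff_depth.1 hi)

/-- The order is locally constant on the part of depth one of a face. -/
theorem exists_order_near (hn : 0 < n) (hV : V.IsExact) (hF : IsHyperfaceSystem n F ρ) {q : M}
    (hq : depth n q = 1) {i : Fin N} :
    ∃ k, ∀ᶠ x in 𝓝 q, depth n x = 1 → x ∈ F i → V.HasOrder (ρ i) x k := by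
  obtain ⟨e, a, he, hqe, U, hUe, hqU, v, hv, hform⟩ :=
    hV q (mem_boundary_of_depth_ne (by omega))
  have hq1 := hq
  rw [depth_eq he hqe, ncard_eq_one] at hq1
  obtain ⟨j, hj⟩ := hq1
  have hqj : e.extend (cornerModel n) q j = 0 := by
    have : j ∈ ({j} : Set (Fin n)) := rfl
    rw [← hj] at this; exact this
  have hql : ∀ l ≠ j, 0 < e.extend (cornerModel n) q l := by
    intro l hl
    refine lt_of_le_of_ne (extend_mem_quad e q l) fun h0 => hl ?_
    have : l ∈ {i | e.extend (cornerModel n) q i = 0} := h0.symm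
    rw [hj] at this; exact this
  refine ⟨∑ m, a m j, ?_⟩
  have hpos : ∀ᶠ x in 𝓝 q, ∀ l ≠ j, 0 < e.extend (cornerModel n) x l := by
    rw [eventually_all]
    intro l
    by_cases hl : l = j
    · exact Eventually.of_forall fun x h => absurd hl h
    · have h1 : ContinuousAt (fun x => e.extend (cornerModel n) x l) q :=
        (continuous_coord l).continuousAt.comp (e.continuousAt_extend hqe)
      filter_upwards [h1.eventually (lt_mem_nhds (hql l hl))] with x hx _ using hx
  filter_upwards [hpos, hv.isOpen.mem_nhds hqU] with x hx hxU _ hxF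
  exact hasOrder_of_exact hn hF he (hUe hxU) hv hxU hform hqj hx hxF

/-- The order is unique at each depth-one point of the face and locally constant there, hence a
continuous function into ℕ on a connected component, hence constant. -/
theorem exists_order (hn : 0 < n) (hV : V.IsExact) (hF : IsHyperfaceSystem n F ρ) (i : Fin N) :
    ∃ k, ∀ q, depth n q = 1 → q ∈ F i → V.HasOrder (ρ i) q k := by
  obtain ⟨p, hp, hFp⟩ := hF.exists_point i
  have hpF : p ∈ F i := by
    rw [hFp]; exact subset_closure (mem_connectedComponentIn hp)
  have hex : ∀ q, depth n q = 1 → q ∈ F i → ∃ k, V.HasOrder (ρ i) q k := by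
    intro q hq hqF
    obtain ⟨k, hk⟩ := exists_order_near hn hV hF hq (i := i)
    exact ⟨k, hk.self_of_nhds hq hqF⟩
  classical
  let κ : M → ℕ := fun q => if h : ∃ k, V.HasOrder (ρ i) q k then h.choose else 0
  have hκ : ∀ q, depth n q = 1 → q ∈ F i → V.HasOrder (ρ i) q (κ q) := by
    intro q hq hqF
    have h := hex q hq hqF
    simp only [κ, dif_pos h]
    exact h.choose_spec
  have huniq : ∀ q, q ∈ F i → ∀ {k k'}, V.HasOrder (ρ i) q k → V.HasOrder (ρ i) q k' → k = k' :=
    fun q hqF _ _ h h' => h.unique (ρ i).contMDiff.continuous (fun x hx => hF.rho_pos hn i hx)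
      (((hF.defining i).zero_iff q).2 hqF) h'
  set C := connectedComponentIn {x : M | depth n x = 1} p with hC
  have hC1 : ∀ q ∈ C, depth n q = 1 := fun q hq =>
    connectedComponentIn_subset {x : M | depth n x = 1} p hq
  have hCF : C ⊆ F i := by rw [hFp]; exact subset_closure
  have hcont : ContinuousOn κ C := by
    intro q hq
    obtain ⟨k, hk⟩ := exists_order_near hn hV hF (hC1 q hq) (i := i)
    have : κ =ᶠ[𝓝[C] q] fun _ => k := by
      filter_upwards [mem_nhdsWithin_of_mem_nhds hk, self_mem_nhdsWithin] with x hx hxC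
      exact huniq x (hCF hxC) (hκ x (hC1 x hxC) (hCF hxC)) (hx (hC1 x hxC) (hCF hxC))
    exact continuousWithinAt_const.congr_of_eventuallyEq this (this.self_of_nhdsWithin hq)
  refine ⟨κ p, fun q hq hqF => ?_⟩
  have hqC : q ∈ C := mem_component_of_mem_closure hp hq (by rw [← hC, ← hFp]; exact hqF)
  have := (isPreconnected_connectedComponentIn).constant hcont hqC (mem_connectedComponentIn hp)
  rw [← this]
  exact hκ q hq hqF

/-- At a deeper corner `p` the exact chart also describes the generators at nearby depth-one points
with x_j = 0. There the exponents of x_j add up to the order of vanishing along F_i, which is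
already known to be independent of chart and point. -/
theorem exists_isDegeneracyIndex (hn : 0 < n) (hV : V.IsExact) (hF : IsHyperfaceSystem n F ρ)
    (i : Fin N) : ∃ k, V.IsDegeneracyIndex (F i) k ∧
      ∀ q, depth n q = 1 → q ∈ F i → V.HasOrder (ρ i) q k := by
  obtain ⟨k, hk⟩ := exists_order hn hV hF i
  refine ⟨k, ?_, hk⟩
  rintro p hpF e a ⟨he, hpe, U, hUe, hpU, v, hv, hform⟩ j hpj hev
  have hyt := map_extend (n := n) hpe
  have hsymm := tendsto_extend_symm e hyt
  rw [extend_symm_apply hpe] at hsymm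
  obtain ⟨O, hO, hpO, hOs⟩ := mem_nhdsWithin.1 (hsymm (inter_mem hev (hv.isOpen.mem_nhds hpU)))
  obtain ⟨r, hr, hrt, hrO, hrpos⟩ := exists_chart_cube hpe (hO.mem_nhds hpO)
  obtain ⟨y, hy⟩ := exists_mem_facePart (extend_mem_quad e p) hr hpj
  have hyq := facePart_subset_quad _ _ _ hy
  have hyt' := hrt ⟨hy.1, hyq⟩
  obtain ⟨h1, h2⟩ := hOs ⟨hrO hy.1, hyq⟩
  set q := (e.extend (cornerModel n)).symm y with hq
  have hqe : q ∈ e.source := map_extend_symm e hyt'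
  have hqy : e.extend (cornerModel n) q = y := extend_apply_symm e hyt'
  have hqF : q ∈ F i := h1 (by rw [hqy]; exact hy.2.1)
  have hq1 : depth n q = 1 := by
    rw [depth_eq he hqe, hqy]
    have : {i | y i = 0} = {j} := by
      ext l
      simp only [mem_ofPred_eq, mem_singleton_iff]
      constructor
      · intro h; by_contra hl; exact (hy.2.2 l hl).ne' h
      · rintro rfl; exact hy.2.1
    rw [this, ncard_singleton]
  have h3 := hasOrder_of_exact hn hF he hqe hv h2 hform hpj
    (fun l hl => by rw [hqy]; exact hy.2.2 l hl) hqF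
  exact h3.unique (ρ i).contMDiff.continuous (fun x hx => hF.rho_pos hn i hx)
    (((hF.defining i).zero_iff q).2 hqF) (hk q hq1 hqF)

end LieStructure

end

/-! ### Exact charts at interior points -/

noncomputable section

variable {n : ℕ} {M : Type*} [TopologicalSpace M] [ChartedSpace (EuclideanQuadrant n) M]
  [IsManifold (cornerModel n) ∞ M] [T2Space M]

/-- The coordinate vector fields of the chart at `p`. -/
def coordField (p : M) (i : Fin n) : (x : M) → TangentSpace (cornerModel n) x :=
  (trivializationAt (EuclideanSpace ℝ (Fin n)) (TangentSpace (cornerModel n) : M → Type _)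
    p).localFrame (stdBasis n) i

theorem coordDerivL_coordField (p : M) (i : Fin n) {x : M}
    (hx : x ∈ (chartAt (EuclideanQuadrant n) p).source) :
    coordDerivL (chartAt (EuclideanQuadrant n) p) x (coordField p i x) =
      EuclideanSpace.single i 1 := by
  set T := trivializationAt (EuclideanSpace ℝ (Fin n)) (TangentSpace (cornerModel n) : M → Type _) p
    with hT
  have hxb : x ∈ T.baseSet := by
    rw [hT, TangentBundle.trivializationAt_baseSet]; exact hx
  have h1 := TangentBundle.continuousLinearMapAt_trivializationAt (I := cornerModel n) (x₀ := p) hx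
  have h2 : T.continuousLinearMapAt ℝ x (coordField p i x) = stdBasis n i := by
    unfold coordField
    rw [Bundle.Trivialization.localFrame_apply_of_mem_baseSet _ _ hxb]
    simp only [Bundle.Trivialization.basisAt, Module.Basis.map_apply]
    rw [Bundle.Trivialization.continuousLinearMapAt_apply, Bundle.Trivialization.coe_linearMapAt_of_mem _ hxb]
    exact (T.linearEquivAt ℝ x hxb).apply_symm_apply (stdBasis n i)
  rw [← hT, h1] at *
  rw [stdBasis_apply] at h2
  exact h2

theorem isOpen_interior_corner : IsOpen ((cornerModel n).interior M) :=
  ModelWithCorners.isOpen_interior (I := cornerModel n) (n := ∞) (by simp)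

namespace LieStructure

variable (V : LieStructure n M)

/-- No coordinate vanishes at an interior point, so all monomials are empty products. Coordinate
fields cut off by a bump function supported in the interior lie in `V` by fullness, and they are a
frame where the bump function is 1. -/
theorem exists_isExactChart_of_mem_interior {p : M}
    (hp : p ∈ (cornerModel n).interior M) : ∃ e a, V.IsExactChart p e a := by
  set c := chartAt (EuclideanQuadrant n) p with hc
  have hO : (cornerModel n).interior M ∩ c.source ∈ 𝓝 p :=
    inter_mem ((isOpen_interior_corner).mem_nhds hp)
      (c.open_source.mem_nhds (mem_chart_source _ p))
  obtain ⟨χ, -, hχ⟩ := (SmoothBumpFunction.nhds_basis_tsupport (I := cornerModel n) p).mem_iff.1 hO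
  have hO' : IsOpen ((cornerModel n).interior M ∩ c.source) :=
    (isOpen_interior_corner).inter c.open_source
  have hbase : (trivializationAt (EuclideanSpace ℝ (Fin n))
    (TangentSpace (cornerModel n) : M → Type _) p).baseSet = c.source := by
    rw [TangentBundle.trivializationAt_baseSet]
  let v : Fin n → VField n M := fun i => ⟨fun x => χ x • coordField p i x, by
    have h1 := (trivializationAt (EuclideanSpace ℝ (Fin n))
      (TangentSpace (cornerModel n) : M → Type _) p).contMDiffOn_localFrame_baseSet
      (I := cornerModel n) ∞ (stdBasis n) i
    exact ContMDiffOn.smul_section_of_tsupport (χ.contMDiff.contMDiffOn) hO' hχ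
      (h1.mono (by rw [hbase]; exact inter_subset_right))⟩
  obtain ⟨U, hU, hUo, hpU⟩ := eventually_nhds_iff.1 (χ.eventuallyEq_one.and hO)
  refine ⟨c, fun _ _ => 0, IsManifold.chart_mem_maximalAtlas p, mem_chart_source _ p, U,
    fun x hx => (hU x hx).2.2, hpU, v, ⟨hUo, fun i => V.full _ ?_, fun X hX => ?_⟩, ?_⟩
  · refine (closure_mono ?_).trans (fun x hx => (hχ hx).1)
    intro x hx hx0
    exact hx (show χ x • coordField p i x = 0 by rw [hx0, zero_smul])
  · refine ⟨fun i x => (trivializationAt (EuclideanSpace ℝ (Fin n))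
      (TangentSpace (cornerModel n) : M → Type _) p).localFrameCoeff (cornerModel n)
        (stdBasis n) i x (X x), fun i => ?_, fun x hx => ?_⟩
    · have := contMDiffOn_baseSet_localFrameCoeff (I := cornerModel n)
        (e := trivializationAt (EuclideanSpace ℝ (Fin n))
          (TangentSpace (cornerModel n) : M → Type _) p) (b := stdBasis n) (k := ∞)
        (s := fun x => X x) X.contMDiff.contMDiffOn i
      exact this.mono (by rw [hbase]; exact fun x hx => (hU x hx).2.2)
    · refine (Bundle.Trivialization.eq_sum_localFrameCoeff_smul (I := cornerModel n)
        (b := stdBasis n) (s := fun x => X x) (by rw [hbase]; exact (hU x hx).2.2)).trans ?_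
      refine Finset.sum_congr rfl fun i _ => ?_
      congr 1
      have h1 : χ x = 1 := (hU x hx).1
      change _ = χ x • coordField p i x
      rw [h1, one_smul]; rfl
  · intro x hx i
    have h1 : χ x = 1 := (hU x hx).1
    have h2 : v i x = coordField p i x := by
      change χ x • coordField p i x = _
      rw [h1, one_smul]
    rw [h2, coordDeriv_eq, coordDerivL_coordField p i (hU x hx).2.2]
    simp

variable {V}

theorem IsExact.exists_isExactChart (hV : V.IsExact) (p : M) :
    ∃ e a, V.IsExactChart p e a := by
  by_cases hp : p ∈ (cornerModel n).interior M
  · exact V.exists_isExactChart_of_mem_interior hp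
  · rw [← mem_compl_iff, ModelWithCorners.compl_interior] at hp
    exact hV p hp

end LieStructure

end

/-! ### Densities in charts -/

noncomputable section

variable {n : ℕ} {M : Type*} [TopologicalSpace M] [ChartedSpace (EuclideanQuadrant n) M]
  [IsManifold (cornerModel n) ∞ M]
variable {c e : OpenPartialHomeomorph M (EuclideanQuadrant n)}

/-- The coordinate basis of the tangent space given by a chart. -/
def chartFrame (c : OpenPartialHomeomorph M (EuclideanQuadrant n)) (x : M) (i : Fin n) :
    EuclideanSpace ℝ (Fin n) := (coordDerivL c x).inverse (EuclideanSpace.single i (1 : ℝ))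

theorem coordDerivL_chartFrame (hc : c ∈ IsManifold.maximalAtlas (cornerModel n) ∞ M) {x : M}
    (hx : x ∈ c.source) (i : Fin n) :
    coordDerivL c x (chartFrame c x i) = EuclideanSpace.single i 1 := by
  obtain ⟨L, hL⟩ : (coordDerivL c x).IsInvertible := by
    let L := (LinearEquiv.ofBijective (coordDerivL c x).toLinearMap
      ⟨coordDerivL_injective hc hx, coordDerivL_surjective hc hx⟩).toContinuousLinearEquiv
    exact ⟨L, by ext1 v; rfl⟩
  unfold chartFrame
  rw [← hL, ContinuousLinearMap.inverse_equiv]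
  exact L.apply_symm_apply _

/-- The endomorphism composed of the differential of the chart and the linear map taking the
standard basis to `w` carries the coordinate frame to `w`. The scaling law then produces its
determinant. -/
theorem LieStructure.Density.val_eq {V : LieStructure n M} (f : V.Density)
    (hc : c ∈ IsManifold.maximalAtlas (cornerModel n) ∞ M) {x : M} (hx : x ∈ c.source)
    (hxi : x ∈ (cornerModel n).interior M) (w : Fin n → EuclideanSpace ℝ (Fin n)) :
    f.val x w = (|(stdBasis n).det fun i => coordDerivL c x (w i)| : ℝ) *
      f.val x (chartFrame c x) := by
  let S : EuclideanSpace ℝ (Fin n) →ₗ[ℝ] EuclideanSpace ℝ (Fin n) := (stdBasis n).constr ℝ w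
  have h1 := f.scaling x hxi (S ∘ₗ (coordDerivL c x).toLinearMap) (chartFrame c x)
  have h2 : (fun i => (S ∘ₗ (coordDerivL c x).toLinearMap) (chartFrame c x i)) = w := by
    ext1 i
    change S (coordDerivL c x (chartFrame c x i)) = _
    rw [coordDerivL_chartFrame hc hx, ← stdBasis_apply]
    exact (stdBasis n).constr_basis ℝ w i
  have h3 : LinearMap.det (S ∘ₗ (coordDerivL c x).toLinearMap) =
      (stdBasis n).det fun i => coordDerivL c x (w i) := by
    rw [LinearMap.det_comp, mul_comm]
    have h4 : (stdBasis n).det w = LinearMap.det S := by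
      have h5 := (stdBasis n).det_comp S (stdBasis n)
      rw [Module.Basis.det_self, mul_one] at h5
      rw [← h5]
      congr 1
      ext1 i
      exact ((stdBasis n).constr_basis ℝ w i).symm
    rw [← h4]
    exact ((stdBasis n).det_comp (coordDerivL c x).toLinearMap w).symm
  have h6 : f.val x (fun i => (S ∘ₗ (coordDerivL c x).toLinearMap) (chartFrame c x i)) =
      f.val x w := congrArg (f.val x) h2
  rw [← h3]
  exact h6.symm.trans h1

variable [T2Space M] {N : ℕ} {F : Fin N → Set M} {ρ : Fin N → SmoothFun n M}

namespace LieStructure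

variable {V : LieStructure n M}

/-- In any chart, the determinant of a suitable local frame is `∏ ρ_i ^ k_i`, up to a smooth
positive factor. -/
theorem IsExact.exists_frameDet (hn : 0 < n) (hV : V.IsExact) (hF : IsHyperfaceSystem n F ρ)
    {k : Fin N → ℕ} (hk : ∀ i, V.IsDegeneracyIndex (F i) (k i))
    (hc : c ∈ IsManifold.maximalAtlas (cornerModel n) ∞ M) {q : M} (hq : q ∈ c.source) :
    ∃ (U : Set M) (v : Fin n → VField n M), V.IsLocalFrame U v ∧ q ∈ U ∧
      ∃ W : Set (EuclideanSpace ℝ (Fin n)), IsOpen W ∧ c.extend (cornerModel n) q ∈ W ∧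
        W ∩ quad n ⊆ (c.extend (cornerModel n)).target ∧
        (∀ y ∈ W ∩ quad n, (c.extend (cornerModel n)).symm y ∈ U) ∧
        ∃ m : EuclideanSpace ℝ (Fin n) → ℝ, ContDiffOn ℝ ∞ m (W ∩ quad n) ∧
          (∀ y ∈ W ∩ quad n, 0 < m y) ∧ ∀ y ∈ W ∩ quad n,
            |frameDet c v ((c.extend (cornerModel n)).symm y)| =
              m y * ∏ i, ρ i ((c.extend (cornerModel n)).symm y) ^ k i := by
  obtain ⟨e, a, hex⟩ := hV.exists_isExactChart q
  have hex' := hex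
  obtain ⟨he, hqe, U, hUe, hqU, v, hv, hform⟩ := hex'
  obtain ⟨D, hDq, -, hDt, hDρ, hDS, hDJ, -⟩ := hF.exists_cornerData hn he hqe univ_mem
  set σ := (c.extend (cornerModel n)).symm with hσ
  set τ := transition c e with hτ
  have hρD : ∀ i, ∀ x ∈ e.source, e.extend (cornerModel n) x ∈ D.W →
      ρ i x = D.rho i (e.extend (cornerModel n) x) := by
    intro i x hx hxW
    have := hDρ i _ ⟨hxW, extend_mem_quad e x⟩
    rwa [extend_symm_apply hx] at this
  have hDev : ∀ᶠ x in 𝓝 q, e.extend (cornerModel n) x ∈ D.W :=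
    (e.continuousAt_extend hqe).eventually (D.isOpen.mem_nhds hDq)
  -- The coordinate attached to i ∈ S cuts out F_i near `q`, so the degeneracy index reads off its
  -- total exponent.
  have hκ : ∀ i ∈ D.S, ∑ l, a l (D.idx i) = k i := by
    intro i hi
    have hz : ∀ x ∈ e.source, e.extend (cornerModel n) x ∈ D.W →
        e.extend (cornerModel n) x (D.idx i) = 0 → x ∈ F i := by
      intro x hx hxW h0
      rw [← (hF.defining i).zero_iff, hρD i x hx hxW, CornerData.rho, CornerData.coord, if_pos hi,
        h0, zero_mul]
    refine hk i q (hz q hqe hDq (hDS i hi)) e a hex (D.idx i) (hDS i hi) ?_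
    filter_upwards [hDev, e.open_source.mem_nhds hqe] with x hxW hxe h0 using hz x hxe hxW h0
  have hyt := map_extend (n := n) hq
  have hev : ∀ᶠ y in 𝓝[quad n] (c.extend (cornerModel n) q), σ y ∈ U ∧
      e.extend (cornerModel n) (σ y) ∈ D.W := by
    have := tendsto_extend_symm c hyt
    rw [extend_symm_apply hq] at this
    exact this (inter_mem (hv.isOpen.mem_nhds hqU) hDev)
  obtain ⟨W, hWo, hyW, hW⟩ := mem_nhdsWithin.1 (inter_mem hev (extend_target_mem c hyt))
  have hWt : W ∩ quad n ⊆ (c.extend (cornerModel n)).target := fun y hy => (hW hy).2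
  have hWe : ∀ y ∈ W ∩ quad n, σ y ∈ e.source := fun y hy => hUe (hW hy).1.1
  have hJ0 : ∀ y ∈ W ∩ quad n, jacobian c e y ≠ 0 := by
    intro y hy
    have := jacobian_ne_zero hc he (map_extend_symm c (hWt hy)) (hWe y hy)
    rwa [extend_apply_symm c (hWt hy)] at this
  have hτD : ∀ y ∈ W ∩ quad n, τ y ∈ D.W ∩ quad n := fun y hy =>
    ⟨(hW hy).1.2, extend_mem_quad e _⟩
  have hτs : ContDiffOn ℝ ∞ τ (W ∩ quad n) := transition_smooth hc he hWt hWe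
  have hgs : ∀ i, ContDiffOn ℝ ∞ (fun y => D.g i (τ y) ^ k i) (W ∩ quad n) := fun i =>
    ((D.smooth i).comp hτs hτD).pow _
  have hprod : ∀ y ∈ W ∩ quad n, 0 < ∏ i, D.g i (τ y) ^ k i := fun y hy =>
    Finset.prod_pos fun i _ => pow_pos (D.pos i _ (hτD y hy)) _
  -- In the exact chart the determinant is ∏ x_j^(k_i) over the faces through `q`. Passing to the
  -- chart `c` divides it by the Jacobian, and replacing x_j by ρ_i divides by the powers of the
  -- positive factors.
  refine ⟨U, v, hv, hqU, W, hWo, hyW, hWt, fun y hy => (hW hy).1.1,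
    fun y => |jacobian c e y|⁻¹ * (∏ i, D.g i (τ y) ^ k i)⁻¹, ?_, ?_, ?_⟩
  · refine ContDiffOn.mul ?_ ?_
    · refine ContDiffOn.inv (fun y hy => ?_) fun y hy => abs_ne_zero.2 (hJ0 y hy)
      exact (contDiffAt_abs (hJ0 y hy)).comp_contDiffWithinAt y
        (jacobian_smooth hc he hWo hWt hWe y hy)
    · exact ContDiffOn.inv (contDiffOn_prod fun i _ => hgs i) fun y hy => (hprod y hy).ne'
  · intro y hy
    exact mul_pos (inv_pos.2 (abs_pos.2 (hJ0 y hy))) (inv_pos.2 (hprod y hy))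
  · intro y hy
    have hxc := map_extend_symm c (hWt hy)
    have hxe := hWe y hy
    have h1 := frameDet_transition hc he hxc hxe v
    rw [extend_apply_symm c (hWt hy), frameDet_exact (hform _ (hW hy).1.1)] at h1
    have h2 : ∏ j with e.extend (cornerModel n) q j = 0,
        e.extend (cornerModel n) (σ y) j ^ ∑ i, a i j = ∏ i, D.coord i (τ y) ^ k i := by
      have h3 : ∏ i, D.coord i (τ y) ^ k i = ∏ i ∈ D.S, (τ y) (D.idx i) ^ k i := by
        rw [← Finset.prod_subset (Finset.subset_univ D.S)]
        · exact Finset.prod_congr rfl fun i hi => by rw [CornerData.coord, if_pos hi]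
        · intro i _ hi
          rw [CornerData.coord, if_neg hi, one_pow]
      rw [h3]
      symm
      refine Finset.prod_bij (fun i _ => D.idx i) (fun i hi => ?_) (fun i hi j hj h => D.injOn i hi j hj h)
        (fun j hj => ?_) (fun i hi => ?_)
      · exact Finset.mem_filter.2 ⟨Finset.mem_univ _, hDS i hi⟩
      · obtain ⟨i, hi, hij⟩ := hDJ j (Finset.mem_filter.1 hj).2
        exact ⟨i, hi, hij⟩
      · rw [hκ i hi]; rfl
    have h4 : ∏ i, ρ i (σ y) ^ k i =
        (∏ i, D.coord i (τ y) ^ k i) * ∏ i, D.g i (τ y) ^ k i := by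
      rw [← Finset.prod_mul_distrib]
      refine Finset.prod_congr rfl fun i _ => ?_
      rw [hρD i _ hxe (hτD y hy).1, CornerData.rho, mul_pow]; rfl
    have h5 : 0 ≤ ∏ i, D.coord i (τ y) ^ k i :=
      Finset.prod_nonneg fun i _ => pow_nonneg (CornerData.coord_nonneg i (hτD y hy).2) _
    rw [h4, ← abs_of_nonneg h5, ← h2, h1, abs_mul]
    have h6 := (abs_pos.2 (hJ0 y hy)).ne'
    have h7 := (hprod y hy).ne'
    field_simp
    rfl

/-- In any chart, a density is smooth up to the factor `∏ ρ_i ^ (-k_i)`. -/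
theorem Density.exists_chart (hn : 0 < n) (hV : V.IsExact) (hF : IsHyperfaceSystem n F ρ)
    {k : Fin N → ℕ} (hk : ∀ i, V.IsDegeneracyIndex (F i) (k i)) (f : V.Density)
    (hc : c ∈ IsManifold.maximalAtlas (cornerModel n) ∞ M) {q : M} (hq : q ∈ c.source) :
    ∃ W : Set (EuclideanSpace ℝ (Fin n)), IsOpen W ∧ c.extend (cornerModel n) q ∈ W ∧
      W ∩ quad n ⊆ (c.extend (cornerModel n)).target ∧
      ∃ φ : EuclideanSpace ℝ (Fin n) → ℂ, ContDiffOn ℝ ∞ φ (W ∩ quad n) ∧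
        ∀ y ∈ W ∩ openQuad n, (∏ i, ρ i ((c.extend (cornerModel n)).symm y) ^ k i : ℝ) *
          f.val ((c.extend (cornerModel n)).symm y)
            (chartFrame c ((c.extend (cornerModel n)).symm y)) = φ y := by
  obtain ⟨U, v, hv, hqU, W, hWo, hqW, hWt, hWU, m, hms, hm0, hm⟩ :=
    hV.exists_frameDet hn hF hk hc hq
  obtain ⟨g, hg, hgv⟩ := f.smooth U v hv
  refine ⟨W, hWo, hqW, hWt, fun y => ((m y)⁻¹ : ℝ) * g ((c.extend (cornerModel n)).symm y),
    ?_, ?_⟩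
  · refine ContDiffOn.mul (ContDiffOn.complex_ofReal (hms.inv fun y hy => (hm0 y hy).ne')) ?_
    exact contDiffOn_comp_extend_symm hc hg hWt hWU
  · intro y hy
    have hyq : y ∈ W ∩ quad n := ⟨hy.1, openQuad_subset n hy.2⟩
    have hxc := map_extend_symm c (hWt hyq)
    have hxi : (c.extend (cornerModel n)).symm y ∈ (cornerModel n).interior M := by
      rw [mem_interior_iff hc hxc, extend_apply_symm c (hWt hyq)]; exact hy.2
    have h1 := hgv _ ⟨hWU y hyq, hxi⟩
    have h2 := f.val_eq hc hxc hxi (fun i => v i ((c.extend (cornerModel n)).symm y))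
    have h3 := hm y hyq
    unfold frameDet at h3
    rw [h3] at h2
    have h4 := (hm0 y hyq).ne'
    have h4' : (m y : ℂ) ≠ 0 := by exact_mod_cast h4
    refine Eq.trans ?_ (congrArg (fun z => (((m y)⁻¹ : ℝ) : ℂ) * z) (h2.symm.trans h1))
    simp only [Complex.ofReal_mul, Complex.ofReal_inv, mul_assoc]
    rw [inv_mul_cancel_left₀ h4']

end LieStructure

end

/-! ### Localization to corner integrals -/

noncomputable section

variable {n : ℕ} {M : Type*} [TopologicalSpace M] [ChartedSpace (EuclideanQuadrant n) M]
  [IsManifold (cornerModel n) ∞ M] [T2Space M] [CompactSpace M]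
  {N : ℕ} {F : Fin N → Set M} {ρ : Fin N → SmoothFun n M}

/-- The image of the support of a function of the partition of unity in the chart. -/
def partitionImage (n : ℕ) {M : Type*} [TopologicalSpace M]
    [ChartedSpace (EuclideanQuadrant n) M] [IsManifold (cornerModel n) ∞ M] [T2Space M]
    [CompactSpace M] (p : M) : Set (EuclideanSpace ℝ (Fin n)) :=
  extChartAt (cornerModel n) p '' tsupport (chartPartition n M p)

theorem tsupport_subset_source (p : M) :
    tsupport (chartPartition n M p) ⊆ (chartAt (EuclideanQuadrant n) p).source :=
  chartPartition_isSubordinate n M p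

theorem isCompact_partitionImage (p : M) : IsCompact (partitionImage n p) := by
  refine (isClosed_tsupport (chartPartition n M p)).isCompact.image_of_continuousOn ?_
  refine (continuousOn_extChartAt p).mono ?_
  rw [extChartAt_source]
  exact tsupport_subset_source p

theorem partitionImage_subset (p : M) :
    partitionImage n p ⊆ (extChartAt (cornerModel n) p).target := by
  rintro _ ⟨x, hx, rfl⟩
  exact (extChartAt (cornerModel n) p).map_source
    (by rw [extChartAt_source]; exact tsupport_subset_source p hx)

theorem chartPartition_eq_zero {p : M} {y : EuclideanSpace ℝ (Fin n)}
    (hy : y ∈ (extChartAt (cornerModel n) p).target) (hyK : y ∉ partitionImage n p) :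
    chartPartition n M p ((extChartAt (cornerModel n) p).symm y) = 0 := by
  by_contra h
  exact hyK ⟨_, subset_tsupport _ h, (extChartAt (cornerModel n) p).right_inv hy⟩

namespace LieStructure

variable {V : LieStructure n M}

theorem cutoffDensity_multiPowMul (f : V.Density) (z : Fin N → ℂ) (p : M)
    (y : EuclideanSpace ℝ (Fin n)) :
    cutoffDensity (multiPowMul ρ f z) p y =
      (chartPartition n M p ((extChartAt (cornerModel n) p).symm y) : ℂ) *
        ((∏ i, (ρ i ((extChartAt (cornerModel n) p).symm y) : ℂ) ^ z i) *
          f.val ((extChartAt (cornerModel n) p).symm y)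
            (chartFrame (chartAt (EuclideanQuadrant n) p)
              ((extChartAt (cornerModel n) p).symm y))) := rfl

theorem prod_cpow_eq {r : Fin N → ℝ} (hr : ∀ i, 0 < r i) (z : Fin N → ℂ) (k : Fin N → ℕ) :
    ∏ i, (r i : ℂ) ^ z i =
      (∏ i, (r i : ℂ) ^ (z i - k i)) * ((∏ i, r i ^ k i : ℝ) : ℂ) := by
  rw [Complex.ofReal_prod, ← Finset.prod_mul_distrib]
  refine Finset.prod_congr rfl fun i _ => ?_
  have h : (r i : ℂ) ≠ 0 := by exact_mod_cast (hr i).ne'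
  rw [Complex.ofReal_pow, ← Complex.cpow_natCast, ← Complex.cpow_add _ _ h, sub_add_cancel]

/-- In a chart, `ρ^z f` is a finite sum of the integrands studied for corners. -/
theorem Density.exists_pieces (hn : 0 < n) (hV : V.IsExact) (hF : IsHyperfaceSystem n F ρ)
    {k : Fin N → ℕ} (hk : ∀ i, V.IsDegeneracyIndex (F i) (k i)) {d : ℕ}
    (hd : ∀ p : M, depth n p ≤ d) (f : V.Density) (p : M) :
    ∃ (ι : Type) (_ : Fintype ι) (D : ι → CornerData n N)
      (φ : ι → EuclideanSpace ℝ (Fin n) → ℂ), (∀ a, (D a).Test (φ a)) ∧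
      (∀ a, (D a).S.card ≤ d) ∧
      (∀ a, ∀ y ∈ quad n, y ∉ (extChartAt (cornerModel n) p).target → φ a y = 0) ∧
      ∀ z, ∀ y ∈ (extChartAt (cornerModel n) p).target ∩ openQuad n,
        cutoffDensity (multiPowMul ρ f z) p y =
          ∑ a, (D a).rhoPow (fun i => z i - k i) y * φ a y := by
  classical
  set c := chartAt (EuclideanQuadrant n) p with hcdef
  have hc : c ∈ IsManifold.maximalAtlas (cornerModel n) ∞ M := IsManifold.chart_mem_maximalAtlas p
  set σ := (extChartAt (cornerModel n) p).symm with hσ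
  set T := (extChartAt (cornerModel n) p).target with hT
  set K := partitionImage n p with hK
  -- Each point of the compact support has a neighbourhood on which defining functions and density
  -- are in normal form. The size of `S` is at most the depth, since `idx` embeds `S` in the set of
  -- vanishing coordinates.
  have hloc : ∀ y₀ : K, ∃ D : CornerData n N, (y₀ : EuclideanSpace ℝ (Fin n)) ∈ D.W ∧
      D.W ∩ quad n ⊆ T ∧ (∀ i, ∀ y ∈ D.W ∩ quad n, ρ i (σ y) = D.rho i y) ∧ D.S.card ≤ d ∧
      ∃ φ : EuclideanSpace ℝ (Fin n) → ℂ, ContDiffOn ℝ ∞ φ (D.W ∩ quad n) ∧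
        ∀ y ∈ D.W ∩ openQuad n, (∏ i, ρ i (σ y) ^ k i : ℝ) * f.val (σ y) (chartFrame c (σ y)) =
          φ y := by
    rintro ⟨y₀, hy₀⟩
    have hy₀T : y₀ ∈ (c.extend (cornerModel n)).target := partitionImage_subset p hy₀
    have hq : (c.extend (cornerModel n)).symm y₀ ∈ c.source := map_extend_symm c hy₀T
    have hqy : c.extend (cornerModel n) ((c.extend (cornerModel n)).symm y₀) = y₀ :=
      extend_apply_symm c hy₀T
    obtain ⟨W, hWo, hqW, hWt, φ, hφ, hφf⟩ := f.exists_chart hn hV hF hk hc hq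
    obtain ⟨D, hDq, hDW, hDt, hDρ, hDS, -, -⟩ := hF.exists_cornerData hn hc hq (hWo.mem_nhds hqW)
    rw [hqy] at hDq
    refine ⟨D, hDq, hDt, hDρ, ?_, φ, hφ.mono (inter_subset_inter_left _ hDW),
      fun y hy => hφf y ⟨hDW hy.1, hy.2⟩⟩
    refine le_trans ?_ (hd ((c.extend (cornerModel n)).symm y₀))
    rw [depth_eq hc hq, ← Finset.card_image_of_injOn (s := D.S) (f := D.idx)
      (fun i hi j hj h => D.injOn i hi j hj h), ← ncard_coe_finset]
    refine ncard_le_ncard ?_ (toFinite _)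
    intro j hj
    obtain ⟨i, hi, rfl⟩ := Finset.mem_image.1 hj
    exact hDS i hi
  choose D hDq hDt hDρ hDS φ hφ hφf using hloc
  obtain ⟨t, ht⟩ := (isCompact_partitionImage (n := n) p).elim_finite_subcover
    (fun y₀ : K => (D y₀).W) (fun y₀ => (D y₀).isOpen)
    (fun y hy => mem_iUnion.2 ⟨⟨y, hy⟩, hDq ⟨y, hy⟩⟩)
  let s : Fin t.card ≃ t := t.equivFin.symm
  obtain ⟨b, hb⟩ := SmoothPartitionOfUnity.exists_isSubordinate 𝓘(ℝ, EuclideanSpace ℝ (Fin n))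
    (isCompact_partitionImage (n := n) p).isClosed (fun a : Fin t.card => (D (s a)).W)
    (fun a => (D (s a)).isOpen) (fun y hy => by
      obtain ⟨y₀, hy₀t, hy₀⟩ := mem_iUnion₂.1 (ht hy)
      exact mem_iUnion.2 ⟨s.symm ⟨y₀, hy₀t⟩, by rw [Equiv.apply_symm_apply]; exact hy₀⟩)
  -- A second partition of unity, on ℝⁿ, distributes the cutoff density over these neighbourhoods.
  -- The indicator discards the arbitrary values of `φ` outside `W`.
  let ψ : Fin t.card → EuclideanSpace ℝ (Fin n) → ℂ := fun a =>
    (D (s a)).W.indicator fun y => ((chartPartition n M p (σ y) * b a y : ℝ) : ℂ) * φ (s a) y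
  have hψ0 : ∀ a, ∀ y ∈ quad n, y ∉ K ∩ tsupport (b a) → ψ a y = 0 := by
    intro a y hy hyK
    by_cases hyW : y ∈ (D (s a)).W
    · simp only [ψ, indicator_of_mem hyW]
      by_cases hyK' : y ∈ K
      · have : b a y = 0 := by
          by_contra h
          exact hyK ⟨hyK', subset_tsupport _ h⟩
        simp [this]
      · have := chartPartition_eq_zero (hDt _ ⟨hyW, hy⟩) hyK'
        rw [← hσ] at this
        simp [this]
    · simp only [ψ, indicator_of_notMem hyW]
  refine ⟨Fin t.card, inferInstance, fun a => D (s a), ψ, fun a => ?_, fun a => hDS _, ?_, ?_⟩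
  · have hKc : IsCompact (K ∩ tsupport (b a)) :=
      (isCompact_partitionImage p).inter_right (isClosed_tsupport _)
    refine ⟨contDiffOn_of_support (D (s a)).isOpen hKc.isClosed
      (inter_subset_right.trans (hb a)) ?_ (hψ0 a), _, inter_subset_right.trans (hb a), hKc, hψ0 a⟩
    refine ContDiffOn.congr (f := fun y =>
      ((chartPartition n M p (σ y) * b a y : ℝ) : ℂ) * φ (s a) y) ?_
      fun y hy => by simp only [ψ, indicator_of_mem hy.1]
    refine (ContDiffOn.complex_ofReal ?_).mul (hφ _)
    refine ContDiffOn.mul ?_ ?_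
    · exact (contDiffOn_fun_chart hc (chartPartition n M p)).mono (hDt _)
    · exact (contMDiff_iff_contDiff.1 (b a).contMDiff).contDiffOn
  · intro a y hy hyT
    exact hψ0 a y hy fun h => hyT (partitionImage_subset p h.1)
  · rintro z y ⟨hyT, hyo⟩
    have hyq := openQuad_subset n hyo
    rw [cutoffDensity_multiPowMul]
    by_cases hyK : y ∈ K
    · have h1 : ∑ a, b a y = 1 := by
        rw [← finsum_eq_sum_of_fintype]
        exact b.sum_eq_one hyK
      have h1' : (1 : ℂ) = ∑ a, (b a y : ℂ) := by rw [← Complex.ofReal_sum, h1]; simp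
      rw [← one_mul (_ * _), h1', Finset.sum_mul]
      refine Finset.sum_congr rfl fun a _ => ?_
      by_cases hba : b a y = 0
      · have : ψ a y = 0 := by
          simp only [ψ, indicator_apply, hba]; simp
        rw [this, hba]; simp
      · have hyW : y ∈ (D (s a)).W := hb a (subset_tsupport _ hba)
        have hpos : ∀ i, 0 < ρ i (σ y) := fun i => by
          rw [hDρ (s a) i y ⟨hyW, hyq⟩]
          exact CornerData.rho_pos i hyo hyW
        simp only [ψ, indicator_of_mem hyW]
        rw [prod_cpow_eq hpos z k, ← hφf (s a) y ⟨hyW, hyo⟩]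
        have h2 : (D (s a)).rhoPow (fun i => z i - k i) y =
            ∏ i, (ρ i (σ y) : ℂ) ^ (z i - k i) := by
          unfold CornerData.rhoPow
          exact Finset.prod_congr rfl fun i _ => by rw [hDρ (s a) i y ⟨hyW, hyq⟩]
        rw [h2, Complex.ofReal_mul]
        ring
    · have := chartPartition_eq_zero hyT hyK
      rw [this, Finset.sum_eq_zero fun a _ => by rw [hψ0 a y hyq fun h => hyK h.1, mul_zero]]
      simp

end LieStructure

end

/-! ### Sums of polar functions and restriction to the diagonal -/

noncomputable section

/-- Only finitely many of the points k - 1 - j lie within distance one of `w`. -/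
theorem eventually_notMem_poleSet (k : ℕ) (w : ℂ) : ∀ᶠ z in 𝓝[≠] w, z ∉ poleSet k := by
  obtain ⟨R, hR⟩ := exists_nat_gt ((k : ℝ) + |w.re| + 1)
  set A : Set ℂ := ((fun j : ℕ => (k : ℂ) - 1 - j) '' (Iio R)) \ {w} with hA
  have hAf : A.Finite := ((finite_Iio R).image _).sdiff
  have hAw : w ∉ A := fun h => h.2 rfl
  filter_upwards [nhdsWithin_le_nhds (hAf.isClosed.isOpen_compl.mem_nhds hAw),
    nhdsWithin_le_nhds (Metric.ball_mem_nhds w one_pos), self_mem_nhdsWithin] with z hz hzw hne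
  rintro ⟨j, hj⟩
  refine hz ⟨⟨j, ?_, hj.symm⟩, hne⟩
  have h1 : |(z - w).re| < 1 := (Complex.abs_re_le_norm _).trans_lt (by
    rwa [Metric.mem_ball, dist_eq_norm] at hzw)
  rw [hj] at h1
  simp only [Complex.sub_re, Complex.natCast_re, Complex.one_re] at h1
  have h2 := (abs_lt.1 h1).1
  have h3 := neg_abs_le w.re
  have h4 : (j : ℝ) < R := by linarith
  exact_mod_cast h4

variable {N : ℕ} {k : Fin N → ℕ}

open scoped Classical in
-- Multiplying by the linear factors of the variables outside `S` is harmless. The finer information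
-- about `S` is kept separately since it bounds the order on the diagonal.
theorem PolesOn.hasSimplePolesAlong {S : Finset (Fin N)} {P : Fin N → Set ℂ}
    {g : (Fin N → ℂ) → ℂ} (hg : PolesOn S P g) : HasSimplePolesAlong P g := by
  intro w
  obtain ⟨h, hh, hev⟩ := hg w
  refine ⟨fun z => (∏ i ∈ Sᶜ with w i ∈ P i, (z i - w i)) * h z, AnalyticAt.mul ?_ hh, ?_⟩
  · refine Finset.analyticAt_fun_prod _ fun i _ => ?_
    exact ((ContinuousLinearMap.proj (R := ℂ) (φ := fun _ : Fin N => ℂ) i).analyticAt w).sub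
      analyticAt_const
  · filter_upwards [hev] with z hz hzP
    rw [← hz hzP, ← mul_assoc]
    congr 1
    simp only [Finset.prod_filter]
    rw [mul_comm, Finset.prod_mul_prod_compl]

/-- The clearing factor at `w` depends only on `w` and `P`, so it is common to all summands. -/
theorem HasSimplePolesAlong.sum {ι : Type*} (s : Finset ι) {P : Fin N → Set ℂ}
    {g : ι → (Fin N → ℂ) → ℂ} (hg : ∀ a, HasSimplePolesAlong P (g a)) :
    HasSimplePolesAlong P fun z => ∑ a ∈ s, g a z := by
  intro w
  choose h hh hev using fun a => hg a w
  refine ⟨fun z => ∑ a ∈ s, h a z, s.analyticAt_fun_sum fun a _ => hh a, ?_⟩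
  filter_upwards [(s.eventually_all).2 fun a _ => hev a] with z hz hzP
  rw [Finset.mul_sum]
  exact Finset.sum_congr rfl fun a ha => hz a ha hzP

/-- The restriction of `g` to the diagonal is meromorphic, with poles of order at most `d` at the
points of the sets `poleSet (k i)`. -/
def DiagonalPoles (k : Fin N → ℕ) (d : ℕ) (g : ℂ → ℂ) : Prop :=
  ∀ z, MeromorphicAt g z ∧ ((∀ i, z ∉ poleSet (k i)) → AnalyticAt ℂ g z) ∧
    ((-(d : ℤ) : ℤ) : WithTop ℤ) ≤ meromorphicOrderAt g z

theorem DiagonalPoles.zero (d : ℕ) : DiagonalPoles k d fun _ => 0 := fun z => by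
  have h : AnalyticAt ℂ (fun _ : ℂ => (0 : ℂ)) z := analyticAt_const
  exact ⟨h.meromorphicAt, fun _ => h, le_trans (by exact_mod_cast (by omega : -(d : ℤ) ≤ 0))
    h.meromorphicOrderAt_nonneg⟩

theorem DiagonalPoles.add {d : ℕ} {g g' : ℂ → ℂ} (hg : DiagonalPoles k d g)
    (hg' : DiagonalPoles k d g') : DiagonalPoles k d fun z => g z + g' z := fun z => by
  obtain ⟨h1, h2, h3⟩ := hg z
  obtain ⟨h1', h2', h3'⟩ := hg' z
  exact ⟨h1.add h1', fun h => (h2 h).add (h2' h),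
    (le_min h3 h3').trans (meromorphicOrderAt_add h1 h1')⟩

theorem DiagonalPoles.sum {d : ℕ} {ι : Type*} (s : Finset ι) {g : ι → ℂ → ℂ}
    (hg : ∀ a, DiagonalPoles k d (g a)) : DiagonalPoles k d fun z => ∑ a ∈ s, g a z := by
  classical
  induction s using Finset.induction_on with
  | empty => simpa using DiagonalPoles.zero d
  | insert a s ha ih =>
    simp only [Finset.sum_insert ha]
    exact (hg a).add ih

open scoped Classical in
-- On the diagonal all clearing factors become z - z₀, and there are at most |S| of them. If z₀ is
-- in no pole set there are none, and the identity with `h` holds on a full neighbourhood, which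
-- gives analyticity and not only a removable singularity.
theorem PolesOn.diagonalPoles {S : Finset (Fin N)} {g : (Fin N → ℂ) → ℂ}
    (hg : PolesOn S (fun i => poleSet (k i)) g) {d : ℕ} (hd : S.card ≤ d) :
    DiagonalPoles k d fun z => g fun _ => z := by
  intro z₀
  obtain ⟨h, hh, hev⟩ := hg fun _ => z₀
  have hδ : AnalyticAt ℂ (fun (z : ℂ) (_ : Fin N) => z) z₀ :=
    (ContinuousLinearMap.pi fun _ : Fin N => ContinuousLinearMap.id ℂ ℂ).analyticAt z₀
  have hH : AnalyticAt ℂ (fun z : ℂ => h fun _ => z) z₀ :=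
    AnalyticAt.comp (g := h) (f := fun (z : ℂ) (_ : Fin N) => z) hh hδ
  set m := (S.filter fun i => z₀ ∈ poleSet (k i)).card with hm
  have hmd : m ≤ d := (Finset.card_filter_le _ _).trans hd
  have hev' : ∀ᶠ z in 𝓝 z₀, (∀ i, z ∉ poleSet (k i)) →
      (z - z₀) ^ m * g (fun _ => z) = h fun _ => z := by
    filter_upwards [hδ.continuousAt.eventually hev] with z hz hzP
    rw [← hz hzP, Finset.prod_const]
  have hP : ∀ᶠ z in 𝓝[≠] z₀, ∀ i, z ∉ poleSet (k i) :=
    eventually_all.2 fun i => eventually_notMem_poleSet (k i) z₀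
  have heq : (fun z => g fun _ => z) =ᶠ[𝓝[≠] z₀]
      fun z => (z - z₀) ^ (-(m : ℤ)) * h fun _ => z := by
    filter_upwards [nhdsWithin_le_nhds hev', hP, self_mem_nhdsWithin] with z hz hzP hne
    have h0 : z - z₀ ≠ 0 := sub_ne_zero.2 hne
    rw [← hz hzP, zpow_neg, zpow_natCast, inv_mul_cancel_left₀ (pow_ne_zero m h0)]
  have hzp : MeromorphicAt (fun z => (z - z₀) ^ (-(m : ℤ))) z₀ := by fun_prop
  refine ⟨(hzp.mul hH.meromorphicAt).congr heq.symm, fun hz₀ => ?_, ?_⟩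
  · have hm0 : m = 0 := by
      rw [hm, Finset.card_eq_zero, Finset.filter_eq_empty_iff]
      exact fun i _ => hz₀ i
    refine hH.congr ?_
    have hP' : ∀ᶠ z in 𝓝 z₀, ∀ i, z ∉ poleSet (k i) := by
      rw [eventually_nhdsWithin_iff] at hP
      filter_upwards [hP] with z hz i
      by_cases h0 : z = z₀
      · rw [h0]; exact hz₀ i
      · exact hz h0 i
    filter_upwards [hev', hP'] with z hz hzP
    have := hz hzP
    rw [hm0, pow_zero, one_mul] at this
    exact this.symm
  · rw [meromorphicOrderAt_congr heq]
    have h1 := meromorphicOrderAt_mul hzp hH.meromorphicAt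
    have h2 : meromorphicOrderAt (fun z => (z - z₀) ^ (-(m : ℤ))) z₀ = ((-(m : ℤ) : ℤ) : WithTop ℤ) :=
      fun_meromorphicOrderAt_zpow_id_sub_const
    have h3 : meromorphicOrderAt (fun z => (z - z₀) ^ (-(m : ℤ)) * h fun _ => z) z₀ =
      meromorphicOrderAt ((fun z => (z - z₀) ^ (-(m : ℤ))) * fun z => h fun _ => z) z₀ := rfl
    rw [h3, h1, h2]
    calc ((-(d : ℤ) : ℤ) : WithTop ℤ) ≤ ((-(m : ℤ) : ℤ) : WithTop ℤ) := by
          exact_mod_cast (by omega : -(d : ℤ) ≤ -(m : ℤ))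
      _ ≤ _ := le_add_of_nonneg_right hH.meromorphicOrderAt_nonneg

end

/-! ### Global continuation and the one-variable function -/

noncomputable section

variable {n : ℕ} {M : Type*} [TopologicalSpace M] [ChartedSpace (EuclideanQuadrant n) M]

theorem target_subset_quad (p : M) : (extChartAt (cornerModel n) p).target ⊆ quad n :=
  extend_target_subset (chartAt (EuclideanQuadrant n) p)

theorem measurableSet_target (p : M) :
    MeasurableSet (extChartAt (cornerModel n) p).target := by
  obtain ⟨O, hO, h⟩ := extend_target_eq (chartAt (EuclideanQuadrant n) p)
  have : (extChartAt (cornerModel n) p).target = O ∩ quad n := h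
  rw [this]
  exact hO.measurableSet.inter (isClosed_quad n).measurableSet

/-- The boundary of the quadrant is a null set, so integrals can be computed where all ρ_i are
positive. -/
theorem target_ae_eq (p : M) :
    ((extChartAt (cornerModel n) p).target ∩ openQuad n : Set (EuclideanSpace ℝ (Fin n)))
      =ᵐ[volume] (extChartAt (cornerModel n) p).target := by
  have h1 : ((extChartAt (cornerModel n) p).target ∩ openQuad n : Set (EuclideanSpace ℝ (Fin n)))
      =ᵐ[volume] ((extChartAt (cornerModel n) p).target ∩ quad n :
        Set (EuclideanSpace ℝ (Fin n))) :=
    ae_eq_set_inter (ae_eq_refl _) (quad_ae_eq n)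
  rwa [inter_eq_self_of_subset_left (target_subset_quad p)] at h1

theorem extChartAt_symm_mem_interior [IsManifold (cornerModel n) ∞ M] {p : M}
    {y : EuclideanSpace ℝ (Fin n)}
    (hy : y ∈ (extChartAt (cornerModel n) p).target ∩ openQuad n) :
    (extChartAt (cornerModel n) p).symm y ∈ (cornerModel n).interior M := by
  have hc : chartAt (EuclideanQuadrant n) p ∈ IsManifold.maximalAtlas (cornerModel n) ∞ M :=
    IsManifold.chart_mem_maximalAtlas p
  refine (mem_interior_iff hc (map_extend_symm _ hy.1)).2 ?_
  have h : (chartAt (EuclideanQuadrant n) p).extend (cornerModel n)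
    (((chartAt (EuclideanQuadrant n) p).extend (cornerModel n)).symm y) = y :=
    extend_apply_symm _ hy.1
  exact h.symm ▸ hy.2

variable [IsManifold (cornerModel n) ∞ M] [T2Space M] [CompactSpace M]
  {N : ℕ} {F : Fin N → Set M} {ρ : Fin N → SmoothFun n M}

theorem finite_chartPartition : {p : M | ∃ x, chartPartition n M p x ≠ 0}.Finite := by
  have := (chartPartition n M).locallyFinite.finite_nonempty_of_compact
  exact this

theorem densityIntegral_eq_sum {f : ∀ x : M, (Fin n → TangentSpace (cornerModel n) x) → ℂ} :
    densityIntegral f = ∑ p ∈ (finite_chartPartition (n := n) (M := M)).toFinset,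
      ∫ y in (extChartAt (cornerModel n) p).target, cutoffDensity f p y := by
  refine finsum_eq_sum_of_support_subset _ fun p hp => ?_
  rw [Finite.coe_toFinset]
  by_contra hp'
  simp only [mem_ofPred_eq, not_exists, not_not] at hp'
  refine hp ?_
  simp [cutoffDensity, hp']

namespace LieStructure

variable {V : LieStructure n M}

theorem Density.exists_continuation_chart (hn : 0 < n) (hV : V.IsExact)
    (hF : IsHyperfaceSystem n F ρ) {k : Fin N → ℕ} (hk : ∀ i, V.IsDegeneracyIndex (F i) (k i))
    {d : ℕ} (hd : ∀ p : M, depth n p ≤ d) (f : V.Density) (p : M) :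
    ∃ G : (Fin N → ℂ) → ℂ,
      (∀ z : Fin N → ℂ, (∀ i, (k i : ℝ) - 1 < (z i).re) →
        IntegrableOn (cutoffDensity (multiPowMul ρ f z) p) (extChartAt (cornerModel n) p).target ∧
        G z = ∫ y in (extChartAt (cornerModel n) p).target, cutoffDensity (multiPowMul ρ f z) p y) ∧
      HasSimplePolesAlong (fun i => poleSet (k i)) G ∧
      DiagonalPoles k d fun z => G fun _ => z := by
  obtain ⟨ι, hι, D, φ, hφ, hD, h0, hcut⟩ := f.exists_pieces hn hV hF hk hd p
  choose G hG hP using fun a => (hφ a).exists_shifted_continuation k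
  refine ⟨fun z => ∑ a, G a z, fun z hz => ?_,
    HasSimplePolesAlong.sum _ fun a => (hP a).hasSimplePolesAlong,
    DiagonalPoles.sum _ fun a => (hP a).diagonalPoles (hD a)⟩
  have hint : ∀ a, IntegrableOn (fun y => (D a).rhoPow (fun i => z i - k i) y * φ a y)
      (openQuad n) := fun a => (hφ a).integrableOn fun i _ => by
    have := hz i
    simp only [Pi.zero_apply, Complex.sub_re, Complex.natCast_re]
    linarith
  have hm : MeasurableSet ((extChartAt (cornerModel n) p).target ∩ openQuad n) :=
    (measurableSet_target (n := n) p).inter (isOpen_openQuad n).measurableSet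
  have hsum : IntegrableOn (fun y => ∑ a, (D a).rhoPow (fun i => z i - k i) y * φ a y)
      (openQuad n) := integrable_finsetSum _ fun a _ => hint a
  constructor
  · refine IntegrableOn.congr_set_ae ?_ (target_ae_eq (n := n) p).symm
    exact (hsum.mono_set inter_subset_right).congr_fun (fun y hy => (hcut z y hy).symm) hm
  · rw [← setIntegral_congr_set (target_ae_eq (n := n) p), setIntegral_congr_fun hm (hcut z),
      ← setIntegral_eq_of_subset_of_forall_sdiff_eq_zero
        (f := fun y => ∑ a, (D a).rhoPow (fun i => z i - k i) y * φ a y)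
        (isOpen_openQuad n).measurableSet inter_subset_right (fun y hy =>
          Finset.sum_eq_zero fun a _ => by
            rw [h0 a y (openQuad_subset n hy.1) fun h => hy.2 ⟨h, hy.1⟩, mul_zero]),
      integral_finsetSum _ fun a _ => hint a]
    exact Finset.sum_congr rfl fun a _ => hG a z hz

theorem Density.exists_continuation (hn : 0 < n) (hV : V.IsExact)
    (hF : IsHyperfaceSystem n F ρ) {k : Fin N → ℕ} (hk : ∀ i, V.IsDegeneracyIndex (F i) (k i))
    {d : ℕ} (hd : ∀ p : M, depth n p ≤ d) (f : V.Density) :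
    (∀ z : Fin N → ℂ, (∀ i, (k i : ℝ) - 1 < (z i).re) → DensityIntegrable (multiPowMul ρ f z)) ∧
    ∃ G : (Fin N → ℂ) → ℂ,
      (∀ z : Fin N → ℂ, (∀ i, (k i : ℝ) - 1 < (z i).re) → G z = multiG ρ f z) ∧
      HasSimplePolesAlong (fun i => poleSet (k i)) G ∧
      DiagonalPoles k d fun z => G fun _ => z := by
  choose G hG hP hdiag using f.exists_continuation_chart hn hV hF hk hd
  refine ⟨fun z hz p => (hG p z hz).1, fun z => ∑ p ∈ (finite_chartPartition (n := n)
    (M := M)).toFinset, G p z, fun z hz => ?_, HasSimplePolesAlong.sum _ hP,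
    DiagonalPoles.sum _ hdiag⟩
  rw [multiG, densityIntegral_eq_sum]
  exact Finset.sum_congr rfl fun p _ => (hG p z hz).2

/-- Complex powers are multiplicative on nonnegative reals. This identifies `G` with the restriction
of `multiG` to the diagonal. -/
theorem cutoffDensity_powMul (hn : 0 < n) (hF : IsHyperfaceSystem n F ρ) (f : V.Density) (z : ℂ)
    (p : M) {y : EuclideanSpace ℝ (Fin n)}
    (hy : y ∈ (extChartAt (cornerModel n) p).target ∩ openQuad n) :
    cutoffDensity (powMul ρ f z) p y = cutoffDensity (multiPowMul ρ f fun _ => z) p y := by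
  have hx := extChartAt_symm_mem_interior hy
  have h : ∀ s : Finset (Fin N),
      ((∏ i ∈ s, ρ i ((extChartAt (cornerModel n) p).symm y) : ℝ) : ℂ) ^ z =
        ∏ i ∈ s, (ρ i ((extChartAt (cornerModel n) p).symm y) : ℂ) ^ z := by
    intro s
    classical
    induction s using Finset.induction_on with
    | empty => simp
    | insert a s ha ih =>
      rw [Finset.prod_insert ha, Finset.prod_insert ha, ← ih, Complex.ofReal_mul,
        Complex.mul_cpow_ofReal_nonneg (hF.rho_pos hn a hx).le
          (Finset.prod_nonneg fun i _ => (hF.rho_pos hn i hx).le)]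
  unfold cutoffDensity densityInChart powMul multiPowMul
  rw [h]

theorem densityIntegrable_powMul (hn : 0 < n) (hF : IsHyperfaceSystem n F ρ) (f : V.Density)
    (z : ℂ) : DensityIntegrable (powMul ρ f z) ↔ DensityIntegrable (multiPowMul ρ f fun _ => z) := by
  refine forall_congr' fun p => ?_
  refine (integrableOn_congr_set_ae (target_ae_eq p)).symm.trans (Iff.trans ?_
    (integrableOn_congr_set_ae (target_ae_eq p)))
  exact integrableOn_congr_fun (fun y hy => cutoffDensity_powMul hn hF f z p hy)
    ((measurableSet_target (n := n) p).inter (isOpen_openQuad n).measurableSet)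

theorem G_eq_multiG (hn : 0 < n) (hF : IsHyperfaceSystem n F ρ) (f : V.Density) (z : ℂ) :
    G ρ f z = multiG ρ f fun _ => z := by
  refine finsum_congr fun p => ?_
  refine (setIntegral_congr_set (target_ae_eq p)).symm.trans (Eq.trans ?_
    (setIntegral_congr_set (target_ae_eq p)))
  exact setIntegral_congr_fun ((measurableSet_target (n := n) p).inter (isOpen_openQuad n).measurableSet)
    fun y hy => cutoffDensity_powMul hn hF f z p hy

end LieStructure

end

/-! ### Divergence of 1/y_j and densities with prescribed values -/

noncomputable section

variable {n : ℕ}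

/-- The inverse of a coordinate is not integrable near a point where this coordinate vanishes. -/
theorem not_integrableOn_coord_inv {y₀ : EuclideanSpace ℝ (Fin n)} (hy₀ : y₀ ∈ quad n) {j : Fin n}
    (hj : y₀ j = 0) {W : Set (EuclideanSpace ℝ (Fin n))} (hW : W ∈ 𝓝 y₀) :
    ¬ IntegrableOn (fun y : EuclideanSpace ℝ (Fin n) => (y j)⁻¹) (W ∩ openQuad n) := by
  intro hint
  obtain ⟨r₀, hr₀, hrW⟩ := exists_cube_subset hW
  set r := r₀ / 2 with hr
  have hr0 : 0 < r := by positivity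
  set B : Set (EuclideanSpace ℝ (Fin n)) := {y | ∀ l, y l ∈ Ioc (y₀ l) (y₀ l + r)} with hB
  have hBW : B ⊆ W ∩ openQuad n := by
    intro y hy
    refine ⟨hrW fun l => ?_, fun l => (hy₀ l).trans_lt (hy l).1⟩
    have h1 := (hy l).1
    have h2 := (hy l).2
    rw [abs_of_pos (by linarith)]
    linarith
  have hBm : MeasurableSet B := by
    have : B = ⋂ l, {y : EuclideanSpace ℝ (Fin n) | y l ∈ Ioc (y₀ l) (y₀ l + r)} := by
      ext; simp [hB]
    rw [this]
    exact MeasurableSet.iInter fun l => (continuous_coord l).measurable measurableSet_Ioc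
  have hintB := hint.mono_set hBW
  set J := ∫ y in B, (y j)⁻¹ with hJ
  set R := ∏ _l ∈ (Finset.univ : Finset (Fin n)).erase j, r with hR
  have hR0 : 0 < R := Finset.prod_pos fun _ _ => hr0
  -- Restricting to r e^(-t) < y_j ≤ r contributes log(r / (r e^(-t))) = t times the volume `R` of
  -- the other sides, so the integral would exceed every bound.
  have key : ∀ t : ℝ, 0 < t → t * R ≤ J := by
    intro t ht
    set δ := r * Real.exp (-t) with hδ
    have hδ0 : 0 < δ := by positivity
    have hδr : δ ≤ r := by
      have : Real.exp (-t) ≤ 1 := Real.exp_le_one_iff.2 (by linarith)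
      nlinarith
    let f : Fin n → ℝ → ℝ := fun l => if l = j then (Ioc δ r).indicator fun s => s⁻¹ else
      (Ioc (y₀ l) (y₀ l + r)).indicator fun _ => 1
    have hf0 : ∀ l s, 0 ≤ f l s := by
      intro l s
      by_cases hl : l = j
      · simp only [f, if_pos hl]
        exact indicator_nonneg (fun x hx => inv_nonneg.2 (hδ0.trans hx.1).le) s
      · simp only [f, if_neg hl]
        exact indicator_nonneg (fun x hx => zero_le_one) s
    have hfi : ∏ l, ∫ s, f l s = t * R := by
      rw [← Finset.mul_prod_erase _ _ (Finset.mem_univ j)]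
      congr 1
      · simp only [f, if_true]
        rw [integral_indicator measurableSet_Ioc, ← intervalIntegral.integral_of_le hδr,
          integral_inv_of_pos hδ0 hr0, hδ, ← div_div, div_self hr0.ne', one_div, Real.log_inv,
          Real.log_exp, neg_neg]
      · refine Finset.prod_congr rfl fun l hl => ?_
        simp only [f, if_neg (Finset.ne_of_mem_erase hl)]
        rw [integral_indicator measurableSet_Ioc]
        simp [hr0.le]
    have hfe : ∫ y : EuclideanSpace ℝ (Fin n), ∏ l, f l (y l) = t * R := by
      rw [← hfi, ← integral_fintype_prod_volume_eq_prod]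
      exact (EuclideanSpace.volume_preserving_symm_measurableEquiv_toLp
        (Fin n)).integral_comp' (fun x : Fin n → ℝ => ∏ l, f l (x l))
    rw [← hfe, hJ, ← integral_indicator hBm]
    refine integral_mono_of_nonneg (Eventually.of_forall fun y => Finset.prod_nonneg fun l _ =>
      hf0 l _) ((integrable_indicator_iff hBm).2 hintB) (Eventually.of_forall fun y => ?_)
    by_cases hz : ∏ l, f l (y l) = 0
    · simp only [hz]
      exact indicator_nonneg (fun y hy => inv_nonneg.2 ((hy₀ j).trans (hy j).1.le)) y
    · have hne := Finset.prod_ne_zero_iff.1 hz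
      have hj' : y j ∈ Ioc δ r := by
        by_contra h
        exact hne j (Finset.mem_univ j) (by simp only [f, if_true]; exact indicator_of_notMem h _)
      have hl' : ∀ l ≠ j, y l ∈ Ioc (y₀ l) (y₀ l + r) := by
        intro l hl
        by_contra h
        exact hne l (Finset.mem_univ l) (by
          simp only [f, if_neg hl]; exact indicator_of_notMem h _)
      have hyB : y ∈ B := by
        intro l
        by_cases hl : l = j
        · rw [hl, hj, zero_add]; exact ⟨hδ0.trans hj'.1, hj'.2⟩
        · exact hl' l hl
      simp only [indicator_of_mem hyB]
      rw [← Finset.mul_prod_erase _ _ (Finset.mem_univ j), Finset.prod_eq_one, mul_one]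
      · simp only [f, if_true, indicator_of_mem hj']; exact le_rfl
      · intro l hl
        have hl := Finset.ne_of_mem_erase hl
        simp only [f, if_neg hl, indicator_of_mem (hl' l hl)]
  have h1 := key (|J| / R + 1) (by positivity)
  rw [add_mul, div_mul_cancel₀ _ hR0.ne'] at h1
  have := le_abs_self J
  linarith

variable {M : Type*} [TopologicalSpace M] [ChartedSpace (EuclideanQuadrant n) M]
  [IsManifold (cornerModel n) ∞ M]

theorem eq_of_eqOn_interior {X : Type*} [TopologicalSpace X] [T2Space X] {f g : M → X} {U : Set M}
    (hU : IsOpen U) (hf : ContinuousOn f U) (hg : ContinuousOn g U)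
    (h : ∀ x ∈ U, x ∈ (cornerModel n).interior M → f x = g x) : EqOn f g U := by
  intro x hx
  by_contra hne
  have h1 := (hf.continuousAt (hU.mem_nhds hx)).prodMk_nhds (hg.continuousAt (hU.mem_nhds hx))
  have h2 : {p : X × X | p.1 ≠ p.2} ∈ 𝓝 (f x, g x) :=
    (isClosed_diagonal.isOpen_compl).mem_nhds hne
  have h3 : ∀ᶠ y in 𝓝 x, f y ≠ g y := h1 h2
  obtain ⟨y, hy, hy1, hy2⟩ := ((interior_mem_of_frequently (n := n) x).and_eventually
    (h3.and (hU.mem_nhds hx))).exists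
  exact hy1 (h y hy2 hy)

namespace LieStructure

variable {V : LieStructure n M}

variable [T2Space M]

/-- Near an interior point there is a frame of coordinate fields with determinant 1, and its
determinant is bounded by a multiple of that of `v`. -/
theorem IsLocalFrame.frameDet_ne_zero {U : Set M} {v : Fin n → VField n M} (hv : V.IsLocalFrame U v)
    {c : OpenPartialHomeomorph M (EuclideanQuadrant n)}
    (hc : c ∈ IsManifold.maximalAtlas (cornerModel n) ∞ M) {x : M} (hx : x ∈ c.source)
    (hxU : x ∈ U) (hxi : x ∈ (cornerModel n).interior M) : frameDet c v x ≠ 0 := by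
  obtain ⟨e, a, he, hxe, U', -, hxU', v', hv', hform⟩ :=
    V.exists_isExactChart_of_mem_interior hxi
  obtain ⟨C, hC, hle⟩ := hv.exists_le hv' hc he hx hxe hxU
  have h1 := hle.self_of_nhds
  have h2 : frameDet e v' x = 1 := by
    rw [frameDet_exact (hform x hxU')]
    refine Finset.prod_eq_one fun j hj => ?_
    exact absurd (Finset.mem_filter.1 hj).2 ((mem_interior_iff he hxe).1 hxi j).ne'
  intro h0
  rw [h2, h0] at h1
  norm_num at h1

/-- The matrix of a change of local frames is invertible. -/
theorem IsLocalFrame.det_ne_zero {U U' : Set M} {v v' : Fin n → VField n M}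
    (hv : V.IsLocalFrame U v) (hv' : V.IsLocalFrame U' v') {A : M → Fin n → Fin n → ℝ}
    (hA : ∀ i k, ContMDiffOn (cornerModel n) 𝓘(ℝ, ℝ) ∞ (fun x => A x i k) U)
    (hvA : ∀ x ∈ U, ∀ i, v' i x = ∑ k, A x i k • v k x) {x : M} (hx : x ∈ U ∩ U') :
    (Matrix.of (A x)).det ≠ 0 := by
  obtain ⟨B, hB, hvB⟩ := hv'.exists_matrix hv
  -- In the interior the non-zero frame determinant can be cancelled. At boundary points it may
  -- vanish, and there the identity follows by density and continuity.
  have h1 : EqOn (fun x => (Matrix.of (A x)).det * (Matrix.of (B x)).det) (fun _ => 1)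
      (U ∩ U') := by
    refine eq_of_eqOn_interior (n := n) (hv.isOpen.inter hv'.isOpen) ?_ continuousOn_const ?_
    · exact ((contMDiffOn_det hA).continuousOn.mono inter_subset_left).mul
        ((contMDiffOn_det hB).continuousOn.mono inter_subset_right)
    · intro y hy hyi
      have hc : chartAt (EuclideanQuadrant n) y ∈ IsManifold.maximalAtlas (cornerModel n) ∞ M :=
        IsManifold.chart_mem_maximalAtlas y
      have h3 := hv.frameDet_ne_zero hc (mem_chart_source _ y) hy.1 hyi
      have h4 := frameDet_combination (chartAt (EuclideanQuadrant n) y) (hvA y hy.1)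
      have h5 := frameDet_combination (chartAt (EuclideanQuadrant n) y) (hvB y hy.2)
      rw [h4, ← mul_assoc] at h5
      have : ((Matrix.of (A y)).det * (Matrix.of (B y)).det - 1) *
          frameDet (chartAt (EuclideanQuadrant n) y) v y = 0 := by linear_combination -h5
      rcases mul_eq_zero.1 this with h | h
      · linarith
      · exact absurd h h3
  intro h0
  have := h1 hx
  simp [h0] at this

open scoped Classical in
/-- The density with value `χ` on a local frame. -/
theorem IsLocalFrame.exists_density {U : Set M} {v : Fin n → VField n M} (hv : V.IsLocalFrame U v)
    {χ : M → ℝ} (hχ : ContMDiff (cornerModel n) 𝓘(ℝ, ℝ) ∞ χ) (hχU : tsupport χ ⊆ U) :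
    ∃ f : V.Density, ∀ x ∈ U ∩ (cornerModel n).interior M, f.val x (fun i => v i x) = χ x := by
  let dt : ∀ x : M, (Fin n → TangentSpace (cornerModel n) x) → ℝ := fun x w =>
    (stdBasis n).det (w : Fin n → EuclideanSpace ℝ (Fin n))
  have hdt : ∀ x (A : Fin n → Fin n → ℝ) (w : Fin n → TangentSpace (cornerModel n) x),
      dt x (fun i => ∑ k, A i k • w k) = (Matrix.of A).det * dt x w := fun x A w =>
    basis_det_combination A w
  have hdt0 : ∀ x ∈ U ∩ (cornerModel n).interior M, dt x (fun i => v i x) ≠ 0 := by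
    intro x hx h0
    have hc : chartAt (EuclideanQuadrant n) x ∈ IsManifold.maximalAtlas (cornerModel n) ∞ M :=
      IsManifold.chart_mem_maximalAtlas x
    refine hv.frameDet_ne_zero hc (mem_chart_source _ x) hx.1 hx.2 ?_
    have := (stdBasis n).det_comp
      (coordDerivL (chartAt (EuclideanQuadrant n) x) x).toLinearMap (fun i => v i x)
    refine Eq.trans this ?_
    refine mul_eq_zero_of_right _ h0
  -- The ratio of determinants does not depend on the basis used in each tangent space, so no chart
  -- is needed. On another frame the value is χ |det A| with det A ≠ 0, where |·| is smooth.
  refine ⟨⟨fun x w => if x ∈ U then ((χ x * (|dt x w| / |dt x fun i => v i x|) : ℝ) : ℂ) else 0,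
    ?_, ?_⟩, ?_⟩
  · intro x _ T w
    have h1 : dt x (fun i => T (w i)) = LinearMap.det T * dt x w := (stdBasis n).det_comp T w
    simp only [h1, abs_mul]
    split_ifs
    · push_cast; ring
    · simp
  · intro U' v' hv'
    obtain ⟨A, hA, hvA⟩ := hv.exists_matrix hv'
    refine ⟨fun x => if x ∈ U then ((χ x * |(Matrix.of (A x)).det| : ℝ) : ℂ) else 0, ?_, ?_⟩
    · intro x hx
      by_cases hxs : x ∈ tsupport χ
      · have hxU := hχU hxs
        have h1 := (contMDiffOn_det hA).contMDiffAt (hv.isOpen.mem_nhds hxU)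
        have h2 : ContDiffAt ℝ ∞ (fun t : ℝ => |t|) (Matrix.of (A x)).det :=
          contDiffAt_abs (hv.det_ne_zero hv' hA hvA ⟨hxU, hx⟩)
        have h3 : ContMDiffAt (cornerModel n) 𝓘(ℝ, ℝ) ∞ (fun x => |(Matrix.of (A x)).det|) x :=
          h2.contMDiffAt.comp x h1
        have h4 : ContMDiffAt (cornerModel n) 𝓘(ℝ, ℂ) ∞
            (fun x => ((χ x * |(Matrix.of (A x)).det| : ℝ) : ℂ)) x :=
          (Complex.ofRealCLM.contDiff.contMDiff.contMDiffAt).comp x (hχ.contMDiffAt.mul h3)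
        refine (h4.congr_of_eventuallyEq ?_).contMDiffWithinAt
        filter_upwards [hv.isOpen.mem_nhds hxU] with y hy
        rw [if_pos hy]
      · refine (contMDiffAt_const (c := (0 : ℂ))).congr_of_eventuallyEq ?_ |>.contMDiffWithinAt
        filter_upwards [(isClosed_tsupport χ).isOpen_compl.mem_nhds hxs] with y hy
        have : χ y = 0 := image_eq_zero_of_notMem_tsupport hy
        simp [this]
    · rintro x ⟨hx, hxi⟩
      by_cases hxU : x ∈ U
      · have h1 : dt x (fun i => v' i x) = (Matrix.of (A x)).det * dt x (fun i => v i x) := by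
          rw [← hdt]
          exact congrArg (dt x) (funext fun i => hvA x hxU i)
        have h2 := abs_ne_zero.2 (hdt0 x ⟨hxU, hxi⟩)
        simp only [if_pos hxU, h1, abs_mul]
        rw [mul_div_cancel_right₀ _ h2]
      · simp only [if_neg hxU]
  · rintro x ⟨hxU, hxi⟩
    have h2 := abs_ne_zero.2 (hdt0 x ⟨hxU, hxi⟩)
    simp only [if_pos hxU, div_self h2, mul_one]

end LieStructure

end

/-! ### Sharpness of the degeneracy index -/

noncomputable section

/-- With only one face present, the exponent k_i - 1 from ρ^z and -k_i from the density add up to -1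
on its coordinate; everything else is a smooth positive factor. -/
theorem CornerData.prod_rpow_eq {n N : ℕ} {D : CornerData n N} {i : Fin N} (hS : D.S = {i})
    {y : EuclideanSpace ℝ (Fin n)} (hy : y ∈ openQuad n) (hW : y ∈ D.W) (k : Fin N → ℕ) :
    (∏ l, D.rho l y ^ ((k i : ℝ) - 1)) * (∏ l, D.rho l y ^ k l)⁻¹ =
      (y (D.idx i))⁻¹ * ∏ l, D.g l y ^ ((k i : ℝ) - 1 - k l) := by
  have h1 : (y (D.idx i))⁻¹ = ∏ l, D.coord l y ^ ((k i : ℝ) - 1 - k l) := by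
    rw [Finset.prod_eq_single i]
    · rw [CornerData.coord, if_pos (by simp [hS]), sub_sub_cancel_left, Real.rpow_neg_one]
    · intro l _ hl
      rw [CornerData.coord, if_neg (by simpa [hS] using hl), Real.one_rpow]
    · simp
  rw [h1, ← Finset.prod_inv_distrib, ← Finset.prod_mul_distrib, ← Finset.prod_mul_distrib]
  refine Finset.prod_congr rfl fun l _ => ?_
  have hg := D.pos l y ⟨hW, openQuad_subset n hy⟩
  rw [← Real.mul_rpow (coord_pos l hy).le hg.le, ← Real.rpow_natCast, ← div_eq_mul_inv,
    ← Real.rpow_sub (rho_pos l hy hW)]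
  rfl

variable {n : ℕ} {M : Type*} [TopologicalSpace M] [ChartedSpace (EuclideanQuadrant n) M]
  [IsManifold (cornerModel n) ∞ M] [T2Space M]
  {N : ℕ} {F : Fin N → Set M} {ρ : Fin N → SmoothFun n M}

theorem pos_of_boundary_nonempty (hbd : ((cornerModel n).boundary M).Nonempty) : 0 < n := by
  obtain ⟨p, hp⟩ := hbd
  rcases Nat.eq_zero_or_pos n with rfl | h
  · rw [← ModelWithCorners.compl_interior] at hp
    refine absurd ((mem_interior_iff (IsManifold.chart_mem_maximalAtlas (n := ∞) p)
      (mem_chart_source _ p)).2 fun i => i.elim0) hp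
  · exact h

/-- A boundary point has a vanishing coordinate, and every vanishing coordinate belongs to some
face. -/
theorem IsHyperfaceSystem.nonempty (hF : IsHyperfaceSystem n F ρ)
    (hbd : ((cornerModel n).boundary M).Nonempty) : Nonempty (Fin N) := by
  have hn := pos_of_boundary_nonempty hbd
  obtain ⟨p, hp⟩ := hbd
  have hc : chartAt (EuclideanQuadrant n) p ∈ IsManifold.maximalAtlas (cornerModel n) ∞ M :=
    IsManifold.chart_mem_maximalAtlas p
  rw [← ModelWithCorners.compl_interior, mem_compl_iff,
    mem_interior_iff hc (mem_chart_source _ p)] at hp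
  obtain ⟨D, -, -, -, -, -, hJ, -⟩ :=
    hF.exists_cornerData hn hc (mem_chart_source _ p) univ_mem
  by_contra hN
  refine hp fun j => lt_of_le_of_ne (extend_mem_quad _ p j) fun h0 => ?_
  obtain ⟨i, -, -⟩ := hJ j h0.symm
  exact hN ⟨i⟩

variable [CompactSpace M]

namespace LieStructure

variable {V : LieStructure n M}

/-- A bump density is placed at a depth-one point `q` of F_i, and the chart is one whose partition
function is positive at `q`. At z = k_i - 1 the integrand has norm u / y_j with `u` continuous and
positive at `q`, while 1/y_j is not integrable near `q`. -/
theorem exists_not_densityIntegrable (hn : 0 < n) (hV : V.IsExact) (hF : IsHyperfaceSystem n F ρ)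
    {k : Fin N → ℕ} (hk : ∀ i, V.IsDegeneracyIndex (F i) (k i)) (i : Fin N) :
    ∃ f : V.Density, ¬ DensityIntegrable (powMul ρ f ((k i : ℂ) - 1)) := by
  obtain ⟨q, hq1, hFq⟩ := hF.exists_point i
  have hqF : q ∈ F i := by
    rw [hFq]; exact subset_closure (mem_connectedComponentIn hq1)
  obtain ⟨p, hp⟩ := (chartPartition n M).exists_pos_of_mem (mem_univ q)
  set c := chartAt (EuclideanQuadrant n) p with hcdef
  have hc : c ∈ IsManifold.maximalAtlas (cornerModel n) ∞ M := IsManifold.chart_mem_maximalAtlas p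
  have hq : q ∈ c.source := tsupport_subset_source p (subset_tsupport _ hp.ne')
  obtain ⟨U, v, hv, hqU, W, hWo, hqW, hWt, hWU, m, hms, hm0, hm⟩ :=
    hV.exists_frameDet hn hF hk hc hq
  obtain ⟨D, hDq, hDW, hDt, hDρ, hDS, -, -⟩ := hF.exists_cornerData hn hc hq (hWo.mem_nhds hqW)
  set y₀ := c.extend (cornerModel n) q with hy₀
  set σ := (c.extend (cornerModel n)).symm with hσ
  have hy₀q : y₀ ∈ quad n := extend_mem_quad c q
  have hσy₀ : σ y₀ = q := extend_symm_apply hq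
  have hiS : i ∈ D.S := by
    by_contra hi
    have h1 := hDρ i _ ⟨hDq, hy₀q⟩
    rw [hσy₀, ((hF.defining i).zero_iff q).2 hqF] at h1
    have h2 := D.pos i _ ⟨hDq, hy₀q⟩
    simp only [CornerData.rho, CornerData.coord, if_neg hi, one_mul] at h1
    linarith
  have hS : D.S = {i} := by
    refine Finset.eq_singleton_iff_unique_mem.2 ⟨hiS, fun l hl => ?_⟩
    rw [depth_eq hc hq, ncard_eq_one] at hq1
    obtain ⟨j, hj⟩ := hq1
    have h1 : D.idx l ∈ ({j} : Set (Fin n)) := hj.subset (hDS l hl)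
    have h2 : D.idx i ∈ ({j} : Set (Fin n)) := hj.subset (hDS i hiS)
    exact D.injOn l hl i hiS ((mem_singleton_iff.1 h1).trans (mem_singleton_iff.1 h2).symm)
  obtain ⟨χ, -, hχ⟩ := (SmoothBumpFunction.nhds_basis_tsupport (I := cornerModel n)
    q).mem_iff.1 (hv.isOpen.mem_nhds hqU)
  obtain ⟨f, hf⟩ := hv.exists_density χ.contMDiff hχ
  refine ⟨f, fun hint => ?_⟩
  let u : EuclideanSpace ℝ (Fin n) → ℝ := fun y =>
    chartPartition n M p (σ y) * χ (σ y) * (m y)⁻¹ * ∏ l, D.g l y ^ ((k i : ℝ) - 1 - k l)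
  have hnorm : ∀ y ∈ D.W ∩ openQuad n,
      ‖cutoffDensity (powMul ρ f ((k i : ℂ) - 1)) p y‖ = (y (D.idx i))⁻¹ * u y := by
    rintro y ⟨hyW, hyo⟩
    have hyq := openQuad_subset n hyo
    have hyt : y ∈ (extChartAt (cornerModel n) p).target := hDt ⟨hyW, hyq⟩
    have hxi : σ y ∈ (cornerModel n).interior M := extChartAt_symm_mem_interior ⟨hyt, hyo⟩
    have hyW' : y ∈ W ∩ quad n := ⟨hDW hyW, hyq⟩
    have hρ : ∀ l, ρ l (σ y) = D.rho l y := fun l => hDρ l y ⟨hyW, hyq⟩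
    have hρ0 : ∀ l, 0 < D.rho l y := fun l => CornerData.rho_pos l hyo hyW
    have hmy := hm0 y hyW'
    have hP : 0 < ∏ l, D.rho l y ^ k l := Finset.prod_pos fun l _ => pow_pos (hρ0 l) _
    have h1 := f.val_eq hc (map_extend_symm c hyt) hxi (fun l => v l (σ y))
    have h2 := hm y hyW'
    unfold frameDet at h2
    have h3 := (hf (σ y) ⟨hWU y hyW', hxi⟩).symm.trans h1
    rw [h2] at h3
    have h4 : ‖f.val (σ y) (chartFrame c (σ y))‖ =
        χ (σ y) * ((m y)⁻¹ * (∏ l, D.rho l y ^ k l)⁻¹) := by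
      have h5 := congrArg norm h3
      rw [norm_mul, Complex.norm_real, Complex.norm_real, Real.norm_of_nonneg χ.nonneg] at h5
      simp only [← hσ, hρ] at h5
      rw [Real.norm_of_nonneg (mul_pos hmy hP).le] at h5
      rw [h5, ← mul_inv, mul_comm (m y * _), mul_assoc, mul_inv_cancel₀ (mul_pos hmy hP).ne',
        mul_one]
    rw [cutoffDensity_powMul hn hF f _ p ⟨hyt, hyo⟩, cutoffDensity_multiPowMul]
    have h6 : ‖∏ l, (ρ l (σ y) : ℂ) ^ ((k i : ℂ) - 1)‖ = ∏ l, D.rho l y ^ ((k i : ℝ) - 1) := by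
      rw [norm_prod]
      refine Finset.prod_congr rfl fun l _ => ?_
      rw [hρ, Complex.norm_cpow_eq_rpow_re_of_pos (hρ0 l)]
      simp
    rw [norm_mul, Complex.norm_real, Real.norm_of_nonneg ((chartPartition n M).nonneg p _)]
    have h7 : ‖(∏ l, (ρ l (σ y) : ℂ) ^ ((k i : ℂ) - 1)) * f.val (σ y) (chartFrame c (σ y))‖ =
        (∏ l, D.rho l y ^ ((k i : ℝ) - 1)) *
          (χ (σ y) * ((m y)⁻¹ * (∏ l, D.rho l y ^ k l)⁻¹)) := by
      rw [← h4, ← h6, ← norm_mul]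
    refine (congrArg (chartPartition n M p (σ y) * ·) h7).trans ?_
    have h8 := CornerData.prod_rpow_eq hS hyo hyW k
    simp only [u]
    linear_combination (chartPartition n M p (σ y) * χ (σ y) * (m y)⁻¹) * h8
  have hσt : Tendsto σ (𝓝[quad n] y₀) (𝓝 q) := by
    have := tendsto_extend_symm c (map_extend (n := n) hq)
    rwa [extend_symm_apply hq] at this
  have hmc : ContinuousWithinAt m (quad n) y₀ := by
    have := hms.continuousOn _ ⟨hqW, hy₀q⟩
    rw [inter_comm] at this
    exact (continuousWithinAt_inter (hWo.mem_nhds hqW)).1 this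
  have hgc : ∀ l, ContinuousWithinAt (D.g l) (quad n) y₀ := by
    intro l
    have := (D.smooth l).continuousOn _ ⟨hDq, hy₀q⟩
    rw [inter_comm] at this
    exact (continuousWithinAt_inter (D.isOpen.mem_nhds hDq)).1 this
  have hut : Tendsto u (𝓝[quad n] y₀) (𝓝 (u y₀)) := by
    have h1 : Tendsto (fun y => chartPartition n M p (σ y)) (𝓝[quad n] y₀)
        (𝓝 (chartPartition n M p (σ y₀))) := by
      rw [hσy₀]
      exact ((chartPartition n M p).contMDiff.continuous.tendsto q).comp hσt
    have h2 : Tendsto (fun y => χ (σ y)) (𝓝[quad n] y₀) (𝓝 (χ (σ y₀))) := by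
      rw [hσy₀]
      exact (χ.continuous.tendsto q).comp hσt
    refine ((h1.mul h2).mul (hmc.tendsto.inv₀ (hm0 y₀ ⟨hqW, hy₀q⟩).ne')).mul
      (tendsto_finsetProd _ fun l _ => ?_)
    exact (hgc l).tendsto.rpow_const (Or.inl (D.pos l y₀ ⟨hDq, hy₀q⟩).ne')
  have hu0 : 0 < u y₀ := by
    simp only [u, hσy₀]
    have h1 : χ q = 1 := χ.eq_one
    have h2 : 0 < (m y₀)⁻¹ := inv_pos.2 (hm0 y₀ ⟨hqW, hy₀q⟩)
    rw [h1]
    refine mul_pos (mul_pos (mul_pos hp one_pos) h2) (Finset.prod_pos fun l _ => ?_)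
    exact Real.rpow_pos_of_pos (D.pos l y₀ ⟨hDq, hy₀q⟩) _
  obtain ⟨O, hO, hyO, hOu⟩ := mem_nhdsWithin.1 (inter_mem
    (hut.eventually (lt_mem_nhds (half_lt_self hu0)))
    (mem_nhdsWithin_of_mem_nhds (D.isOpen.mem_nhds hDq)))
  refine not_integrableOn_coord_inv hy₀q (hDS i hiS) (hO.mem_nhds hyO) ?_
  have hsub : O ∩ openQuad n ⊆ (extChartAt (cornerModel n) p).target := fun y hy =>
    hDt ⟨(hOu ⟨hy.1, openQuad_subset n hy.2⟩).2, openQuad_subset n hy.2⟩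
  have hint' := ((hint p).mono_set hsub).norm.const_mul (u y₀ / 2)⁻¹
  refine Integrable.mono' hint' ((continuous_coord _).measurable.inv.aestronglyMeasurable) ?_
  refine ae_restrict_of_forall_mem (hO.measurableSet.inter (isOpen_openQuad n).measurableSet) ?_
  intro y hy
  obtain ⟨h1, h2⟩ := hOu ⟨hy.1, openQuad_subset n hy.2⟩
  have h1 : u y₀ / 2 < u y := h1
  have hyj : 0 < (y (D.idx i))⁻¹ := inv_pos.2 (hy.2 _)
  rw [hnorm y ⟨h2, hy.2⟩, Real.norm_of_nonneg hyj.le, inv_mul_eq_div,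
    le_div_iff₀ (by positivity : 0 < u y₀ / 2)]
  exact mul_le_mul_of_nonneg_left h1.le hyj.le

/-- If κ < k_i, the point k_i - 1 lies in the open half-plane where convergence is demanded, and
some density diverges there. Conversely, for κ ≥ all k_i the half-plane contains no poles, and the
continuation agrees with `G` on it. -/
theorem regularizesAt_iff (hn : 0 < n) (hV : V.IsExact) (hF : IsHyperfaceSystem n F ρ)
    {k : Fin N → ℕ} (hk : ∀ i, V.IsDegeneracyIndex (F i) (k i)) (κ : ℝ) :
    RegularizesAt V ρ κ ↔ ∀ i, (k i : ℝ) ≤ κ := by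
  constructor
  · intro h i
    by_contra hlt
    push Not at hlt
    obtain ⟨f, hf⟩ := exists_not_densityIntegrable hn hV hF hk i
    refine hf ((h f).1 _ ?_)
    simp only [Complex.sub_re, Complex.natCast_re, Complex.one_re]
    linarith
  · intro h f
    have hd : ∀ p : M, depth n p ≤ n := fun p =>
      (ncard_le_card _).trans_eq (Nat.card_fin n)
    obtain ⟨hint, g, hg, -, hdiag⟩ := f.exists_continuation hn hV hF hk hd
    have hz : ∀ z : ℂ, κ - 1 < z.re → ∀ i, (k i : ℝ) - 1 < z.re := fun z hz i => by
      have := h i; linarith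
    have hgG : ∀ z : ℂ, κ - 1 < z.re → g (fun _ => z) = G ρ f z := fun z hz' => by
      rw [hg _ (hz z hz'), G_eq_multiG hn hF]
    refine ⟨fun z hz' => (densityIntegrable_powMul hn hF f z).2 (hint _ (hz z hz')), ?_,
      fun z => g fun _ => z, fun z _ => (hdiag z).1, fun z hz' => hgG z hz'⟩
    intro z hz'
    have hz' : κ - 1 < z.re := hz'
    refine DifferentiableWithinAt.congr (f := fun z => g fun _ => z) ?_
      (fun w hw => (hgG w hw).symm) (hgG z hz').symm
    refine ((hdiag z).2.1 fun i hi => ?_).differentiableAt.differentiableWithinAt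
    obtain ⟨j, rfl⟩ := hi
    have := hz _ hz' i
    simp only [Complex.sub_re, Complex.natCast_re, Complex.one_re] at this
    have h0 : (0 : ℝ) ≤ j := Nat.cast_nonneg j
    linarith

/-- The admissible κ are the upper bounds of a finite non-empty set, so the least of them is its
maximum. -/
theorem isMinimalIndex_iff [Nonempty (Fin N)] (hn : 0 < n) (hV : V.IsExact)
    (hF : IsHyperfaceSystem n F ρ)
    {k : Fin N → ℕ} (hk : ∀ i, V.IsDegeneracyIndex (F i) (k i)) (κ : ℝ) :
    V.IsMinimalIndex ρ κ ↔ IsGreatest (range fun i => (k i : ℝ)) κ := by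
  have h1 : {κ' : ℝ | RegularizesAt V ρ κ'} = upperBounds (range fun i => (k i : ℝ)) := by
    ext κ'
    rw [mem_ofPred_eq, regularizesAt_iff hn hV hF hk, mem_upperBounds, forall_mem_range]
  obtain ⟨i, hi⟩ := Finite.exists_max fun i => (k i : ℝ)
  have h2 : IsGreatest (range fun i => (k i : ℝ)) (k i : ℝ) :=
    ⟨mem_range_self i, forall_mem_range.2 hi⟩
  unfold IsMinimalIndex
  rw [h1]
  constructor
  · intro h
    have : IsLUB (range fun i => (k i : ℝ)) κ := h
    rwa [this.unique h2.isLUB]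
  · exact fun h => h.isLUB

end LieStructure

end

end LieMfd

/-! ### Assembly of the main theorem -/

theorem proposition5p4 (n : ℕ) (M : Type*) [TopologicalSpace M]
    [ChartedSpace (EuclideanQuadrant n) M] [IsManifold (LieMfd.cornerModel n) ∞ M]
    [T2Space M] [CompactSpace M]
    (hbd : ((LieMfd.cornerModel n).boundary M).Nonempty)
    (V : LieMfd.LieStructure n M) (hV : V.IsExact)
    (N : ℕ) (F : Fin N → Set M) (ρ : Fin N → LieMfd.SmoothFun n M)
    (hF : LieMfd.IsHyperfaceSystem n F ρ) :
    V.Renormalizable ρ ∧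
    ∃ k : Fin N → ℕ,
      (∀ i, V.IsDegeneracyIndex (F i) (k i)) ∧
      (∀ κ : ℝ, V.IsMinimalIndex ρ κ ↔ IsGreatest (Set.range fun i => (k i : ℝ)) κ) ∧
      ∀ f : V.Density,
        -- one complex variable: poles of order at most the maximal codimension of the corners
        -- (simple poles if there are no corners)
        (∃ g : ℂ → ℂ,
          (∀ z : ℂ, (∀ i, (k i : ℝ) - 1 < z.re) → g z = LieMfd.LieStructure.G ρ f z) ∧
          ∀ z : ℂ, MeromorphicAt g z ∧
            ((∀ i, z ∉ LieMfd.poleSet (k i)) → AnalyticAt ℂ g z) ∧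
            ∀ d : ℕ, (∀ p : M, LieMfd.depth n p ≤ d) →
              ((-(d : ℤ) : ℤ) : WithTop ℤ) ≤ meromorphicOrderAt g z) ∧
        -- one complex variable for each face: at most simple poles
        (∀ z : Fin N → ℂ, (∀ i, (k i : ℝ) - 1 < (z i).re) →
          LieMfd.DensityIntegrable (LieMfd.LieStructure.multiPowMul ρ f z)) ∧
        ∃ g : (Fin N → ℂ) → ℂ,
          (∀ z : Fin N → ℂ, (∀ i, (k i : ℝ) - 1 < (z i).re) →
            g z = LieMfd.LieStructure.multiG ρ f z) ∧
          LieMfd.HasSimplePolesAlong (fun i => LieMfd.poleSet (k i)) g := by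
  classical
  have hn := LieMfd.pos_of_boundary_nonempty hbd
  have := hF.nonempty hbd
  choose k hk _ using fun i => LieMfd.LieStructure.exists_isDegeneracyIndex hn hV hF i
  have hmin := LieMfd.LieStructure.isMinimalIndex_iff hn hV hF hk
  have hd : ∃ d : ℕ, ∀ p : M, LieMfd.depth n p ≤ d :=
    ⟨n, fun p => (ncard_le_card _).trans_eq (Nat.card_fin n)⟩
  obtain ⟨i, hi⟩ := Finite.exists_max fun i => (k i : ℝ)
  refine ⟨⟨k i, (hmin _).2 ⟨mem_range_self i, forall_mem_range.2 hi⟩⟩, k, hk, hmin, fun f => ?_⟩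
  -- The continuation has to be fixed before the depth bound `d` is given. Building it with the
  -- least bound gives the estimate on the order for every `d`.
  obtain ⟨hint, g, hg, hpoles, hdiag⟩ := f.exists_continuation hn hV hF hk (Nat.find_spec hd)
  refine ⟨⟨fun z => g fun _ => z, fun z hz => ?_, fun z => ?_⟩, hint, g, hg, hpoles⟩
  · exact (hg _ hz).trans (LieMfd.LieStructure.G_eq_multiG hn hF f z).symm
  · obtain ⟨h1, h2, h3⟩ := hdiag z
    refine ⟨h1, h2, fun d hd' => le_trans ?_ h3⟩
    have := Nat.find_min' hd hd'
    exact_mod_cast (by omega : -(d : ℤ) ≤ -(Nat.find hd : ℤ))
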